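/- Let $d\ge 2$ and let $\Omega\subset\mathbb R^d$ be open and bounded. Let $g(s)=\sum_{i=0}^N a_i s^{\alpha_i}$ for $s\ge 0$, with $N\ge 1$, real exponents $0=\alpha_0<\alpha_1<\dots<\alpha_N$ and coefficients $a_i\ge 0$ with $a_0,a_N>0$. For $\xi\ge 0$ put $K(\xi)=1/g(s(\xi))$, where $s=s(\xi)\ge 0$ is the unique solution of $s\,g(s)=\xi$. Let $$a=\frac{\alpha_N}{\alpha_N+1},\qquad \beta=2-a,\qquad \lambda=\frac{2-a}{1-a},$$ and assume the degree condition $a\le \frac{4}{d+2}$. Write $(\cdot,\cdot)$ and $\|\cdot\|$ for the inner product and norm of $L^2(\Omega)$ or $(L^2(\Omega))^d$, and $\|v\|_1=(\|v\|^2+\|\nabla v\|^2)^{1/2}$ for the norm of $H^1(\Omega)$. Let $r\ge 0$ be an integer and $\sigma>0$. A mesh $\mathcal T_h$ of $\Omega$ of size $h>0$ consists of finitely many pairwise disjoint open sets $T\subset\Omega$ (elements) that cover $\Omega$ up to a null set, each of diameter at most $h$ and star-shaped with respect to every point of some ball of radius $\sigma h$ contained in it (for example a quasi-uniform triangulation,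 possibly with curved simplices at the boundary). Let $W_h$ be the space of discontinuous piecewise polynomials of total degree at most $r$ over $\mathcal T_h$; gradients of elements of $W_h$ are taken element by element. Let $\pi$ be the $L^2$-projection onto $W_h$: $(\pi w,v)=(w,v)$ for all $v\in W_h$. Let $\phi:[0,\infty)\to H^1(\Omega)$ (the extension of the boundary data) be differentiable with derivative $\phi_t$, let $f:[0,\infty)\to L^2(\Omega)$ be such that $\tilde f=f-\phi_t:[0,\infty)\to L^2(\Omega)$ is differentiable with derivative $\tilde f_t$, and assume that $\|\phi_t\|_1^2$ and $\|\tilde f_t\|^2$ are integrable over bounded time intervals. Let $\rho^0\in L^2(\Omega)$ and $\tilde\rho^0=\rho^0-\phi(0)$. Let $\tilde\rho_h:[0,\infty)\to W_h$ be a solution of the semidiscrete problem: it is continuous on $[0,\infty)$, differentiable on $(0,\infty)$ with derivative $\tilde\rho_{h,t}$, satisfies $\tilde\rho_h(0)=\pi\tilde\rho^0$, and, with $\rho_h=\tilde\rho_h+\pi\phi$, $$(\tilde\rho_{h,t},w_h)+\big(K(|\nabla\rho_h|)\nabla\rho_h,\nabla w_h\big)=(\tilde f,w_h)\qquad\text{for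 all } w_h\in W_h,\ t>0 .$$ **Theorem 4.5.** There is a constant $C>0$, depending only on $d$, $\Omega$, the exponents and coefficients of $g$, the degree $r$ and the mesh regularity constant $\sigma$ (hence independent of $h$, of the mesh, of the data $\phi,f,\rho^0$ and of the solution), such that for every continuous nondecreasing function $\mathrm{Env}\,G$ on $[0,\infty)$ with $\mathrm{Env}\,G(t)\ge G(t):=\|\tilde f(t)\|^{\lambda}+\|\phi(t)\|_1^2$ for all $t\ge0$, and for all $t\ge 1$, $$\|\tilde\rho_{h,t}(t)\|^2\le C\left\{1+\|\tilde\rho^0\|^2+\big(\mathrm{Env}\,G(t)\big)^{2/\beta}+\int_{t-1}^{t}\left(\|\phi_t(s)\|_1^2+\|\tilde f_t(s)\|^2\right)ds\right\}.$$ -/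

import Mathlib

open MeasureTheory Set
open scoped ContDiff

namespace Forchheimer

/-! ### The generalized polynomial `g` and the nonlinearity `K` -/

/-- Data of a generalized polynomial `g(s) = a₀ s^{α₀} + ⋯ + a_N s^{α_N}` with `N ≥ 1`, real exponents
`0 = α₀ < α₁ < ⋯ < α_N` and nonnegative coefficients with `a₀ > 0`, `a_N > 0`. -/
structure GenPoly where
  N : ℕ
  one_le_N : 1 ≤ N
  α : Fin (N + 1) → ℝ
  α_zero : α 0 = 0
  α_strictMono : StrictMono α
  coeff : Fin (N + 1) → ℝ
  coeff_nonneg : ∀ i, 0 ≤ coeff i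
  coeff_zero_pos : 0 < coeff 0
  coeff_last_pos : 0 < coeff (Fin.last N)

namespace GenPoly

/-- The function `g`, meant for `s ≥ 0`. -/
noncomputable def g (P : GenPoly) (s : ℝ) : ℝ := ∑ i, P.coeff i * s ^ P.α i

/-- `deg g = α_N`. -/
def deg (P : GenPoly) : ℝ := P.α (Fin.last P.N)

/-- `a = deg g / (deg g + 1)`. -/
noncomputable def a (P : GenPoly) : ℝ := P.deg / (P.deg + 1)

/-- `β = 2 - a`. -/
noncomputable def β (P : GenPoly) : ℝ := 2 - P.a

/-- `λ = (2 - a) / (1 - a)`. -/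
noncomputable def lam (P : GenPoly) : ℝ := (2 - P.a) / (1 - P.a)

lemma α_nonneg (P : GenPoly) (i : Fin (P.N + 1)) : 0 ≤ P.α i := by
  rw [← P.α_zero]
  exact P.α_strictMono.monotone (Fin.zero_le i)

lemma coeff_zero_le_g (P : GenPoly) {s : ℝ} (hs : 0 ≤ s) : P.coeff 0 ≤ P.g s := by
  have h := Finset.single_le_sum (f := fun i => P.coeff i * s ^ P.α i)
    (fun i _ => mul_nonneg (P.coeff_nonneg i) (Real.rpow_nonneg hs _)) (Finset.mem_univ 0)
  simpa [P.α_zero, g] using h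

lemma g_monotoneOn (P : GenPoly) : MonotoneOn P.g (Ici 0) := by
  intro s hs t _ hst
  exact Finset.sum_le_sum fun i _ => mul_le_mul_of_nonneg_left
    (Real.rpow_le_rpow hs hst (P.α_nonneg i)) (P.coeff_nonneg i)

lemma g_continuous (P : GenPoly) : Continuous P.g :=
  continuous_finsetSum _ fun i _ =>
    continuous_const.mul (Real.continuous_rpow_const (P.α_nonneg i))

/-- For `ξ ≥ 0` the equation `s g(s) = ξ` has exactly one solution `s ≥ 0`. -/
theorem existsUnique_sol (P : GenPoly) {ξ : ℝ} (hξ : 0 ≤ ξ) :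
    ∃! s : ℝ, s ∈ Ici (0 : ℝ) ∧ s * P.g s = ξ := by
  have hc := P.coeff_zero_pos
  have hR : 0 ≤ ξ / P.coeff 0 := by positivity
  have hcont : ContinuousOn (fun s => s * P.g s) (Icc 0 (ξ / P.coeff 0)) :=
    (continuous_id.mul P.g_continuous).continuousOn
  have hmem : ξ ∈ Icc ((fun s => s * P.g s) 0) ((fun s => s * P.g s) (ξ / P.coeff 0)) := by
    refine ⟨by simpa using hξ, ?_⟩
    calc ξ = ξ / P.coeff 0 * P.coeff 0 := by field_simp
      _ ≤ _ := mul_le_mul_of_nonneg_left (P.coeff_zero_le_g hR) hR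
  obtain ⟨s, hs, hs'⟩ := intermediate_value_Icc hR hcont hmem
  have hlt : ∀ x y : ℝ, 0 ≤ x → x < y → x * P.g x < y * P.g y := by
    intro x y hx hxy
    have hy : 0 ≤ y := hx.trans hxy.le
    have h1 : P.g x ≤ P.g y := P.g_monotoneOn hx hy hxy.le
    have h2 : 0 < P.g y := hc.trans_le (P.coeff_zero_le_g hy)
    calc x * P.g x ≤ x * P.g y := mul_le_mul_of_nonneg_left h1 hx
      _ < y * P.g y := mul_lt_mul_of_pos_right hxy h2
  refine ⟨s, ⟨hs.1, hs'⟩, ?_⟩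
  rintro t ⟨ht, ht'⟩
  have hs'' : s * P.g s = ξ := hs'
  rcases lt_trichotomy t s with h | h | h
  · have := hlt t s ht h
    linarith
  · exact h
  · have := hlt s t hs.1 h
    linarith

/-- `s(ξ)`: for `ξ ≥ 0` the unique `s ≥ 0` with `s g(s) = ξ`. -/
noncomputable def sol (P : GenPoly) (ξ : ℝ) : ℝ := Function.invFunOn (fun s => s * P.g s) (Ici 0) ξ

lemma sol_spec (P : GenPoly) {ξ : ℝ} (hξ : 0 ≤ ξ) : 0 ≤ P.sol ξ ∧ P.sol ξ * P.g (P.sol ξ) = ξ :=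
  Function.invFunOn_pos (f := fun s => s * P.g s) (P.existsUnique_sol hξ).exists

/-- `K(ξ) = 1 / g(s(ξ))`, for `ξ ≥ 0`. -/
noncomputable def K (P : GenPoly) (ξ : ℝ) : ℝ := 1 / P.g (P.sol ξ)

end GenPoly

/-- `F` is an envelope of `f` on `I`: a continuous, increasing function with `f ≤ F` on `I`. -/
def IsEnvelope (I : Set ℝ) (f F : ℝ → ℝ) : Prop :=
  ContinuousOn F I ∧ MonotoneOn F I ∧ ∀ t ∈ I, f t ≤ F t

/-! ### The Sobolev space `H¹(Ω)` -/

/-- `ℝᵈ` with the Euclidean norm. -/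
abbrev Space (d : ℕ) := EuclideanSpace ℝ (Fin d)

/-- The scalar space `L²(Ω)`. -/
noncomputable abbrev L2 {d : ℕ} (Ω : Set (Space d)) := Lp ℝ 2 (volume.restrict Ω)

/-- The space `(L²(Ω))ᵈ`. -/
noncomputable abbrev L2Vec {d : ℕ} (Ω : Set (Space d)) := Lp (Space d) 2 (volume.restrict Ω)

/-- `ψ` is a test function on `Ω`: smooth with compact support inside `Ω`. -/
def IsTestFunction {d : ℕ} (Ω : Set (Space d)) (ψ : Space d → ℝ) : Prop :=
  ContDiff ℝ ∞ ψ ∧ HasCompactSupport ψ ∧ tsupport ψ ⊆ Ω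

/-- `G` is the weak gradient of `u` on `Ω`: `∫_Ω u ∂ᵢψ = - ∫_Ω Gᵢ ψ` for all test functions `ψ` and all `i`. -/
def IsWeakGradient {d : ℕ} {Ω : Set (Space d)} (u : L2 Ω) (G : L2Vec Ω) : Prop :=
  ∀ ψ : Space d → ℝ, IsTestFunction Ω ψ → ∀ i : Fin d,
    ∫ x in Ω, u x * fderiv ℝ ψ x (EuclideanSpace.single i 1) = - ∫ x in Ω, G x i * ψ x

lemma integrable_mul_partial {d : ℕ} {Ω : Set (Space d)} {ψ : Space d → ℝ}
    (hψ : IsTestFunction Ω ψ) (u : L2 Ω) (i : Fin d) :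
    Integrable (fun x => u x * fderiv ℝ ψ x (EuclideanSpace.single i 1)) (volume.restrict Ω) := by
  have hc : Continuous fun x => fderiv ℝ ψ x (EuclideanSpace.single i 1) :=
    (hψ.1.continuous_fderiv (by simp)).clm_apply continuous_const
  have hs : HasCompactSupport fun x => fderiv ℝ ψ x (EuclideanSpace.single i 1) :=
    hψ.2.1.fderiv_apply (𝕜 := ℝ) _
  exact MemLp.integrable_mul (p := 2) (q := 2) (Lp.memLp u) ((hc.memLp_of_hasCompactSupport hs).restrict Ω)

lemma integrable_coord_mul {d : ℕ} {Ω : Set (Space d)} {ψ : Space d → ℝ}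
    (hψ : IsTestFunction Ω ψ) (G : L2Vec Ω) (i : Fin d) :
    Integrable (fun x => G x i * ψ x) (volume.restrict Ω) := by
  have h1 : MemLp (fun x => G x i) 2 (volume.restrict Ω) :=
    (Lp.memLp G).continuousLinearMap_comp (EuclideanSpace.proj (𝕜 := ℝ) i)
  exact MemLp.integrable_mul (p := 2) (q := 2) h1 ((hψ.1.continuous.memLp_of_hasCompactSupport hψ.2.1).restrict Ω)

/-- `H¹(Ω) = W^{1,2}(Ω)`, realized as the space of pairs `(u, ∇u)` in `L²(Ω) × (L²(Ω))ᵈ`; the inherited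
norm is `‖u‖₁ = (‖u‖² + ‖∇u‖²)^{1/2}`. -/
noncomputable def H1 {d : ℕ} (Ω : Set (Space d)) : Submodule ℝ (WithLp 2 (L2 Ω × L2Vec Ω)) where
  carrier := {p | IsWeakGradient p.fst p.snd}
  zero_mem' := by
    intro ψ hψ i
    have h1 : ∀ᵐ x ∂(volume.restrict Ω), (0 : L2 Ω) x = 0 := Lp.coeFn_zero _ _ _
    have h2 : ∀ᵐ x ∂(volume.restrict Ω), (0 : L2Vec Ω) x = 0 := Lp.coeFn_zero _ _ _
    rw [integral_eq_zero_of_ae, integral_eq_zero_of_ae, neg_zero]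
    · filter_upwards [h2] with x hx
      have e : (0 : WithLp 2 (L2 Ω × L2Vec Ω)).snd x i = 0 := by
        rw [WithLp.zero_snd, hx]; rfl
      simp only [e, zero_mul, Pi.zero_apply]
    · filter_upwards [h1] with x hx
      simp only [WithLp.zero_fst, hx, zero_mul, Pi.zero_apply]
  add_mem' := by
    intro p q hp hq ψ hψ i
    have h1 := Lp.coeFn_add p.fst q.fst
    have h2 := Lp.coeFn_add p.snd q.snd
    have e1 : ∫ x in Ω, (p + q).fst x * fderiv ℝ ψ x (EuclideanSpace.single i 1)
        = ∫ x in Ω, (p.fst x * fderiv ℝ ψ x (EuclideanSpace.single i 1)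
          + q.fst x * fderiv ℝ ψ x (EuclideanSpace.single i 1)) := by
      refine integral_congr_ae ?_
      filter_upwards [h1] with x hx
      simp only [WithLp.add_fst, hx, Pi.add_apply]
      ring
    have e2 : ∫ x in Ω, (p + q).snd x i * ψ x
        = ∫ x in Ω, (p.snd x i * ψ x + q.snd x i * ψ x) := by
      refine integral_congr_ae ?_
      filter_upwards [h2] with x hx
      simp only [WithLp.add_snd, hx, Pi.add_apply, PiLp.add_apply]
      ring
    rw [e1, e2, integral_add (integrable_mul_partial hψ _ i) (integrable_mul_partial hψ _ i),
      integral_add (integrable_coord_mul hψ _ i) (integrable_coord_mul hψ _ i),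
      hp ψ hψ i, hq ψ hψ i]
    ring
  smul_mem' := by
    intro c p hp ψ hψ i
    have h1 := Lp.coeFn_smul c p.fst
    have h2 := Lp.coeFn_smul c p.snd
    have e1 : ∫ x in Ω, (c • p).fst x * fderiv ℝ ψ x (EuclideanSpace.single i 1)
        = ∫ x in Ω, c * (p.fst x * fderiv ℝ ψ x (EuclideanSpace.single i 1)) := by
      refine integral_congr_ae ?_
      filter_upwards [h1] with x hx
      simp only [WithLp.smul_fst, hx, Pi.smul_apply, smul_eq_mul]
      ring
    have e2 : ∫ x in Ω, (c • p).snd x i * ψ x = ∫ x in Ω, c * (p.snd x i * ψ x) := by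
      refine integral_congr_ae ?_
      filter_upwards [h2] with x hx
      simp only [WithLp.smul_snd, hx, Pi.smul_apply, PiLp.smul_apply, smul_eq_mul]
      ring
    rw [e1, e2, integral_const_mul, integral_const_mul, hp ψ hψ i]
    ring

/-- The function in `L²(Ω)` underlying an element of `H¹(Ω)`. -/
noncomputable def H1.fn {d : ℕ} {Ω : Set (Space d)} (u : H1 Ω) : L2 Ω := (u : WithLp 2 (L2 Ω × L2Vec Ω)).fst

/-! ### The finite element space -/

/-- A mesh of `Ω` of size `h` and quasi-uniformity constant `σ`: finitely many pairwise disjoint open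
elements that fill `Ω` up to a null set, each of diameter at most `h` and star-shaped with respect to
some ball of radius `σ h`. Quasi-uniform simplicial triangulations are of this kind (the elements being
the open simplices), and so are those with curved simplices along a smooth boundary. -/
structure Mesh {d : ℕ} (Ω : Set (Space d)) (σ h : ℝ) where
  card : ℕ
  cell : Fin card → Set (Space d)
  isOpen_cell : ∀ T, IsOpen (cell T)
  cell_subset : ∀ T, cell T ⊆ Ω
  disjoint_cell : Pairwise fun T T' => Disjoint (cell T) (cell T')
  cover : volume (Ω \ ⋃ T, cell T) = 0
  dist_le : ∀ T, ∀ x ∈ cell T, ∀ y ∈ cell T, dist x y ≤ h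
  star : ∀ T, ∃ z, Metric.ball z (σ * h) ⊆ cell T ∧
    ∀ y ∈ Metric.ball z (σ * h), StarConvex ℝ y (cell T)

/-- Value of a polynomial in `d` variables at a point of `ℝᵈ`. -/
noncomputable def polyEval {d : ℕ} (p : MvPolynomial (Fin d) ℝ) (x : Space d) : ℝ :=
  MvPolynomial.eval (fun i => x i) p

/-- Gradient of a polynomial in `d` variables at a point of `ℝᵈ`. -/
noncomputable def polyGrad {d : ℕ} (p : MvPolynomial (Fin d) ℝ) (x : Space d) : Space d :=
  WithLp.toLp 2 fun i => polyEval (MvPolynomial.pderiv i p) x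

lemma continuous_polyEval {d : ℕ} (p : MvPolynomial (Fin d) ℝ) : Continuous (polyEval p) :=
  (MvPolynomial.continuous_eval p).comp (by fun_prop)

namespace Mesh

variable {d : ℕ} {Ω : Set (Space d)} {σ h : ℝ}

/-- The space `W_h` of discontinuous piecewise polynomials of degree at most `r`: one polynomial of total
degree at most `r` for each element, independently of each other. -/
abbrev PolySpace (M : Mesh Ω σ h) (r : ℕ) :=
  Fin M.card → MvPolynomial.restrictTotalDegree (Fin d) ℝ r

/-- The values of a piecewise polynomial (and `0` off the elements). -/
noncomputable def eval (M : Mesh Ω σ h) {r : ℕ} (v : M.PolySpace r) (x : Space d) : ℝ :=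
  ∑ T, (M.cell T).indicator (polyEval (v T : MvPolynomial (Fin d) ℝ)) x

/-- The elementwise gradient of a piecewise polynomial (and `0` off the elements). -/
noncomputable def grad (M : Mesh Ω σ h) {r : ℕ} (v : M.PolySpace r) (x : Space d) : Space d :=
  ∑ T, (M.cell T).indicator (polyGrad (v T : MvPolynomial (Fin d) ℝ)) x

lemma isBounded_cell (M : Mesh Ω σ h) (T : Fin M.card) : Bornology.IsBounded (M.cell T) :=
  Metric.isBounded_iff.2 ⟨h, fun x hx y hy => M.dist_le T x hx y hy⟩

lemma memLp_eval (M : Mesh Ω σ h) {r : ℕ} (v : M.PolySpace r) :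
    MemLp (M.eval v) 2 (volume.restrict Ω) := by
  refine memLp_finsetSum _ fun T _ => ?_
  rw [memLp_indicator_iff_restrict (M.isOpen_cell T).measurableSet]
  have hfin : IsFiniteMeasure ((volume.restrict Ω).restrict (M.cell T)) :=
    ⟨by
      rw [Measure.restrict_apply_univ]
      exact (Measure.restrict_apply_le _ _).trans_lt (M.isBounded_cell T).measure_lt_top⟩
  obtain ⟨B, hB⟩ := (M.isBounded_cell T).isCompact_closure.exists_bound_of_continuousOn
    (continuous_polyEval (v T : MvPolynomial (Fin d) ℝ)).continuousOn
  refine MemLp.of_bound (continuous_polyEval _).aestronglyMeasurable B ?_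
  filter_upwards [ae_restrict_mem (M.isOpen_cell T).measurableSet] with x hx
  exact hB x (subset_closure hx)

lemma eval_add (M : Mesh Ω σ h) {r : ℕ} (v w : M.PolySpace r) :
    M.eval (v + w) = M.eval v + M.eval w := by
  funext x
  simp only [eval, Pi.add_apply, ← Finset.sum_add_distrib]
  refine Finset.sum_congr rfl fun T _ => ?_
  by_cases hx : x ∈ M.cell T <;> simp [hx, polyEval]

lemma eval_smul (M : Mesh Ω σ h) {r : ℕ} (c : ℝ) (v : M.PolySpace r) :
    M.eval (c • v) = c • M.eval v := by
  funext x
  simp only [eval, Pi.smul_apply, smul_eq_mul, Finset.mul_sum]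
  refine Finset.sum_congr rfl fun T _ => ?_
  by_cases hx : x ∈ M.cell T <;> simp [hx, polyEval]

/-- A piecewise polynomial as an element of `L²(Ω)`. -/
noncomputable def toL2 (M : Mesh Ω σ h) (r : ℕ) : M.PolySpace r →ₗ[ℝ] L2 Ω where
  toFun v := (M.memLp_eval v).toLp (M.eval v)
  map_add' v w := by
    rw [← MemLp.toLp_add]
    congr 1
    exact M.eval_add v w
  map_smul' c v := by
    rw [RingHom.id_apply, ← MemLp.toLp_const_smul]
    congr 1
    exact M.eval_smul c v

theorem exists_proj (M : Mesh Ω σ h) (r : ℕ) (w : L2 Ω) :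
    ∃ p : M.PolySpace r, ∀ v, inner ℝ (M.toL2 r p) (M.toL2 r v) = inner ℝ w (M.toL2 r v) := by
  obtain ⟨p, hp⟩ := ((M.toL2 r).range.starProjection_apply_mem w)
  refine ⟨p, fun v => ?_⟩
  rw [hp]
  have := Submodule.starProjection_inner_eq_zero (K := (M.toL2 r).range) w (M.toL2 r v) ⟨v, rfl⟩
  rw [inner_sub_left] at this
  linarith

/-- The `L²`-projection `π` onto `W_h`: the piecewise polynomial with `(π w, v) = (w, v)` for all
`v ∈ W_h`. -/
noncomputable def proj (M : Mesh Ω σ h) (r : ℕ) (w : L2 Ω) : M.PolySpace r := (M.exists_proj r w).choose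

lemma proj_spec (M : Mesh Ω σ h) (r : ℕ) (w : L2 Ω) (v : M.PolySpace r) :
    inner ℝ (M.toL2 r (M.proj r w)) (M.toL2 r v) = inner ℝ w (M.toL2 r v) :=
  (M.exists_proj r w).choose_spec v

/-- `u = ρ̃_h` with time derivative `ut = ρ̃_{h,t}` solves the semidiscrete problem with boundary data
extension `φ`, right-hand side `F = f̃` and initial value `u₀ = ρ̃⁰`: with `ρ_h = ρ̃_h + π φ`,
`(ρ̃_{h,t}, w) + (K(|∇ρ_h|) ∇ρ_h, ∇w) = (f̃, w)` for all `w ∈ W_h` and all `t > 0`, `ρ̃_h(0) = π ρ̃⁰`, and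
`ρ̃_h` is continuous up to `t = 0`. Gradients of elements of `W_h` are taken elementwise. -/
structure IsSemidiscreteSolution (M : Mesh Ω σ h) (P : GenPoly) {r : ℕ} (φ : ℝ → H1 Ω) (F : ℝ → L2 Ω)
    (u₀ : L2 Ω) (u ut : ℝ → M.PolySpace r) : Prop where
  continuousOn : ContinuousOn (fun t => M.toL2 r (u t)) (Ici 0)
  hasDerivAt : ∀ t, 0 < t → HasDerivAt (fun s => M.toL2 r (u s)) (M.toL2 r (ut t)) t
  equation : ∀ t, 0 < t → ∀ w : M.PolySpace r,
    inner ℝ (M.toL2 r (ut t)) (M.toL2 r w)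
      + ∫ x in Ω, inner ℝ (P.K ‖M.grad (u t + M.proj r (H1.fn (φ t))) x‖ • M.grad (u t + M.proj r (H1.fn (φ t))) x)
          (M.grad w x)
      = inner ℝ (F t) (M.toL2 r w)
  initial : u 0 = M.proj r u₀

end Mesh

end Forchheimer

/-!
The semidiscrete problem is an ODE `(U', w) + (A p, ∇w) = (F, w)` in a finite-dimensional subspace
of `L²`, where `p = ∇(U + πφ)` and `A` is a cocoercive gradient field, hence Lipschitz, but
degenerate: `(A p, p)` grows only like `‖p‖ ^ β` with `β < 2`.

* Test with the part of `U` orthogonal to `ker ∇`. Its `β`-th power is bounded by the dissipation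
  `(A p, p)` and the data through a broken Poincaré inequality; there `a ≤ 4 / (d + 2)` enters, each
  cell contributing the power `1 + d / 2 - d / β ≥ 0` of the mesh size. Comparison with a scalar ODE
  bounds this part of `U` by the data up to time `t`, and then the dissipation over a unit time
  interval. The part of `U` in `ker ∇` is never needed, since only `∇U` enters the equation.
* Testing with `U'` makes the flux term the time derivative of the potential of `A`. With a weight
  in time this bounds `∫ ‖U'‖²` by the dissipation and the data.
* `U'` need not be differentiable in time. Instead, subtract the equation at time `s - δ` from that
  at time `s` and test with the increment of `U`. By cocoercivity and a weight in time,
  `‖U t - U (t - δ)‖² / δ²` is bounded by `∫ ‖U'‖²` and the data; then let `δ → 0`.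
-/

namespace Forchheimer

section TimeCalculus

open Filter Topology

lemma sub_le_integral_of_hasDerivAt_le {g g' ψ : ℝ → ℝ} {a b : ℝ} (hab : a ≤ b)
    (hg : ContinuousOn g (Icc a b)) (hd : ∀ s ∈ Ioo a b, HasDerivAt g (g' s) s)
    (hψ : IntervalIntegrable ψ volume a b) (hle : ∀ s ∈ Ioo a b, g' s ≤ ψ s) :
    g b - g a ≤ ∫ s in a..b, ψ s :=
  intervalIntegral.sub_le_integral_of_hasDeriv_right_of_le hab hg
    (fun s hs => (hd s hs).hasDerivWithinAt)
    ((intervalIntegrable_iff_integrableOn_Icc_of_le hab).1 hψ) hle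

lemma intervalIntegrable_mono_Icc {f : ℝ → ℝ} {a b s t : ℝ} (hsa : s ≤ a) (hab : a ≤ b)
    (hbt : b ≤ t) (hint : IntervalIntegrable f volume s t) : IntervalIntegrable f volume a b :=
  hint.mono_set (by
    rw [uIcc_of_le hab, uIcc_of_le (hsa.trans (hab.trans hbt))]
    exact Icc_subset_Icc hsa hbt)

lemma intervalIntegrable_of_continuousOn_Ici {f : ℝ → ℝ} {a s t : ℝ}
    (hf : ContinuousOn f (Ici a)) (hs : a ≤ s) (hst : s ≤ t) : IntervalIntegrable f volume s t :=
  (hf.mono (by rw [uIcc_of_le hst]; exact fun x hx => hs.trans hx.1)).intervalIntegrable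

lemma integral_sub_shift_le_of_monotoneOn {I : ℝ → ℝ} {b t δ : ℝ} (hbt : b ≤ t) (hδ : 0 ≤ δ)
    (hI : MonotoneOn I (Icc (b - δ) t)) :
    ∫ τ in b..t, (I τ - I (τ - δ)) ≤ δ * (I t - I (b - δ)) := by
  have hint {x y : ℝ} (hx : x ∈ Icc (b - δ) t) (hy : y ∈ Icc (b - δ) t) :
      IntervalIntegrable I volume x y :=
    (hI.mono (uIcc_subset_Icc hx hy)).intervalIntegrable
  have hb : b ∈ Icc (b - δ) t := ⟨by linarith, hbt⟩
  have ht : t ∈ Icc (b - δ) t := ⟨by linarith, le_rfl⟩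
  have hb' : b - δ ∈ Icc (b - δ) t := ⟨le_rfl, by linarith⟩
  have ht' : t - δ ∈ Icc (b - δ) t := ⟨by linarith, by linarith⟩
  have hshift : IntervalIntegrable (fun τ => I (τ - δ)) volume b t := by
    simpa using (hint hb' ht').comp_sub_right δ
  have htail : ∫ τ in (t - δ)..t, I τ ≤ δ * I t := by
    calc ∫ τ in (t - δ)..t, I τ ≤ ∫ _ in (t - δ)..t, I t :=
          intervalIntegral.integral_mono_on (by linarith) (hint ht' ht) intervalIntegrable_const
            fun τ hτ => hI ⟨by linarith [hτ.1], hτ.2⟩ ht hτ.2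
      _ = δ * I t := by simp
  have hhead : δ * I (b - δ) ≤ ∫ τ in (b - δ)..b, I τ := by
    calc δ * I (b - δ) = ∫ _ in (b - δ)..b, I (b - δ) := by simp
      _ ≤ ∫ τ in (b - δ)..b, I τ :=
          intervalIntegral.integral_mono_on (by linarith) intervalIntegrable_const (hint hb' hb)
            fun τ hτ => hI hb' ⟨hτ.1, hτ.2.trans hbt⟩ hτ.1
  rw [intervalIntegral.integral_sub (hint hb ht) hshift,
    intervalIntegral.integral_comp_sub_right I δ]
  have hsplit₁ := intervalIntegral.integral_add_adjacent_intervals (hint hb' hb) (hint hb ht)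
  have hsplit₂ := intervalIntegral.integral_add_adjacent_intervals (hint hb' ht') (hint ht' ht)
  linarith

lemma intervalIntegrable_norm_sub_shift_sq {E : Type*} [NormedAddCommGroup E] {X : ℝ → E}
    {a s t δ : ℝ} (hX : ContinuousOn X (Ici a)) (hδ : 0 ≤ δ) (hs : a + δ ≤ s) (hst : s ≤ t) :
    IntervalIntegrable (fun τ => ‖X τ - X (τ - δ)‖ ^ 2) volume s t := by
  refine intervalIntegrable_of_continuousOn_Ici (a := s) ?_ le_rfl hst
  exact ((hX.mono (Ici_subset_Ici.2 (by linarith))).sub (hX.comp (by fun_prop) fun τ hτ =>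
    le_sub_iff_add_le.2 (hs.trans hτ))).norm.pow 2

section NormedSpace

variable {E : Type*} [NormedAddCommGroup E] [NormedSpace ℝ E]

lemma norm_sub_sq_le_mul_integral {X X' : ℝ → E} {s t : ℝ} (hst : s ≤ t)
    (hX : ∀ τ ∈ Icc s t, HasDerivAt X (X' τ) τ)
    (hint : IntervalIntegrable (fun τ => ‖X' τ‖ ^ 2) volume s t) :
    ‖X t - X s‖ ^ 2 ≤ (t - s) * ∫ τ in s..t, ‖X' τ‖ ^ 2 := by
  rcases hst.eq_or_lt with rfl | hlt
  · simp
  set Z := X t - X s with hZ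
  obtain ⟨f, hf, hfZ⟩ := exists_dual_vector'' ℝ Z
  have hd : ∀ τ ∈ Icc s t, HasDerivAt (fun τ => 2 * (t - s) * ‖Z‖ * f (X τ))
      (2 * (t - s) * ‖Z‖ * f (X' τ)) τ := fun τ hτ =>
    (f.hasFDerivAt.comp_hasDerivAt τ (hX τ hτ)).const_mul _
  have hpoint (τ : ℝ) : 2 * (t - s) * ‖Z‖ * f (X' τ) ≤ ‖Z‖ ^ 2 + (t - s) ^ 2 * ‖X' τ‖ ^ 2 := by
    have hfX : f (X' τ) ≤ ‖X' τ‖ :=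
      (le_abs_self _).trans (by simpa using f.le_of_opNorm_le hf (X' τ))
    have hmul := mul_le_mul_of_nonneg_left hfX (mul_nonneg (sub_nonneg.2 hst) (norm_nonneg Z))
    nlinarith [sq_nonneg (‖Z‖ - (t - s) * ‖X' τ‖)]
  have key := sub_le_integral_of_hasDerivAt_le hst
    (fun τ hτ => (hd τ hτ).continuousAt.continuousWithinAt)
    (fun τ hτ => hd τ (Ioo_subset_Icc_self hτ))
    ((intervalIntegrable_const (c := ‖Z‖ ^ 2)).add (hint.const_mul ((t - s) ^ 2)))
    (fun τ _ => hpoint τ)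
  rw [← mul_sub, ← map_sub, ← hZ, hfZ, RCLike.ofReal_real_eq_id, id,
    intervalIntegral.integral_add intervalIntegrable_const (hint.const_mul _),
    intervalIntegral.integral_const, intervalIntegral.integral_const_mul, smul_eq_mul] at key
  refine le_of_mul_le_mul_left (a := t - s) ?_ (sub_pos.2 hlt)
  linarith

lemma integral_norm_sub_shift_sq_le {X X' : ℝ → E} {b t δ : ℝ} (hbt : b ≤ t) (hδ : 0 ≤ δ)
    (hX : ∀ τ ∈ Icc (b - δ) t, HasDerivAt X (X' τ) τ)
    (hint : IntervalIntegrable (fun τ => ‖X' τ‖ ^ 2) volume (b - δ) t) :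
    ∫ τ in b..t, ‖X τ - X (τ - δ)‖ ^ 2 ≤ δ ^ 2 * ∫ τ in (b - δ)..t, ‖X' τ‖ ^ 2 := by
  set I : ℝ → ℝ := fun τ => ∫ s in (b - δ)..τ, ‖X' s‖ ^ 2 with hI
  have hsub {x y : ℝ} (hx : b - δ ≤ x) (hxy : x ≤ y) (hy : y ≤ t) :
      IntervalIntegrable (fun τ => ‖X' τ‖ ^ 2) volume x y :=
    intervalIntegrable_mono_Icc hx hxy hy hint
  have hI_sub {x y : ℝ} (hx : b - δ ≤ x) (hxy : x ≤ y) (hy : y ≤ t) :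
      I y - I x = ∫ s in x..y, ‖X' s‖ ^ 2 :=
    intervalIntegral.integral_interval_sub_left (hsub le_rfl (hx.trans hxy) hy)
      (hsub le_rfl hx (hxy.trans hy))
  have hmono : MonotoneOn I (Icc (b - δ) t) := fun x hx y hy hxy => by
    rw [← sub_nonneg, hI_sub hx.1 hxy hy.2]
    exact intervalIntegral.integral_nonneg hxy fun _ _ => sq_nonneg _
  have hXc : ContinuousOn X (Icc (b - δ) t) :=
    fun τ hτ => (hX τ hτ).continuousAt.continuousWithinAt
  have hshift : MapsTo (fun τ => τ - δ) (Icc b t) (Icc (b - δ) t) :=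
    fun τ hτ => ⟨by linarith [hτ.1], by linarith [hτ.2]⟩
  have hcont : ContinuousOn (fun τ => ‖X τ - X (τ - δ)‖ ^ 2) (uIcc b t) := by
    rw [uIcc_of_le hbt]
    exact ((hXc.mono (Icc_subset_Icc_left (by linarith))).sub
      (hXc.comp (by fun_prop) hshift)).norm.pow 2
  have hIint : IntervalIntegrable (fun τ => I τ - I (τ - δ)) volume b t := by
    have h1 : MonotoneOn I (uIcc b t) :=
      hmono.mono (by rw [uIcc_of_le hbt]; exact Icc_subset_Icc_left (by linarith))
    have h2 : MonotoneOn (fun τ => I (τ - δ)) (uIcc b t) := by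
      rw [uIcc_of_le hbt]
      exact fun x hx y hy hxy => hmono (hshift hx) (hshift hy) (by linarith)
    exact h1.intervalIntegrable.sub h2.intervalIntegrable
  calc ∫ τ in b..t, ‖X τ - X (τ - δ)‖ ^ 2
      ≤ ∫ τ in b..t, δ * (I τ - I (τ - δ)) := by
        refine intervalIntegral.integral_mono_on hbt hcont.intervalIntegrable
          (hIint.const_mul δ) fun τ hτ => ?_
        have hτ₀ : b - δ ≤ τ - δ := by linarith [hτ.1]
        rw [hI_sub hτ₀ (by linarith) hτ.2]
        simpa using norm_sub_sq_le_mul_integral (by linarith : τ - δ ≤ τ)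
          (fun x hx => hX x ⟨hτ₀.trans hx.1, hx.2.trans hτ.2⟩)
          (hsub hτ₀ (by linarith) hτ.2)
    _ ≤ δ * (δ * (I t - I (b - δ))) := by
        rw [intervalIntegral.integral_const_mul]
        exact mul_le_mul_of_nonneg_left (integral_sub_shift_le_of_monotoneOn hbt hδ hmono) hδ
    _ = δ ^ 2 * ∫ τ in (b - δ)..t, ‖X' τ‖ ^ 2 := by
        simp only [hI, intervalIntegral.integral_same, sub_zero]
        ring

lemma integral_norm_sub_shift_sq_le_of_le {X X' : ℝ → E} {a b t δ : ℝ} (hbt : b ≤ t) (hδ : 0 ≤ δ)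
    (ha : a ≤ b - δ) (hX : ∀ τ ∈ Icc a t, HasDerivAt X (X' τ) τ)
    (hint : IntervalIntegrable (fun τ => ‖X' τ‖ ^ 2) volume a t) :
    ∫ τ in b..t, ‖X τ - X (τ - δ)‖ ^ 2 ≤ δ ^ 2 * ∫ τ in a..t, ‖X' τ‖ ^ 2 := by
  have hδt : b - δ ≤ t := by linarith
  refine (integral_norm_sub_shift_sq_le hbt hδ (fun τ hτ => hX τ ⟨ha.trans hτ.1, hτ.2⟩)
    (intervalIntegrable_mono_Icc ha hδt le_rfl hint)).trans ?_
  exact mul_le_mul_of_nonneg_left (intervalIntegral.integral_mono_interval ha hδt le_rfl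
    (Eventually.of_forall fun _ => sq_nonneg _) hint) (sq_nonneg δ)

end NormedSpace

-- `y` cannot increase while it lies above the level `(K / c) ^ q⁻¹`.
lemma le_add_rpow_of_deriv_le {y y' : ℝ → ℝ} {c K q t : ℝ} (hc : 0 < c) (hK : 0 ≤ K) (hq : 0 < q)
    (ht : 0 ≤ t) (hy : ContinuousOn y (Icc 0 t)) (hy₀ : 0 ≤ y 0)
    (hd : ∀ s ∈ Ioo 0 t, HasDerivAt y (y' s) s)
    (hle : ∀ s ∈ Ioo 0 t, y' s ≤ -c * y s ^ q + K) :
    y t ≤ y 0 + (K / c) ^ (1 / q) := by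
  have hKc : 0 ≤ K / c := by positivity
  set L := y 0 + (K / c) ^ (1 / q) with hL
  have hlevel : (K / c) ^ (1 / q) ≤ L := by linarith
  have hdecr : ∀ s ∈ Ioo 0 t, L < y s → y' s ≤ 0 := fun s hs hLs => by
    have hpow : K / c ≤ y s ^ q := by
      have := Real.rpow_le_rpow (by positivity) (hlevel.trans hLs.le) hq.le
      rwa [← Real.rpow_mul hKc, one_div_mul_cancel hq.ne', Real.rpow_one] at this
    have := (div_le_iff₀ hc).1 hpow
    linarith [hle s hs]
  by_contra! hcon
  set T : Set ℝ := Icc 0 t ∩ y ⁻¹' Iic L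
  have hT : IsClosed T := hy.preimage_isClosed_of_isClosed isClosed_Icc isClosed_Iic
  have hTb : BddAbove T := ⟨t, fun x hx => hx.1.2⟩
  have hs : sSup T ∈ T := hT.csSup_mem
    ⟨0, ⟨le_rfl, ht⟩, by simpa [hL] using Real.rpow_nonneg hKc _⟩ hTb
  set s := sSup T
  have hIoo : Ioo s t ⊆ Ioo 0 t := Ioo_subset_Ioo_left hs.1.1
  have hanti : AntitoneOn y (Icc s t) := by
    refine antitoneOn_of_deriv_nonpos (convex_Icc _ _) (hy.mono (Icc_subset_Icc_left hs.1.1)) ?_ ?_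
    <;> rw [interior_Icc]
    · exact fun x hx => (hd x (hIoo hx)).differentiableAt.differentiableWithinAt
    · intro x hx
      rw [(hd x (hIoo hx)).deriv]
      refine hdecr x (hIoo hx) (not_le.1 fun h => hx.1.not_ge ?_)
      exact le_csSup hTb ⟨Ioo_subset_Icc_self (hIoo hx), h⟩
  have hts : y t ≤ y s := hanti ⟨le_rfl, hs.1.2⟩ ⟨hs.1.2, le_rfl⟩ hs.1.2
  exact hcon.not_ge (hts.trans hs.2)

end TimeCalculus

section Young

lemma exists_mul_le_mul_rpow_add_mul_rpow {p q : ℝ} (hpq : p.HolderConjugate q) {ε : ℝ}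
    (hε : 0 < ε) :
    ∃ C : ℝ, 0 < C ∧ ∀ x y : ℝ, 0 ≤ x → 0 ≤ y → x * y ≤ ε * y ^ p + C * x ^ q := by
  have hp := hpq.pos
  have hq := hpq.symm.pos
  have hεp : 0 < ε * p := mul_pos hε hp
  set k : ℝ := (ε * p) ^ (1 / p) with hk
  have hk₀ : 0 < k := Real.rpow_pos_of_pos hεp _
  have hkp : k ^ p = ε * p := by
    rw [hk, ← Real.rpow_mul hεp.le, one_div_mul_cancel hp.ne', Real.rpow_one]
  refine ⟨(1 / k) ^ q / q, by positivity, fun x y hx hy => ?_⟩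
  calc x * y = k * y * (1 / k * x) := by field_simp
    _ ≤ (k * y) ^ p / p + (1 / k * x) ^ q / q :=
        Real.young_inequality_of_nonneg (by positivity) (by positivity) hpq
    _ = ε * y ^ p + (1 / k) ^ q / q * x ^ q := by
        rw [Real.mul_rpow hk₀.le hy, Real.mul_rpow (by positivity) hx, hkp]
        field_simp

lemma two_mul_mul_le_mul_sq_add_sq_div {ε : ℝ} (hε : 0 < ε) (x y : ℝ) :
    2 * (x * y) ≤ ε * x ^ 2 + y ^ 2 / ε := by
  have h : ε * x ^ 2 + y ^ 2 / ε - 2 * (x * y) = (ε * x - y) ^ 2 / ε := by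
    field_simp
    ring
  have : 0 ≤ (ε * x - y) ^ 2 / ε := by positivity
  linarith

lemma one_add_rpow_le {e q : ℝ} (he : 0 ≤ e) (hq : 1 ≤ q) :
    (1 + e) ^ q ≤ 2 ^ (q - 1) * (1 + e ^ q) := by
  lift e to NNReal using he
  simpa using (NNReal.coe_le_coe.2 (NNReal.rpow_add_le_mul_rpow_add_rpow 1 e hq))

lemma le_one_add_rpow {e q : ℝ} (he : 0 ≤ e) (hq : 1 ≤ q) : e ≤ 1 + e ^ q := by
  rcases le_total e 1 with h | h
  · exact h.trans (le_add_of_nonneg_right (Real.rpow_nonneg he q))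
  · linarith [Real.self_le_rpow_of_one_le h hq]

end Young

/-! ### Abstract Galerkin systems -/

/-- A `κ`-cocoercive vector field on `V` together with a convex potential of which it is the
gradient. The nonlinear flux `p ↦ K(|p|) p` acts on `(L²(Ω))ᵈ` as such a field. -/
structure CocoerciveGradient (V : Type*) [NormedAddCommGroup V] [InnerProductSpace ℝ V]
    (κ : ℝ) where
  field : V → V
  potential : V → ℝ
  field_zero : field 0 = 0
  potential_zero : potential 0 = 0
  cocoercive : ∀ p q, κ * ‖field p - field q‖ ^ 2 ≤ inner ℝ (field p - field q) (p - q)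
  subgradient : ∀ p q, potential q - potential p ≤ inner ℝ (field q) (q - p)

namespace CocoerciveGradient

open Filter Topology

variable {V : Type*} [NormedAddCommGroup V] [InnerProductSpace ℝ V] {κ : ℝ}
  (A : CocoerciveGradient V κ)

lemma mul_norm_field_sq_le (p : V) : κ * ‖A.field p‖ ^ 2 ≤ inner ℝ (A.field p) p := by
  simpa [A.field_zero] using A.cocoercive p 0

lemma inner_field_nonneg (hκ : 0 ≤ κ) (p : V) : 0 ≤ inner ℝ (A.field p) p :=
  (by positivity : 0 ≤ κ * ‖A.field p‖ ^ 2).trans (A.mul_norm_field_sq_le p)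

lemma potential_nonneg (p : V) : 0 ≤ A.potential p := by
  simpa [A.field_zero, A.potential_zero] using A.subgradient p 0

lemma potential_le_inner (p : V) : A.potential p ≤ inner ℝ (A.field p) p := by
  simpa [A.potential_zero] using A.subgradient 0 p

lemma norm_field_sub_le (hκ : 0 < κ) (p q : V) :
    ‖A.field p - A.field q‖ ≤ κ⁻¹ * ‖p - q‖ := by
  have h := (A.cocoercive p q).trans (real_inner_le_norm _ _)
  rcases (norm_nonneg (A.field p - A.field q)).eq_or_lt with h₀ | h₀
  · rw [← h₀]
    positivity
  · rw [inv_mul_eq_div, le_div_iff₀ hκ]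
    refine le_of_mul_le_mul_left (a := ‖A.field p - A.field q‖) ?_ h₀
    linarith

lemma lipschitzWith_field (hκ : 0 < κ) : LipschitzWith ⟨κ⁻¹, inv_nonneg.2 hκ.le⟩ A.field :=
  LipschitzWith.of_dist_le_mul fun p q => by
    rw [dist_eq_norm, dist_eq_norm]
    exact A.norm_field_sub_le hκ p q

lemma continuous_field (hκ : 0 < κ) : Continuous A.field := (A.lipschitzWith_field hκ).continuous

lemma hasFDerivAt_potential (hκ : 0 < κ) (p : V) :
    HasFDerivAt A.potential (innerSL ℝ (A.field p)) p := by
  rw [hasFDerivAt_iff_isLittleO_nhds_zero]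
  have hquad : (fun v : V => A.potential (p + v) - A.potential p - innerSL ℝ (A.field p) v)
      =O[𝓝 0] fun v => ‖v‖ ^ 2 := by
    refine Asymptotics.IsBigO.of_bound κ⁻¹ (Eventually.of_forall fun v => ?_)
    have hupper := A.subgradient p (p + v)
    have hlower := A.subgradient (p + v) p
    have hlip : inner ℝ (A.field (p + v) - A.field p) v ≤ κ⁻¹ * ‖v‖ ^ 2 := by
      have := A.norm_field_sub_le hκ (p + v) p
      rw [add_sub_cancel_left] at this
      calc _ ≤ ‖A.field (p + v) - A.field p‖ * ‖v‖ := real_inner_le_norm _ _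
        _ ≤ κ⁻¹ * ‖v‖ * ‖v‖ := mul_le_mul_of_nonneg_right this (norm_nonneg _)
        _ = κ⁻¹ * ‖v‖ ^ 2 := by ring
    have hκv : 0 ≤ κ⁻¹ * ‖v‖ ^ 2 := by positivity
    rw [add_sub_cancel_left] at hupper
    rw [sub_add_cancel_left, inner_neg_right] at hlower
    rw [inner_sub_left] at hlip
    rw [innerSL_apply_apply, Real.norm_eq_abs, norm_pow, norm_norm, abs_le]
    constructor <;> linarith
  refine hquad.trans_isLittleO ?_
  simpa using Asymptotics.isLittleO_norm_pow_id (E' := V) one_lt_two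

end CocoerciveGradient

/-- A Galerkin discretization of a degenerate parabolic equation: a trial space `S` with a gradient
`grad`, a nonlinear flux `A` and a lifting `lift` of the boundary data into the space of gradients.
The Poincaré inequality holds modulo `ker grad` and only to the power `β`, the growth rate of the
dissipation; it is stated with the full gradient `p` of the unknown, of which `grad w` is the
discrete part. -/
structure GalerkinSystem {H : Type*} [NormedAddCommGroup H] [InnerProductSpace ℝ H]
    (S : Submodule ℝ H) (V X : Type*) [NormedAddCommGroup V] [InnerProductSpace ℝ V]
    [NormedAddCommGroup X] [NormedSpace ℝ X] (κ c C β : ℝ) where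
  A : CocoerciveGradient V κ
  grad : S →L[ℝ] V
  lift : X →L[ℝ] V
  norm_lift_sq_le : ∀ x, ‖lift x‖ ^ 2 ≤ c * ‖x‖ ^ 2
  poincare : ∀ w p, ∃ z ∈ grad.ker,
    ‖w - z‖ ^ β ≤ C * (1 + inner ℝ (A.field p) p + ‖p - grad w‖ ^ 2)

namespace GalerkinSystem

open Filter Topology

variable {H V X : Type*} [NormedAddCommGroup H] [InnerProductSpace ℝ H]
  [NormedAddCommGroup V] [InnerProductSpace ℝ V] [NormedAddCommGroup X] [NormedSpace ℝ X]
  {S : Submodule ℝ H} {κ c C β : ℝ} (𝓖 : GalerkinSystem S V X κ c C β)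
  {φ φt : ℝ → X} {F Ft : ℝ → H} {U Ut : ℝ → S} {s t : ℝ}

/-- The gradient of the full unknown, the discrete part plus the lifted boundary data. -/
def flux (φ : ℝ → X) (U : ℝ → S) (t : ℝ) : V := 𝓖.grad (U t) + 𝓖.lift (φ t)

/-- The dissipation `(A p, p)`, `p` being the gradient of the full unknown. -/
noncomputable def diss (φ : ℝ → X) (U : ℝ → S) (t : ℝ) : ℝ :=
  inner ℝ (𝓖.A.field (𝓖.flux φ U t)) (𝓖.flux φ U t)

/-- `U` solves `(U', w) + (A (grad U + lift φ), grad w) = (F, w)` for all `w ∈ S`, for positive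
times. -/
structure IsSolution (φ φt : ℝ → X) (F Ft : ℝ → H) (U Ut : ℝ → S) : Prop where
  data_hasDerivWithinAt : ∀ t, 0 ≤ t → HasDerivWithinAt φ (φt t) (Ici 0) t
  source_hasDerivWithinAt : ∀ t, 0 ≤ t → HasDerivWithinAt F (Ft t) (Ici 0) t
  continuousOn : ContinuousOn U (Ici 0)
  hasDerivAt : ∀ t, 0 < t → HasDerivAt U (Ut t) t
  equation : ∀ t, 0 < t → ∀ w : S,
    inner ℝ (Ut t) w + inner ℝ (𝓖.A.field (𝓖.flux φ U t)) (𝓖.grad w) = inner ℝ (F t) (w : H)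

lemma grad_eq_flux_sub : 𝓖.grad (U t) = 𝓖.flux φ U t - 𝓖.lift (φ t) := by
  simp [flux]

lemma diss_nonneg (hκ : 0 ≤ κ) : 0 ≤ 𝓖.diss φ U t := 𝓖.A.inner_field_nonneg hκ _

lemma two_mul_norm_mul_norm_lift_le {ε : ℝ} (hε : 0 < ε) (v : V) (x : X) :
    2 * (‖v‖ * ‖𝓖.lift x‖) ≤ ε * ‖v‖ ^ 2 + c / ε * ‖x‖ ^ 2 := by
  have hyoung := two_mul_mul_le_mul_sq_add_sq_div hε ‖v‖ ‖𝓖.lift x‖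
  have hlift := div_le_div_of_nonneg_right (𝓖.norm_lift_sq_le x) hε.le
  rw [mul_div_right_comm] at hlift
  linarith

namespace IsSolution

variable {𝓖}

lemma data_hasDerivAt (h : 𝓖.IsSolution φ φt F Ft U Ut) (ht : 0 < t) : HasDerivAt φ (φt t) t :=
  (h.data_hasDerivWithinAt t ht.le).hasDerivAt (Ici_mem_nhds ht)

lemma source_hasDerivAt (h : 𝓖.IsSolution φ φt F Ft U Ut) (ht : 0 < t) : HasDerivAt F (Ft t) t :=
  (h.source_hasDerivWithinAt t ht.le).hasDerivAt (Ici_mem_nhds ht)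

lemma data_continuousOn (h : 𝓖.IsSolution φ φt F Ft U Ut) : ContinuousOn φ (Ici 0) :=
  fun t ht => (h.data_hasDerivWithinAt t ht).continuousWithinAt

lemma source_continuousOn (h : 𝓖.IsSolution φ φt F Ft U Ut) : ContinuousOn F (Ici 0) :=
  fun t ht => (h.source_hasDerivWithinAt t ht).continuousWithinAt

lemma continuousOn_flux (h : 𝓖.IsSolution φ φt F Ft U Ut) :
    ContinuousOn (𝓖.flux φ U) (Ici 0) :=
  (𝓖.grad.continuous.comp_continuousOn h.continuousOn).add
    (𝓖.lift.continuous.comp_continuousOn h.data_continuousOn)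

lemma hasDerivAt_flux (h : 𝓖.IsSolution φ φt F Ft U Ut) (ht : 0 < t) :
    HasDerivAt (𝓖.flux φ U) (𝓖.grad (Ut t) + 𝓖.lift (φt t)) t :=
  (𝓖.grad.hasFDerivAt.comp_hasDerivAt t (h.hasDerivAt t ht)).add
    (𝓖.lift.hasFDerivAt.comp_hasDerivAt t (h.data_hasDerivAt ht))

lemma continuousOn_diss (h : 𝓖.IsSolution φ φt F Ft U Ut) (hκ : 0 < κ) :
    ContinuousOn (𝓖.diss φ U) (Ici 0) :=
  ((𝓖.A.continuous_field hκ).comp_continuousOn h.continuousOn_flux).inner h.continuousOn_flux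

section Complete

variable [CompleteSpace S]

lemma continuousOn_deriv [CompleteSpace V] (h : 𝓖.IsSolution φ φt F Ft U Ut) (hκ : 0 < κ) :
    ContinuousOn Ut (Ioi 0) := by
  have heq : ∀ t ∈ Ioi (0 : ℝ), Ut t = S.orthogonalProjectionOnto (F t)
      - ContinuousLinearMap.adjoint 𝓖.grad (𝓖.A.field (𝓖.flux φ U t)) := fun t ht => by
    refine ext_inner_right ℝ fun w => ?_
    rw [inner_sub_left, ContinuousLinearMap.adjoint_inner_left,
      Submodule.inner_orthogonalProjectionOnto_eq_of_mem_right, ← h.equation t ht w]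
    ring
  refine ContinuousOn.congr (.sub ?_ ?_) heq
  · exact S.orthogonalProjectionOnto.continuous.comp_continuousOn
      (h.source_continuousOn.mono Ioi_subset_Ici_self)
  · exact (ContinuousLinearMap.adjoint 𝓖.grad).continuous.comp_continuousOn
      (((𝓖.A.continuous_field hκ).comp_continuousOn h.continuousOn_flux).mono Ioi_subset_Ici_self)

end Complete

end IsSolution

section Energy

variable [CompleteSpace S]

/-- The orthogonal projection of the trial space onto the complement of `ker grad`. Dissipation
controls the solution only modulo `ker grad`, so this is the part that the energy method bounds. -/
noncomputable def kerPerp : S →L[ℝ] S := 𝓖.grad.kerᗮ.starProjection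

lemma norm_kerPerp_le (w : S) : ‖𝓖.kerPerp w‖ ≤ ‖w‖ :=
  Submodule.norm_starProjection_apply_le _ w

lemma sub_kerPerp_mem_ker (w : S) : w - 𝓖.kerPerp w ∈ 𝓖.grad.ker := by
  rw [← 𝓖.grad.ker.orthogonal_orthogonal]
  exact Submodule.sub_starProjection_mem_orthogonal w

lemma grad_kerPerp (w : S) : 𝓖.grad (𝓖.kerPerp w) = 𝓖.grad w := by
  have h := LinearMap.mem_ker.1 (𝓖.sub_kerPerp_mem_ker w)
  exact (sub_eq_zero.1 ((map_sub 𝓖.grad _ _).symm.trans h)).symm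

lemma norm_kerPerp_rpow_le (hβ : 0 ≤ β) (w : S) (p : V) :
    ‖𝓖.kerPerp w‖ ^ β ≤ C * (1 + inner ℝ (𝓖.A.field p) p + ‖p - 𝓖.grad w‖ ^ 2) := by
  obtain ⟨z, hz, hle⟩ := 𝓖.poincare w p
  have hQz : 𝓖.kerPerp z = 0 :=
    (Submodule.starProjection_apply_eq_zero_iff _).2
      (𝓖.grad.ker.le_orthogonal_orthogonal hz)
  have hnorm : ‖𝓖.kerPerp w‖ ≤ ‖w - z‖ := by
    simpa [hQz] using 𝓖.norm_kerPerp_le (w - z)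
  exact (Real.rpow_le_rpow (norm_nonneg _) hnorm hβ).trans hle

variable {𝓖}

namespace IsSolution

lemma continuousOn_norm_kerPerp_sq (h : 𝓖.IsSolution φ φt F Ft U Ut) :
    ContinuousOn (fun t => ‖𝓖.kerPerp (U t)‖ ^ 2) (Ici 0) :=
  (𝓖.kerPerp.continuous.comp_continuousOn h.continuousOn).norm.pow 2

lemma hasDerivAt_norm_kerPerp_sq (h : 𝓖.IsSolution φ φt F Ft U Ut) (ht : 0 < t) :
    HasDerivAt (fun t => ‖𝓖.kerPerp (U t)‖ ^ 2) (2 * inner ℝ (𝓖.kerPerp (U t)) (Ut t)) t := by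
  have hinner : inner ℝ (𝓖.kerPerp (U t)) (𝓖.kerPerp (Ut t))
      = inner ℝ (𝓖.kerPerp (U t)) (Ut t) := by
    rw [kerPerp, ← Submodule.inner_starProjection_left_eq_right,
      Submodule.starProjection_eq_self_iff.2 (Submodule.starProjection_apply_mem _ _)]
  rw [← hinner]
  exact (𝓖.kerPerp.hasFDerivAt.comp_hasDerivAt t (h.hasDerivAt t ht)).norm_sq

lemma two_mul_inner_kerPerp_deriv_le (h : 𝓖.IsSolution φ φt F Ft U Ut) (hκ : 0 < κ)
    (ht : 0 < t) : 2 * inner ℝ (𝓖.kerPerp (U t)) (Ut t) ≤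
      2 * (‖F t‖ * ‖𝓖.kerPerp (U t)‖) - 𝓖.diss φ U t + c / κ * ‖φ t‖ ^ 2 := by
  have htest := h.equation t ht (𝓖.kerPerp (U t))
  rw [grad_kerPerp, 𝓖.grad_eq_flux_sub (φ := φ), inner_sub_right,
    real_inner_comm (𝓖.kerPerp (U t)) (Ut t)] at htest
  have hsource := real_inner_le_norm (F t) (𝓖.kerPerp (U t) : H)
  have hlift := real_inner_le_norm (𝓖.A.field (𝓖.flux φ U t)) (𝓖.lift (φ t))
  have hyoung := 𝓖.two_mul_norm_mul_norm_lift_le hκ (𝓖.A.field (𝓖.flux φ U t)) (φ t)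
  have hcoer := 𝓖.A.mul_norm_field_sq_le (𝓖.flux φ U t)
  change _ ≤ 𝓖.diss φ U t at hcoer
  change _ + (𝓖.diss φ U t - _) = _ at htest
  rw [← Submodule.coe_norm] at hsource
  linarith

lemma norm_kerPerp_sq_le (h : 𝓖.IsSolution φ φt F Ft U Ut) (hβ : 0 < β) {k L : ℝ} (hk : 0 < k)
    (hL : 0 ≤ L) (ht : 0 ≤ t) (hdecay : ∀ s ∈ Ioo 0 t,
      2 * inner ℝ (𝓖.kerPerp (U s)) (Ut s) ≤ -k * ‖𝓖.kerPerp (U s)‖ ^ β + L) :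
    ‖𝓖.kerPerp (U t)‖ ^ 2 ≤ ‖U 0‖ ^ 2 + (L / k) ^ (2 / β) := by
  have hpow (s : ℝ) : (‖𝓖.kerPerp (U s)‖ ^ 2) ^ (β / 2) = ‖𝓖.kerPerp (U s)‖ ^ β := by
    rw [← Real.rpow_natCast_mul (norm_nonneg _)]
    congr 1
    push_cast
    ring
  have hode := le_add_rpow_of_deriv_le hk hL (half_pos hβ) ht
    (h.continuousOn_norm_kerPerp_sq.mono Icc_subset_Ici_self) (sq_nonneg _)
    (fun s hs => h.hasDerivAt_norm_kerPerp_sq hs.1)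
    (fun s hs => by simpa only [hpow] using hdecay s hs)
  rw [one_div_div] at hode
  have hinit := pow_le_pow_left₀ (norm_nonneg _) (𝓖.norm_kerPerp_le (U 0)) 2
  linarith

lemma integral_diss_le (h : 𝓖.IsSolution φ φt F Ft U Ut) (hκ : 0 < κ) {L : ℝ} (hs : 0 ≤ s)
    (hst : s ≤ t) (henergy : ∀ τ ∈ Ioo s t,
      2 * inner ℝ (𝓖.kerPerp (U τ)) (Ut τ) ≤ -(1 / 2) * 𝓖.diss φ U τ + L) :
    ∫ τ in s..t, 𝓖.diss φ U τ ≤ 2 * ‖𝓖.kerPerp (U s)‖ ^ 2 + 2 * ((t - s) * L) := by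
  have hdiss : IntervalIntegrable (𝓖.diss φ U) volume s t :=
    intervalIntegrable_of_continuousOn_Ici (h.continuousOn_diss hκ) hs hst
  have key := sub_le_integral_of_hasDerivAt_le hst
    (h.continuousOn_norm_kerPerp_sq.mono fun τ hτ => hs.trans hτ.1)
    (fun τ hτ => h.hasDerivAt_norm_kerPerp_sq (hs.trans_lt hτ.1))
    ((hdiss.const_mul (-(1 / 2))).add intervalIntegrable_const) henergy
  rw [intervalIntegral.integral_add (hdiss.const_mul _) intervalIntegrable_const,
    intervalIntegral.integral_const_mul, intervalIntegral.integral_const, smul_eq_mul] at key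
  linarith [sq_nonneg ‖𝓖.kerPerp (U t)‖]

end IsSolution

end Energy

section Derivative

lemma potential_add_mul_deriv_le (hκ : 0 < κ) {w : ℝ}
    (hw : 0 ≤ w) (hw₁ : w ≤ 1) :
    𝓖.A.potential (𝓖.flux φ U t) + w * (inner ℝ (F t) (Ut t : H) - ‖Ut t‖ ^ 2
        + inner ℝ (𝓖.A.field (𝓖.flux φ U t)) (𝓖.lift (φt t)))
      ≤ (1 + 1 / (2 * κ)) * 𝓖.diss φ U t + 1 / 2 * ‖F t‖ ^ 2 + c / 2 * ‖φt t‖ ^ 2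
        - 1 / 2 * (w * ‖Ut t‖ ^ 2) := by
  set p := 𝓖.flux φ U t
  have hpot : 𝓖.A.potential p ≤ 𝓖.diss φ U t := 𝓖.A.potential_le_inner p
  have hcoer : ‖𝓖.A.field p‖ ^ 2 ≤ 1 / κ * 𝓖.diss φ U t := by
    rw [one_div_mul_eq_div, le_div_iff₀' hκ]
    exact 𝓖.A.mul_norm_field_sq_le p
  have hlift := 𝓖.two_mul_norm_mul_norm_lift_le one_pos (𝓖.A.field p) (φt t)
  have hinner := real_inner_le_norm (𝓖.A.field p) (𝓖.lift (φt t))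
  have hsource := real_inner_le_norm (F t) (Ut t : H)
  rw [← Submodule.coe_norm] at hsource
  have hF : w * inner ℝ (F t) (Ut t : H) ≤ 1 / 2 * ‖F t‖ ^ 2 + 1 / 2 * (w * ‖Ut t‖ ^ 2) := by
    nlinarith [mul_le_mul_of_nonneg_left hsource hw, mul_nonneg hw (sq_nonneg (‖F t‖ - ‖Ut t‖)),
      mul_le_mul_of_nonneg_right hw₁ (sq_nonneg ‖F t‖)]
  have hφ : w * inner ℝ (𝓖.A.field p) (𝓖.lift (φt t))
      ≤ 1 / 2 * ‖𝓖.A.field p‖ ^ 2 + c / 2 * ‖φt t‖ ^ 2 := by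
    have hnonneg := mul_nonneg (norm_nonneg (𝓖.A.field p)) (norm_nonneg (𝓖.lift (φt t)))
    linarith [mul_le_mul_of_nonneg_left hinner hw, mul_le_mul_of_nonneg_right hw₁ hnonneg]
  have hκ' : 1 / (2 * κ) * 𝓖.diss φ U t = 1 / 2 * (1 / κ * 𝓖.diss φ U t) := by
    field_simp
  linarith

variable {𝓖}

namespace IsSolution

-- Test with `U'`: the flux term becomes the time derivative of the potential.
lemma hasDerivAt_potential (h : 𝓖.IsSolution φ φt F Ft U Ut) (hκ : 0 < κ) (ht : 0 < t) :
    HasDerivAt (fun t => 𝓖.A.potential (𝓖.flux φ U t))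
      (inner ℝ (F t) (Ut t : H) - ‖Ut t‖ ^ 2
        + inner ℝ (𝓖.A.field (𝓖.flux φ U t)) (𝓖.lift (φt t))) t := by
  have hchain := (𝓖.A.hasFDerivAt_potential hκ _).comp_hasDerivAt t (h.hasDerivAt_flux ht)
  refine hchain.congr_deriv ?_
  have htest := h.equation t ht (Ut t)
  rw [real_inner_self_eq_norm_sq] at htest
  rw [innerSL_apply_apply, inner_add_right]
  linarith

section Complete

variable [CompleteSpace S] [CompleteSpace V]

lemma intervalIntegrable_norm_deriv_sq (h : 𝓖.IsSolution φ φt F Ft U Ut) (hκ : 0 < κ)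
    (hs : 0 < s) (hst : s ≤ t) : IntervalIntegrable (fun τ => ‖Ut τ‖ ^ 2) volume s t :=
  intervalIntegrable_of_continuousOn_Ici (a := s)
    (((h.continuousOn_deriv hκ).mono fun _ hτ => hs.trans_le hτ).norm.pow 2) le_rfl hst

lemma integral_weighted_norm_deriv_sq_le (h : 𝓖.IsSolution φ φt F Ft U Ut) (hκ : 0 < κ)
    (hs : 0 < s) (hst : s ≤ t) (hts : t ≤ s + 1)
    (hφt : IntervalIntegrable (fun τ => ‖φt τ‖ ^ 2) volume s t) :
    ∫ τ in s..t, (τ - s) * ‖Ut τ‖ ^ 2 ≤ 2 * ((1 + 1 / (2 * κ)) * (∫ τ in s..t, 𝓖.diss φ U τ)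
      + 1 / 2 * (∫ τ in s..t, ‖F τ‖ ^ 2) + c / 2 * ∫ τ in s..t, ‖φt τ‖ ^ 2) := by
  have hdiss : IntervalIntegrable (𝓖.diss φ U) volume s t :=
    intervalIntegrable_of_continuousOn_Ici (h.continuousOn_diss hκ) hs.le hst
  have hF : IntervalIntegrable (fun τ => ‖F τ‖ ^ 2) volume s t :=
    intervalIntegrable_of_continuousOn_Ici (h.source_continuousOn.norm.pow 2) hs.le hst
  have hUt : IntervalIntegrable (fun τ => (τ - s) * ‖Ut τ‖ ^ 2) volume s t :=
    (h.intervalIntegrable_norm_deriv_sq hκ hs hst).continuousOn_mul (by fun_prop)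
  have hd : ∀ τ, 0 < τ → HasDerivAt (fun τ => (τ - s) * 𝓖.A.potential (𝓖.flux φ U τ)) _ τ :=
    fun τ hτ => ((hasDerivAt_id' τ).sub_const s).mul (h.hasDerivAt_potential hκ hτ)
  have hsum := ((hdiss.const_mul (1 + 1 / (2 * κ))).add (hF.const_mul (1 / 2))).add
    (hφt.const_mul (c / 2))
  have key := sub_le_integral_of_hasDerivAt_le hst
    (fun τ hτ => (hd τ (hs.trans_le hτ.1)).continuousAt.continuousWithinAt)
    (fun τ hτ => hd τ (hs.trans hτ.1))
    (hsum.sub (hUt.const_mul (1 / 2))) (fun τ hτ => by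
      rw [one_mul]
      exact 𝓖.potential_add_mul_deriv_le hκ (sub_nonneg.2 hτ.1.le) (by linarith [hτ.2]))
  rw [intervalIntegral.integral_sub hsum (hUt.const_mul _),
    intervalIntegral.integral_add ((hdiss.const_mul _).add (hF.const_mul _)) (hφt.const_mul _),
    intervalIntegral.integral_add (hdiss.const_mul _) (hF.const_mul _)] at key
  simp only [intervalIntegral.integral_const_mul, sub_self, zero_mul, sub_zero] at key
  have := mul_nonneg (sub_nonneg.2 hst) (𝓖.A.potential_nonneg (𝓖.flux φ U t))
  linarith

-- The weight is based at `t - 3 / 4` since `U'` need not be square integrable near `0`.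
lemma integral_norm_deriv_sq_le (h : 𝓖.IsSolution φ φt F Ft U Ut) (hκ : 0 < κ) (hc : 0 ≤ c)
    (ht : 1 ≤ t) (hφt : IntervalIntegrable (fun τ => ‖φt τ‖ ^ 2) volume (t - 1) t) :
    ∫ τ in (t - 1 / 2)..t, ‖Ut τ‖ ^ 2 ≤
      8 * ((1 + 1 / (2 * κ)) * (∫ τ in (t - 1)..t, 𝓖.diss φ U τ)
        + 1 / 2 * (∫ τ in (t - 1)..t, ‖F τ‖ ^ 2) + c / 2 * ∫ τ in (t - 1)..t, ‖φt τ‖ ^ 2) := by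
  have hwindow {f : ℝ → ℝ} (hf : ∀ τ, 0 ≤ f τ) (hint : IntervalIntegrable f volume (t - 1) t) :
      ∫ τ in (t - 3 / 4)..t, f τ ≤ ∫ τ in (t - 1)..t, f τ :=
    intervalIntegral.integral_mono_interval (by linarith) (by linarith) le_rfl
      (Eventually.of_forall hf) hint
  have hdiss := hwindow (fun τ => 𝓖.diss_nonneg hκ.le)
    (intervalIntegrable_of_continuousOn_Ici (h.continuousOn_diss hκ) (by linarith) (by linarith))
  have hF := hwindow (fun τ => sq_nonneg _) (intervalIntegrable_of_continuousOn_Ici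
    (h.source_continuousOn.norm.pow 2) (by linarith) (by linarith))
  have hφ := hwindow (fun τ => sq_nonneg _) hφt
  have hUt : IntervalIntegrable (fun τ => ‖Ut τ‖ ^ 2) volume (t - 3 / 4) t :=
    h.intervalIntegrable_norm_deriv_sq hκ (by linarith) (by linarith)
  have hUtw : IntervalIntegrable (fun τ => (τ - (t - 3 / 4)) * ‖Ut τ‖ ^ 2) volume (t - 3 / 4) t :=
    hUt.continuousOn_mul (by fun_prop)
  have hweight : 1 / 4 * ∫ τ in (t - 1 / 2)..t, ‖Ut τ‖ ^ 2
      ≤ ∫ τ in (t - 3 / 4)..t, (τ - (t - 3 / 4)) * ‖Ut τ‖ ^ 2 := by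
    rw [← intervalIntegral.integral_const_mul]
    calc ∫ τ in (t - 1 / 2)..t, 1 / 4 * ‖Ut τ‖ ^ 2
        ≤ ∫ τ in (t - 1 / 2)..t, (τ - (t - 3 / 4)) * ‖Ut τ‖ ^ 2 := by
          refine intervalIntegral.integral_mono_on (by linarith) ?_ ?_ fun τ hτ => ?_
          · exact (intervalIntegrable_mono_Icc (by linarith) (by linarith) le_rfl hUt).const_mul _
          · exact intervalIntegrable_mono_Icc (by linarith) (by linarith) le_rfl hUtw
          · exact mul_le_mul_of_nonneg_right (by linarith [hτ.1]) (sq_nonneg _)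
      _ ≤ _ := by
          refine intervalIntegral.integral_mono_interval (by linarith) (by linarith) le_rfl ?_ hUtw
          refine (ae_restrict_mem measurableSet_Ioc).mono fun τ hτ => ?_
          exact mul_nonneg (sub_nonneg.2 hτ.1.le) (sq_nonneg _)
  have key := h.integral_weighted_norm_deriv_sq_le hκ (s := t - 3 / 4) (by linarith) (by linarith)
    (by linarith) (intervalIntegrable_mono_Icc (by linarith) (by linarith) le_rfl hφt)
  have hdiss' := mul_le_mul_of_nonneg_left hdiss (by positivity : 0 ≤ 1 + 1 / (2 * κ))
  have hφ' := mul_le_mul_of_nonneg_left hφ (by positivity : 0 ≤ c / 2)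
  linarith

end Complete

end IsSolution

end Derivative

section TimeDifference

variable {𝓖}

namespace IsSolution

lemma two_mul_inner_sub_deriv_sub_le (h : 𝓖.IsSolution φ φt F Ft U Ut) (hκ : 0 < κ) (hs : 0 < s)
    (ht : 0 < t) : 2 * inner ℝ (U t - U s) (Ut t - Ut s) ≤
      ‖U t - U s‖ ^ 2 + ‖F t - F s‖ ^ 2 + c / (2 * κ) * ‖φ t - φ s‖ ^ 2 := by
  set z := U t - U s
  set ΔA := 𝓖.A.field (𝓖.flux φ U t) - 𝓖.A.field (𝓖.flux φ U s) with hΔA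
  have htest : inner ℝ z (Ut t - Ut s) + inner ℝ ΔA (𝓖.grad z) = inner ℝ (F t - F s) (z : H) := by
    rw [real_inner_comm, hΔA, inner_sub_left, inner_sub_left, inner_sub_left,
      ← h.equation t ht z, ← h.equation s hs z]
    ring
  have hgrad : 𝓖.grad z = 𝓖.flux φ U t - 𝓖.flux φ U s - 𝓖.lift (φ t - φ s) := by
    simp only [z, flux, map_sub]
    abel
  rw [hgrad, inner_sub_right ΔA] at htest
  have hcoc := 𝓖.A.cocoercive (𝓖.flux φ U t) (𝓖.flux φ U s)
  have hlift := real_inner_le_norm ΔA (𝓖.lift (φ t - φ s))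
  have hyoung := 𝓖.two_mul_norm_mul_norm_lift_le (by positivity : 0 < 2 * κ) ΔA (φ t - φ s)
  have hsource := real_inner_le_norm (F t - F s) (z : H)
  rw [← Submodule.coe_norm] at hsource
  linarith [two_mul_le_add_sq ‖F t - F s‖ ‖z‖]

lemma weighted_norm_sub_shift_sq_le (h : 𝓖.IsSolution φ φt F Ft U Ut) (hκ : 0 < κ) (hc : 0 ≤ c)
    {δ : ℝ} (hδ : 0 < δ) (hs : δ < s) (hst : s ≤ t) (hts : t ≤ s + 1) :
    (t - s) * ‖U t - U (t - δ)‖ ^ 2 ≤ 2 * (∫ τ in s..t, ‖U τ - U (τ - δ)‖ ^ 2)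
      + (∫ τ in s..t, ‖F τ - F (τ - δ)‖ ^ 2)
      + c / (2 * κ) * ∫ τ in s..t, ‖φ τ - φ (τ - δ)‖ ^ 2 := by
  have hδs : 0 + δ ≤ s := by linarith
  have hU := intervalIntegrable_norm_sub_shift_sq h.continuousOn hδ.le hδs hst
  have hF := intervalIntegrable_norm_sub_shift_sq h.source_continuousOn hδ.le hδs hst
  have hφ := intervalIntegrable_norm_sub_shift_sq h.data_continuousOn hδ.le hδs hst
  have hd : ∀ τ, δ < τ → HasDerivAt (fun τ => (τ - s) * ‖U τ - U (τ - δ)‖ ^ 2) _ τ := fun τ hτ =>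
    ((hasDerivAt_id' τ).sub_const s).mul ((h.hasDerivAt τ (hδ.trans hτ)).sub
      ((h.hasDerivAt (τ - δ) (sub_pos.2 hτ)).comp_sub_const τ δ)).norm_sq
  have hsum := ((hU.const_mul 2).add hF).add (hφ.const_mul (c / (2 * κ)))
  have key := sub_le_integral_of_hasDerivAt_le hst
    (fun τ hτ => (hd τ (hs.trans_le hτ.1)).continuousAt.continuousWithinAt)
    (fun τ hτ => hd τ (hs.trans hτ.1)) hsum (fun τ hτ => by
      have hincr := h.two_mul_inner_sub_deriv_sub_le hκ (sub_pos.2 (hs.trans hτ.1))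
        (hδ.trans (hs.trans hτ.1))
      have hbound : 0 ≤ ‖U τ - U (τ - δ)‖ ^ 2 + ‖F τ - F (τ - δ)‖ ^ 2
          + c / (2 * κ) * ‖φ τ - φ (τ - δ)‖ ^ 2 := by positivity
      have := mul_le_mul_of_nonneg_left hincr (sub_nonneg.2 hτ.1.le)
      have := mul_le_mul_of_nonneg_right (by linarith [hτ.2] : τ - s ≤ 1) hbound
      simp only [Pi.sub_apply]
      linarith)
  rw [intervalIntegral.integral_add ((hU.const_mul _).add hF) (hφ.const_mul _),
    intervalIntegral.integral_add (hU.const_mul _) hF] at key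
  simpa only [intervalIntegral.integral_const_mul, sub_self, zero_mul, sub_zero] using key

variable [CompleteSpace S] [CompleteSpace V]

lemma norm_sub_shift_sq_le (h : 𝓖.IsSolution φ φt F Ft U Ut) (hκ : 0 < κ) (hc : 0 ≤ c)
    (ht : 0 < t - 1 / 2) (hφt : IntervalIntegrable (fun τ => ‖φt τ‖ ^ 2) volume (t - 1 / 2) t)
    (hFt : IntervalIntegrable (fun τ => ‖Ft τ‖ ^ 2) volume (t - 1 / 2) t) {δ : ℝ} (hδ : 0 < δ)
    (hδ₁ : δ ≤ 1 / 4) :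
    ‖U t - U (t - δ)‖ ^ 2 ≤ 4 * (2 * (∫ τ in (t - 1 / 2)..t, ‖Ut τ‖ ^ 2)
      + (∫ τ in (t - 1 / 2)..t, ‖Ft τ‖ ^ 2)
      + c / (2 * κ) * ∫ τ in (t - 1 / 2)..t, ‖φt τ‖ ^ 2) * δ ^ 2 := by
  have hbt : t - 1 / 4 ≤ t := by linarith
  have ha : t - 1 / 2 ≤ t - 1 / 4 - δ := by linarith
  have hU := integral_norm_sub_shift_sq_le_of_le hbt hδ.le ha
    (fun τ hτ => h.hasDerivAt τ (ht.trans_le hτ.1))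
    (h.intervalIntegrable_norm_deriv_sq hκ ht (by linarith))
  have hF := integral_norm_sub_shift_sq_le_of_le hbt hδ.le ha
    (fun τ hτ => h.source_hasDerivAt (ht.trans_le hτ.1)) hFt
  have hφ := mul_le_mul_of_nonneg_left (integral_norm_sub_shift_sq_le_of_le hbt hδ.le ha
    (fun τ hτ => h.data_hasDerivAt (ht.trans_le hτ.1)) hφt)
    (by positivity : 0 ≤ c / (2 * κ))
  have key := h.weighted_norm_sub_shift_sq_le hκ hc hδ (s := t - 1 / 4) (t := t) (by linarith)
    (by linarith) (by linarith)
  linarith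

lemma norm_deriv_sq_le (h : 𝓖.IsSolution φ φt F Ft U Ut) (hκ : 0 < κ) (hc : 0 ≤ c)
    (ht : 0 < t - 1 / 2) (hφt : IntervalIntegrable (fun τ => ‖φt τ‖ ^ 2) volume (t - 1 / 2) t)
    (hFt : IntervalIntegrable (fun τ => ‖Ft τ‖ ^ 2) volume (t - 1 / 2) t) :
    ‖Ut t‖ ^ 2 ≤ 4 * (2 * (∫ τ in (t - 1 / 2)..t, ‖Ut τ‖ ^ 2)
      + (∫ τ in (t - 1 / 2)..t, ‖Ft τ‖ ^ 2)
      + c / (2 * κ) * ∫ τ in (t - 1 / 2)..t, ‖φt τ‖ ^ 2) := by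
  have hslope : Tendsto (fun δ => ‖(-δ)⁻¹ • (U (t + -δ) - U t)‖ ^ 2) (𝓝[>] 0)
      (𝓝 (‖Ut t‖ ^ 2)) := by
    have hneg : Tendsto (fun δ : ℝ => -δ) (𝓝[>] 0) (𝓝[≠] 0) := by
      have : Tendsto (fun δ : ℝ => -δ) (𝓝[>] 0) (𝓝[<] 0) := by
        simpa using tendsto_neg_nhdsGT (a := (0 : ℝ))
      exact this.mono_right (nhdsWithin_mono _ fun x hx => ne_of_lt hx)
    exact (((hasDerivAt_iff_tendsto_slope_zero.1
      (h.hasDerivAt t (by linarith))).comp hneg).norm).pow 2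
  refine le_of_tendsto hslope ?_
  filter_upwards [Ioc_mem_nhdsGT (by norm_num : (0 : ℝ) < 1 / 4)] with δ hδ
  have hdiff := h.norm_sub_shift_sq_le hκ hc ht hφt hFt hδ.1 hδ.2
  rw [norm_smul, mul_pow, norm_sub_rev, norm_inv, norm_neg, Real.norm_of_nonneg hδ.1.le, inv_pow,
    inv_mul_le_iff₀ (pow_pos hδ.1 2), ← sub_eq_add_neg, mul_comm (δ ^ 2)]
  exact hdiff

end IsSolution

end TimeDifference

lemma IsSolution.integral_norm_source_sq_le {𝓖 : GalerkinSystem S V X κ c C β}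
    (h : 𝓖.IsSolution φ φt F Ft U Ut) {q E : ℝ}
    (hq : 2 ≤ q) (hs : 0 ≤ s) (hst : s ≤ t)
    (hE : ∀ τ ∈ Icc s t, ‖F τ‖ ^ q ≤ E) :
    ∫ τ in s..t, ‖F τ‖ ^ 2 ≤ (t - s) * (1 + E) := by
  calc ∫ τ in s..t, ‖F τ‖ ^ 2 ≤ ∫ _ in s..t, (1 + E) := by
        refine intervalIntegral.integral_mono_on hst
          (intervalIntegrable_of_continuousOn_Ici (h.source_continuousOn.norm.pow 2) hs hst)
          intervalIntegrable_const fun τ hτ => ?_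
        have hpow : (‖F τ‖ ^ 2) ^ (q / 2) = ‖F τ‖ ^ q := by
          rw [← Real.rpow_natCast_mul (norm_nonneg _)]
          congr 1
          push_cast
          ring
        have := le_one_add_rpow (sq_nonneg ‖F τ‖) (by linarith : 1 ≤ q / 2)
        linarith [hE τ hτ]
    _ = (t - s) * (1 + E) := by rw [intervalIntegral.integral_const, smul_eq_mul]

section EnergyEstimate

variable [CompleteSpace S] {𝓖}

lemma IsSolution.two_mul_inner_kerPerp_deriv_le_diss_and_rpow (h : 𝓖.IsSolution φ φt F Ft U Ut)
    (hκ : 0 < κ) (hc : 0 ≤ c) (hC : 0 < C) (hβ : 0 ≤ β) {q M E : ℝ} (hM : 0 ≤ M)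
    (hyoung : ∀ x y : ℝ, 0 ≤ x → 0 ≤ y → x * y ≤ 1 / (8 * C) * y ^ β + M * x ^ q) (ht : 0 < t)
    (hE : ‖F t‖ ^ q + ‖φ t‖ ^ 2 ≤ E) :
    2 * inner ℝ (𝓖.kerPerp (U t)) (Ut t)
        ≤ -(1 / 2) * 𝓖.diss φ U t + (1 + 2 * M + c / κ + c) * (1 + E) ∧
      2 * inner ℝ (𝓖.kerPerp (U t)) (Ut t)
        ≤ -(1 / (4 * C)) * ‖𝓖.kerPerp (U t)‖ ^ β + (1 + 2 * M + c / κ + c) * (1 + E) := by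
  have henergy := h.two_mul_inner_kerPerp_deriv_le hκ ht
  have hsource := hyoung ‖F t‖ ‖𝓖.kerPerp (U t)‖ (norm_nonneg _) (norm_nonneg _)
  have hlift := 𝓖.norm_lift_sq_le (φ t)
  have hpoinc : 1 / (8 * C) * ‖𝓖.kerPerp (U t)‖ ^ β
      ≤ 1 / 8 * (1 + 𝓖.diss φ U t + ‖𝓖.lift (φ t)‖ ^ 2) := by
    have := mul_le_mul_of_nonneg_left (𝓖.norm_kerPerp_rpow_le hβ (U t) (𝓖.flux φ U t))
      (by positivity : 0 ≤ 1 / (8 * C))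
    rw [𝓖.grad_eq_flux_sub (φ := φ), sub_sub_cancel] at this
    refine this.trans_eq ?_
    rw [diss]
    field_simp
  have hD := 𝓖.diss_nonneg (φ := φ) (U := U) (t := t) hκ.le
  have hFq : 0 ≤ ‖F t‖ ^ q := Real.rpow_nonneg (norm_nonneg _) _
  have hdata : 1 + 2 * M * ‖F t‖ ^ q + (c / κ + c) * ‖φ t‖ ^ 2
      ≤ (1 + 2 * M + c / κ + c) * (1 + E) := by
    have hcκ : 0 ≤ c / κ + c := by positivity
    have hφ := sq_nonneg ‖φ t‖
    nlinarith [mul_nonneg hM (by linarith : 0 ≤ 1 + E - ‖F t‖ ^ q),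
      mul_nonneg hcκ (by linarith : 0 ≤ 1 + E - ‖φ t‖ ^ 2)]
  have hcφ : 0 ≤ c * ‖φ t‖ ^ 2 := by positivity
  have hsplit : -(1 / (4 * C)) * ‖𝓖.kerPerp (U t)‖ ^ β
      = -2 * (1 / (8 * C) * ‖𝓖.kerPerp (U t)‖ ^ β) := by
    field_simp
    ring
  rw [hsplit]
  constructor <;> linarith

lemma IsSolution.integral_diss_le_of_energy (h : 𝓖.IsSolution φ φt F Ft U Ut) (hκ : 0 < κ)
    (hβ₀ : 0 < β) (hβ : β ≤ 2) {k L E : ℝ} (hk : 0 < k) (hL : 0 ≤ L) (hE : 0 ≤ E) (ht : 1 ≤ t)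
    (hdiss : ∀ s ∈ Ioo 0 t,
      2 * inner ℝ (𝓖.kerPerp (U s)) (Ut s) ≤ -(1 / 2) * 𝓖.diss φ U s + L * (1 + E))
    (hdecay : ∀ s ∈ Ioo 0 t,
      2 * inner ℝ (𝓖.kerPerp (U s)) (Ut s) ≤ -k * ‖𝓖.kerPerp (U s)‖ ^ β + L * (1 + E)) :
    ∫ s in (t - 1)..t, 𝓖.diss φ U s
      ≤ (2 + 2 * ((L / k) ^ (2 / β) * 2 ^ (2 / β - 1)) + 4 * L)
        * (1 + ‖U 0‖ ^ 2 + E ^ (2 / β)) := by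
  have hβ₁ : 1 ≤ 2 / β := (one_le_div hβ₀).2 hβ
  set B := (L / k) ^ (2 / β) * 2 ^ (2 / β - 1)
  have hY : 0 ≤ E ^ (2 / β) := Real.rpow_nonneg hE _
  have hEY : L * E ≤ L * (1 + E ^ (2 / β)) :=
    mul_le_mul_of_nonneg_left (le_one_add_rpow hE hβ₁) hL
  have hbound : ‖𝓖.kerPerp (U (t - 1))‖ ^ 2 ≤ ‖U 0‖ ^ 2 + B * (1 + E ^ (2 / β)) := by
    refine (h.norm_kerPerp_sq_le hβ₀ hk (by positivity) (sub_nonneg.2 ht)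
      fun s hs => hdecay s ⟨hs.1, by linarith [hs.2]⟩).trans ?_
    rw [mul_div_right_comm, Real.mul_rpow (by positivity) (by positivity), mul_assoc]
    gcongr
    exact one_add_rpow_le hE hβ₁
  have hint := h.integral_diss_le hκ (sub_nonneg.2 ht) (by linarith)
    fun s hs => hdiss s ⟨by linarith [hs.1], hs.2⟩
  have := mul_nonneg (by positivity : 0 ≤ 2 * B + 4 * L) (sq_nonneg ‖U 0‖)
  have := mul_nonneg hL hY
  linarith

lemma IsSolution.norm_deriv_sq_le_integral [CompleteSpace V] (h : 𝓖.IsSolution φ φt F Ft U Ut)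
    (hκ : 0 < κ) (hc : 0 ≤ c) (ht : 1 ≤ t)
    (hφt : IntervalIntegrable (fun s => ‖φt s‖ ^ 2) volume (t - 1) t)
    (hFt : IntervalIntegrable (fun s => ‖Ft s‖ ^ 2) volume (t - 1) t) :
    ‖Ut t‖ ^ 2 ≤ 64 * ((1 + 1 / (2 * κ)) * (∫ s in (t - 1)..t, 𝓖.diss φ U s)
        + 1 / 2 * (∫ s in (t - 1)..t, ‖F s‖ ^ 2))
      + (32 * c + 2 * c / κ) * (∫ s in (t - 1)..t, ‖φt s‖ ^ 2)
      + 4 * ∫ s in (t - 1)..t, ‖Ft s‖ ^ 2 := by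
  have hint := h.integral_norm_deriv_sq_le hκ hc ht hφt
  have hwindow : t - 1 ≤ t - 1 / 2 := by linarith
  have hhalf : t - 1 / 2 ≤ t := by linarith
  have hsub {f : ℝ → ℝ} (hf : IntervalIntegrable f volume (t - 1) t) :
      IntervalIntegrable f volume (t - 1 / 2) t :=
    intervalIntegrable_mono_Icc hwindow hhalf le_rfl hf
  have hmono {f : ℝ → ℝ} (hf₀ : ∀ s, 0 ≤ f s) (hf : IntervalIntegrable f volume (t - 1) t) :
      ∫ s in (t - 1 / 2)..t, f s ≤ ∫ s in (t - 1)..t, f s :=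
    intervalIntegral.integral_mono_interval hwindow hhalf le_rfl (Eventually.of_forall hf₀) hf
  have hF := hmono (fun _ => sq_nonneg _) hFt
  have hφ := mul_le_mul_of_nonneg_left (hmono (fun _ => sq_nonneg _) hφt)
    (by positivity : 0 ≤ c / (2 * κ))
  have hderiv := h.norm_deriv_sq_le hκ hc (by linarith) (hsub hφt) (hsub hFt)
  have hcκ : 2 * c / κ = 4 * (c / (2 * κ)) := by ring
  rw [hcκ]
  linarith

end EnergyEstimate

variable (H V X) in
theorem exists_norm_deriv_sq_le [CompleteSpace V] (hκ : 0 < κ) (hc : 0 ≤ c) (hC : 0 < C) {q : ℝ}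
    (hβq : β.HolderConjugate q) (hβ : β ≤ 2) :
    ∃ K : ℝ, 0 < K ∧ ∀ (S : Submodule ℝ H) [CompleteSpace S]
      (𝓖 : GalerkinSystem S V X κ c C β) (φ φt : ℝ → X) (F Ft : ℝ → H) (U Ut : ℝ → S),
      𝓖.IsSolution φ φt F Ft U Ut → ∀ t E : ℝ, 1 ≤ t →
      (∀ s ∈ Icc 0 t, ‖F s‖ ^ q + ‖φ s‖ ^ 2 ≤ E) →
      IntervalIntegrable (fun s => ‖φt s‖ ^ 2) volume (t - 1) t →
      IntervalIntegrable (fun s => ‖Ft s‖ ^ 2) volume (t - 1) t →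
      ‖Ut t‖ ^ 2 ≤ K * (1 + ‖U 0‖ ^ 2 + E ^ (2 / β)
        + ∫ s in (t - 1)..t, (‖φt s‖ ^ 2 + ‖Ft s‖ ^ 2)) := by
  have hβ₀ := hβq.pos
  have hq : 2 ≤ q := by
    rw [← inv_inv q, le_inv_comm₀ two_pos (inv_pos.2 hβq.symm.pos)]
    linarith [hβq.inv_add_inv_eq_one, inv_anti₀ hβ₀ hβ]
  obtain ⟨M, hM, hyoung⟩ := exists_mul_le_mul_rpow_add_mul_rpow hβq
    (by positivity : 0 < 1 / (8 * C))
  set L := 1 + 2 * M + c / κ + c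
  have hL : 0 < L := by positivity
  set B := 2 + 2 * ((L / (1 / (4 * C))) ^ (2 / β) * 2 ^ (2 / β - 1)) + 4 * L
  refine ⟨64 * ((1 + 1 / (2 * κ)) * B + 1) + (32 * c + 2 * c / κ) + 4, by positivity,
    fun S _ 𝓖 φ φt F Ft U Ut h t E ht hE hφt hFt => ?_⟩
  have henergy (s : ℝ) (hs : s ∈ Ioo 0 t) :=
    h.two_mul_inner_kerPerp_deriv_le_diss_and_rpow hκ hc hC hβ₀.le hM.le hyoung hs.1
      (hE s ⟨hs.1.le, hs.2.le⟩)
  have hE₀ : 0 ≤ E := le_trans (by positivity) (hE t ⟨by linarith, le_rfl⟩)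
  have hdiss : _ ≤ B * _ := h.integral_diss_le_of_energy hκ hβ₀ hβ (by positivity) hL.le hE₀ ht
    (fun s hs => (henergy s hs).1) fun s hs => (henergy s hs).2
  have hsource := h.integral_norm_source_sq_le hq (sub_nonneg.2 ht) (by linarith : t - 1 ≤ t)
    fun s hs => (le_add_of_nonneg_right (sq_nonneg _)).trans (hE s ⟨by linarith [hs.1], hs.2⟩)
  have hEY := le_one_add_rpow hE₀ ((one_le_div hβ₀).2 hβ)
  have hderiv := h.norm_deriv_sq_le_integral hκ hc ht hφt hFt
  rw [intervalIntegral.integral_add hφt hFt]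
  set Y := 1 + ‖U 0‖ ^ 2 + E ^ (2 / β)
  set Iφ := ∫ s in (t - 1)..t, ‖φt s‖ ^ 2
  set IF := ∫ s in (t - 1)..t, ‖Ft s‖ ^ 2
  have hIφ : 0 ≤ Iφ := intervalIntegral.integral_nonneg (by linarith) fun _ _ => sq_nonneg _
  have hIF : 0 ≤ IF := intervalIntegral.integral_nonneg (by linarith) fun _ _ => sq_nonneg _
  have hY₀ : 0 ≤ Y := by positivity
  calc ‖Ut t‖ ^ 2
      ≤ 64 * ((1 + 1 / (2 * κ)) * (B * Y) + Y) + (32 * c + 2 * c / κ) * Iφ + 4 * IF := by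
        have := mul_le_mul_of_nonneg_left hdiss (by positivity : 0 ≤ 1 + 1 / (2 * κ))
        have := Real.rpow_nonneg hE₀ (2 / β)
        linarith [sq_nonneg ‖U 0‖]
    _ ≤ 64 * ((1 + 1 / (2 * κ)) * B + 1) * (Y + (Iφ + IF))
        + (32 * c + 2 * c / κ) * (Y + (Iφ + IF)) + 4 * (Y + (Iφ + IF)) := by
        rw [show (1 + 1 / (2 * κ)) * (B * Y) + Y = ((1 + 1 / (2 * κ)) * B + 1) * Y by ring,
          ← mul_assoc]
        gcongr <;> linarith
    _ = _ := by ring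

end GalerkinSystem

/-! ### The nonlinear flux -/

namespace GenPoly

variable (P : GenPoly) {s ξ : ℝ}

lemma g_pos (hs : 0 ≤ s) : 0 < P.g s := P.coeff_zero_pos.trans_le (P.coeff_zero_le_g hs)

lemma mul_g_strictMonoOn : StrictMonoOn (fun s => s * P.g s) (Ici 0) := fun _ hx _ hy hxy =>
  (mul_le_mul_of_nonneg_left (P.g_monotoneOn hx hy hxy.le) hx).trans_lt
    (mul_lt_mul_of_pos_right hxy (P.g_pos hy))

lemma sol_nonneg (hξ : 0 ≤ ξ) : 0 ≤ P.sol ξ := (P.sol_spec hξ).1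

lemma sol_mul_g (hξ : 0 ≤ ξ) : P.sol ξ * P.g (P.sol ξ) = ξ := (P.sol_spec hξ).2

lemma sol_monotoneOn : MonotoneOn P.sol (Ici 0) := fun _ hx _ hy hxy =>
  (P.mul_g_strictMonoOn.le_iff_le (P.sol_nonneg hx) (P.sol_nonneg hy)).1 <| by
    simpa only [P.sol_mul_g hx, P.sol_mul_g hy] using hxy

lemma sol_intervalIntegrable {x y : ℝ} (hx : 0 ≤ x) (hy : 0 ≤ y) :
    IntervalIntegrable P.sol volume x y :=
  (P.sol_monotoneOn.mono fun _ hs => (le_min hx hy).trans hs.1).intervalIntegrable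

lemma integral_sol_le {x y : ℝ} (hx : 0 ≤ x) (hy : 0 ≤ y) :
    ∫ s in x..y, P.sol s ≤ P.sol y * (y - x) := by
  rcases le_total x y with h | h
  · have := intervalIntegral.integral_mono_on h (P.sol_intervalIntegrable hx hy)
      (intervalIntegrable_const (c := P.sol y))
      fun s hs => P.sol_monotoneOn (mem_Ici.2 (hx.trans hs.1)) (mem_Ici.2 hy) hs.2
    rw [intervalIntegral.integral_const, smul_eq_mul] at this
    linarith
  · have := intervalIntegral.integral_mono_on h (intervalIntegrable_const (c := P.sol y))
      (P.sol_intervalIntegrable hy hx)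
      fun s hs => P.sol_monotoneOn (mem_Ici.2 hy) (mem_Ici.2 (hy.trans hs.1)) hs.1
    rw [intervalIntegral.integral_const, smul_eq_mul] at this
    rw [intervalIntegral.integral_symm]
    linarith

lemma K_mul_self (hξ : 0 ≤ ξ) : P.K ξ * ξ = P.sol ξ := by
  have hg := P.g_pos (P.sol_nonneg hξ)
  rw [K]
  nth_rewrite 2 [← P.sol_mul_g hξ]
  field_simp

lemma K_nonneg (hξ : 0 ≤ ξ) : 0 ≤ P.K ξ := one_div_nonneg.2 (P.g_pos (P.sol_nonneg hξ)).le

lemma deg_pos : 0 < P.deg := by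
  rw [deg, ← P.α_zero]
  refine P.α_strictMono ?_
  rw [Fin.lt_def]
  simpa using Nat.lt_of_succ_le P.one_le_N

lemma a_pos : 0 < P.a := div_pos P.deg_pos (by linarith [P.deg_pos])

lemma a_lt_one : P.a < 1 := (div_lt_one (by linarith [P.deg_pos])).2 (by linarith)

lemma one_lt_β : 1 < P.β := by
  rw [β]
  linarith [P.a_lt_one]

lemma β_lt_two : P.β < 2 := by
  rw [β]
  linarith [P.a_pos]

lemma holderConjugate : P.β.HolderConjugate P.lam := by
  rw [Real.holderConjugate_iff]
  have ha := P.a_lt_one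
  refine ⟨P.one_lt_β, ?_⟩
  have h₂ : 2 - P.a ≠ 0 := by linarith
  have : 1 - P.a ≠ 0 := by linarith
  rw [β, lam]
  field_simp
  ring

lemma deg_add_one_mul_β_sub_one : (P.deg + 1) * (P.β - 1) = 1 := by
  have := P.deg_pos
  rw [β, a]
  field_simp
  ring

lemma sum_coeff_pos : 0 < ∑ i, P.coeff i :=
  P.coeff_zero_pos.trans_le
    (Finset.single_le_sum (fun i _ => P.coeff_nonneg i) (Finset.mem_univ 0))

lemma le_sum_coeff_of_sol_le_one (hξ : 0 ≤ ξ) (h : P.sol ξ ≤ 1) : ξ ≤ ∑ i, P.coeff i := by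
  have hs := P.sol_nonneg hξ
  have hg : P.g (P.sol ξ) ≤ ∑ i, P.coeff i := Finset.sum_le_sum fun i _ =>
    mul_le_of_le_one_right (P.coeff_nonneg i) (Real.rpow_le_one hs h (P.α_nonneg i))
  calc ξ = P.sol ξ * P.g (P.sol ξ) := (P.sol_mul_g hξ).symm
    _ ≤ 1 * ∑ i, P.coeff i := mul_le_mul h hg (P.g_pos hs).le zero_le_one
    _ = ∑ i, P.coeff i := one_mul _

lemma le_sum_coeff_mul_sol_rpow (hξ : 0 ≤ ξ) (h : 1 ≤ P.sol ξ) :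
    ξ ≤ (∑ i, P.coeff i) * P.sol ξ ^ (P.deg + 1) := by
  have hg : P.g (P.sol ξ) ≤ (∑ i, P.coeff i) * P.sol ξ ^ P.deg := by
    rw [Finset.sum_mul]
    exact Finset.sum_le_sum fun i _ => mul_le_mul_of_nonneg_left
      (Real.rpow_le_rpow_of_exponent_le h (P.α_strictMono.monotone (Fin.le_last i)))
      (P.coeff_nonneg i)
  calc ξ = P.sol ξ * P.g (P.sol ξ) := (P.sol_mul_g hξ).symm
    _ ≤ P.sol ξ * ((∑ i, P.coeff i) * P.sol ξ ^ P.deg) :=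
      mul_le_mul_of_nonneg_left hg (P.sol_nonneg hξ)
    _ = (∑ i, P.coeff i) * P.sol ξ ^ (P.deg + 1) := by
      rw [Real.rpow_add_one (by linarith)]
      ring

lemma exists_rpow_le : ∃ C : ℝ, 0 < C ∧ ∀ ξ, 0 ≤ ξ → ξ ^ P.β ≤ C * (1 + P.sol ξ * ξ) := by
  set B := ∑ i, P.coeff i
  have hB : 0 < B := P.sum_coeff_pos
  have hβ := P.one_lt_β
  refine ⟨B ^ P.β + B ^ (P.β - 1), by positivity, fun ξ hξ => ?_⟩
  have hs := P.sol_nonneg hξ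
  have hsξ : 0 ≤ P.sol ξ * ξ := mul_nonneg hs hξ
  rcases le_total (P.sol ξ) 1 with h | h
  · calc ξ ^ P.β ≤ B ^ P.β :=
          Real.rpow_le_rpow hξ (P.le_sum_coeff_of_sol_le_one hξ h) (by linarith)
      _ ≤ B ^ P.β + B ^ (P.β - 1) := le_add_of_nonneg_right (by positivity)
      _ ≤ _ := le_mul_of_one_le_right (by positivity) (by linarith)
  · have hpow : ξ ^ (P.β - 1) ≤ B ^ (P.β - 1) * P.sol ξ := by
      have := Real.rpow_le_rpow hξ (P.le_sum_coeff_mul_sol_rpow hξ h) (sub_nonneg.2 hβ.le)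
      rwa [Real.mul_rpow hB.le (by positivity), ← Real.rpow_mul hs, deg_add_one_mul_β_sub_one,
        Real.rpow_one] at this
    have hξ₀ : ξ ≠ 0 := by
      rw [← P.sol_mul_g hξ]
      exact (mul_pos (by linarith) (P.g_pos hs)).ne'
    calc ξ ^ P.β = ξ ^ (P.β - 1) * ξ := by rw [← Real.rpow_add_one hξ₀, sub_add_cancel]
      _ ≤ B ^ (P.β - 1) * P.sol ξ * ξ := mul_le_mul_of_nonneg_right hpow hξ
      _ = B ^ (P.β - 1) * (P.sol ξ * ξ) := by ring
      _ ≤ (B ^ P.β + B ^ (P.β - 1)) * (1 + P.sol ξ * ξ) :=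
        mul_le_mul (le_add_of_nonneg_left (by positivity)) (by linarith) hsξ (by positivity)

section Field

variable {E : Type*} [NormedAddCommGroup E]

/-- The potential of `field`. -/
noncomputable def potential (p : E) : ℝ := ∫ s in (0 : ℝ)..‖p‖, P.sol s

variable [InnerProductSpace ℝ E]

/-- The nonlinear flux `p ↦ K(|p|) p`. -/
noncomputable def field (p : E) : E := P.K ‖p‖ • p

lemma norm_field (p : E) : ‖P.field p‖ = P.sol ‖p‖ := by
  rw [field, norm_smul, Real.norm_of_nonneg (P.K_nonneg (norm_nonneg p)),
    P.K_mul_self (norm_nonneg p)]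

lemma g_smul_field (p : E) : P.g ‖P.field p‖ • P.field p = p := by
  rw [norm_field, field, K, smul_smul,
    mul_one_div_cancel (P.g_pos (P.sol_nonneg (norm_nonneg p))).ne', one_smul]

lemma inner_field_self (p : E) : inner ℝ (P.field p) p = P.sol ‖p‖ * ‖p‖ := by
  rw [field, real_inner_smul_left, real_inner_self_eq_norm_sq, ← P.K_mul_self (norm_nonneg p)]
  ring

lemma coeff_zero_mul_norm_sub_sq_le (x y : E) :
    P.coeff 0 * ‖x - y‖ ^ 2 ≤ inner ℝ (x - y) (P.g ‖x‖ • x - P.g ‖y‖ • y) := by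
  have hx := P.coeff_zero_le_g (norm_nonneg x)
  have hy := P.coeff_zero_le_g (norm_nonneg y)
  have hxy := real_inner_le_norm x y
  have hexpand : inner ℝ (x - y) (P.g ‖x‖ • x - P.g ‖y‖ • y)
      = P.g ‖x‖ * ‖x‖ ^ 2 + P.g ‖y‖ * ‖y‖ ^ 2 - (P.g ‖x‖ + P.g ‖y‖) * inner ℝ x y := by
    simp only [inner_sub_left, inner_sub_right, real_inner_smul_right, real_inner_self_eq_norm_sq,
      real_inner_comm x y]
    ring
  have hmono : 0 ≤ (‖x‖ - ‖y‖) * (P.g ‖x‖ - P.g ‖y‖) := by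
    rcases le_total ‖x‖ ‖y‖ with h | h
    · exact mul_nonneg_of_nonpos_of_nonpos (sub_nonpos.2 h)
        (sub_nonpos.2 (P.g_monotoneOn (norm_nonneg x) (norm_nonneg y) h))
    · exact mul_nonneg (sub_nonneg.2 h)
        (sub_nonneg.2 (P.g_monotoneOn (norm_nonneg y) (norm_nonneg x) h))
  have hangle : 0 ≤ (P.g ‖x‖ + P.g ‖y‖ - 2 * P.coeff 0) * (‖x‖ * ‖y‖ - inner ℝ x y) :=
    mul_nonneg (by linarith) (by linarith)
  have hnorms : 0 ≤ (P.g ‖x‖ + P.g ‖y‖ - 2 * P.coeff 0) * (‖x‖ - ‖y‖) ^ 2 :=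
    mul_nonneg (by linarith) (sq_nonneg _)
  have hradial : 0 ≤ (‖x‖ - ‖y‖) * (P.g ‖x‖ - P.g ‖y‖) * (‖x‖ + ‖y‖) :=
    mul_nonneg hmono (by positivity)
  rw [hexpand, norm_sub_sq_real]
  linarith

lemma potential_sub_le (p q : E) :
    P.potential q - P.potential p ≤ inner ℝ (P.field q) (q - p) := by
  have hp := norm_nonneg p
  have hq := norm_nonneg q
  have hcauchy := real_inner_le_norm (P.field q) p
  rw [norm_field] at hcauchy
  calc P.potential q - P.potential p = ∫ s in ‖p‖..‖q‖, P.sol s :=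
        intervalIntegral.integral_interval_sub_left (P.sol_intervalIntegrable le_rfl hq)
          (P.sol_intervalIntegrable le_rfl hp)
    _ ≤ P.sol ‖q‖ * (‖q‖ - ‖p‖) := P.integral_sol_le hp hq
    _ ≤ inner ℝ (P.field q) (q - p) := by
      rw [inner_sub_right, inner_field_self]
      linarith

/-- The pointwise flux as a cocoercive gradient field. -/
noncomputable def fieldGradient (E : Type*) [NormedAddCommGroup E] [InnerProductSpace ℝ E] :
    CocoerciveGradient E (P.coeff 0) where
  field := P.field
  potential := P.potential
  field_zero := by simp [field]
  potential_zero := by simp [potential]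
  cocoercive p q := by
    -- Cocoercivity of `field` is the strong monotonicity of its inverse `x ↦ g(|x|) x`.
    have := P.coeff_zero_mul_norm_sub_sq_le (P.field p) (P.field q)
    rwa [g_smul_field, g_smul_field] at this
  subgradient := P.potential_sub_le

end Field

end GenPoly

namespace CocoerciveGradient

variable {α E : Type*} [MeasurableSpace α] {μ : Measure α} [NormedAddCommGroup E]
  [InnerProductSpace ℝ E] {κ : ℝ} (A : CocoerciveGradient E κ) (hκ : 0 < κ)

/-- The superposition operator `G ↦ A ∘ G` on `L²`. -/
noncomputable def compLp : Lp E 2 μ → Lp E 2 μ := (A.lipschitzWith_field hκ).compLp A.field_zero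

lemma coeFn_compLp (G : Lp E 2 μ) : A.compLp hκ G =ᵐ[μ] fun x => A.field (G x) :=
  (A.lipschitzWith_field hκ).coeFn_compLp A.field_zero G

lemma inner_compLp (G G' : Lp E 2 μ) :
    inner ℝ (A.compLp hκ G) G' = ∫ x, inner ℝ (A.field (G x)) (G' x) ∂μ := by
  rw [L2.inner_def]
  refine integral_congr_ae ?_
  filter_upwards [A.coeFn_compLp hκ G] with x hx
  rw [hx]

include hκ

lemma integrable_inner_field (G G' : Lp E 2 μ) :
    Integrable (fun x => inner ℝ (A.field (G x)) (G' x)) μ := by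
  refine (L2.integrable_inner (𝕜 := ℝ) (A.compLp hκ G) G').congr ?_
  filter_upwards [A.coeFn_compLp hκ G] with x hx
  rw [hx]

lemma integrable_potential (G : Lp E 2 μ) : Integrable (fun x => A.potential (G x)) μ := by
  have hcont : Continuous A.potential :=
    continuous_iff_continuousAt.2 fun p => (A.hasFDerivAt_potential hκ p).continuousAt
  refine (A.integrable_inner_field hκ G G).mono'
    (hcont.comp_aestronglyMeasurable (Lp.aestronglyMeasurable G)) (ae_of_all _ fun x => ?_)
  rw [Real.norm_of_nonneg (A.potential_nonneg _)]
  exact A.potential_le_inner _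

omit hκ

/-- The cocoercive gradient field induced on `L²` by a pointwise one. -/
noncomputable def lp (μ : Measure α) : CocoerciveGradient (Lp E 2 μ) κ where
  field := A.compLp hκ
  potential G := ∫ x, A.potential (G x) ∂μ
  field_zero := by
    refine Lp.ext ?_
    filter_upwards [A.coeFn_compLp hκ (0 : Lp E 2 μ), Lp.coeFn_zero E 2 μ] with x hA h₀
    rw [hA, h₀, Pi.zero_apply, A.field_zero]
  potential_zero := by
    refine integral_eq_zero_of_ae ?_
    filter_upwards [Lp.coeFn_zero E 2 μ] with x hx
    rw [hx, Pi.zero_apply, A.potential_zero, Pi.zero_apply]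
  cocoercive G G' := by
    rw [← real_inner_self_eq_norm_sq, L2.inner_def, L2.inner_def, ← integral_const_mul]
    refine integral_mono_ae ((L2.integrable_inner _ _).const_mul _) (L2.integrable_inner _ _) ?_
    filter_upwards [Lp.coeFn_sub (A.compLp hκ G) (A.compLp hκ G'), Lp.coeFn_sub G G',
      A.coeFn_compLp hκ G, A.coeFn_compLp hκ G'] with x hsubA hsub hG hG'
    simp only [hsubA, hsub, Pi.sub_apply, hG, hG', real_inner_self_eq_norm_sq]
    exact A.cocoercive _ _
  subgradient G G' := by
    rw [← integral_sub (A.integrable_potential hκ G') (A.integrable_potential hκ G), inner_compLp]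
    refine integral_mono_ae ((A.integrable_potential hκ G').sub (A.integrable_potential hκ G))
      (A.integrable_inner_field hκ _ _) ?_
    filter_upwards [Lp.coeFn_sub G' G] with x hx
    rw [hx]
    exact A.subgradient _ _

end CocoerciveGradient

/-! ### Polynomials on a cell -/

section Polynomials

open Metric hiding smul_ball

variable {d : ℕ}

lemma continuous_polyGrad (p : MvPolynomial (Fin d) ℝ) : Continuous (polyGrad p) :=
  (PiLp.continuous_toLp 2 _).comp (continuous_pi fun _ => continuous_polyEval _)

/-- `polyEval` as a linear map into the continuous functions. -/
noncomputable def polyEvalₗ (d : ℕ) : MvPolynomial (Fin d) ℝ →ₗ[ℝ] C(Space d, ℝ) where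
  toFun p := ⟨polyEval p, continuous_polyEval p⟩
  map_add' p q := by ext x; simp [polyEval]
  map_smul' c p := by ext x; simp [polyEval]

/-- `polyGrad` as a linear map into the continuous vector fields. -/
noncomputable def polyGradₗ (d : ℕ) : MvPolynomial (Fin d) ℝ →ₗ[ℝ] C(Space d, Space d) where
  toFun p := ⟨polyGrad p, continuous_polyGrad p⟩
  map_add' p q := by ext x i; simp [polyGrad, polyEval]
  map_smul' c p := by ext x i; simp [polyGrad, polyEval]

lemma polyGrad_mul_X (p : MvPolynomial (Fin d) ℝ) (i : Fin d) (x : Space d) :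
    polyGrad (p * MvPolynomial.X i) x
      = polyEval p x • EuclideanSpace.single i 1 + x i • polyGrad p x := by
  ext j
  rcases eq_or_ne i j with rfl | hij
  · simp [polyGrad, polyEval]
  · simp [polyGrad, polyEval, hij.symm]

lemma hasFDerivAt_polyEval (p : MvPolynomial (Fin d) ℝ) (x : Space d) :
    HasFDerivAt (polyEval p) (innerSL ℝ (polyGrad p x)) x := by
  induction p using MvPolynomial.induction_on with
  | C a =>
    have hval : polyEval (MvPolynomial.C a : MvPolynomial (Fin d) ℝ) = fun _ => a := by
      funext y
      simp [polyEval]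
    have hgrad : polyGrad (MvPolynomial.C a : MvPolynomial (Fin d) ℝ) x = 0 := by
      ext i
      simp [polyGrad, polyEval]
    rw [hval, hgrad, map_zero]
    exact hasFDerivAt_const a x
  | add p q hp hq =>
    have hval : polyEval (p + q) = polyEval p + polyEval q := by
      funext y
      simp [polyEval]
    have hgrad : polyGrad (p + q) x = polyGrad p x + polyGrad q x :=
      DFunLike.congr_fun (map_add (polyGradₗ d) p q) x
    rw [hval, hgrad, map_add]
    exact hp.add hq
  | mul_X p i hp =>
    have hval : polyEval (p * MvPolynomial.X i) = fun y => polyEval p y * y i := by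
      funext y
      simp [polyEval]
    rw [hval]
    refine (hp.mul (EuclideanSpace.proj (𝕜 := ℝ) i).hasFDerivAt).congr_fderiv ?_
    ext y
    simp [polyGrad_mul_X, EuclideanSpace.inner_single_left]

lemma eq_zero_of_polyEval_eq_zero_on_ball {p : MvPolynomial (Fin d) ℝ} {s : ℝ} (hs : 0 < s)
    (hp : ∀ x ∈ ball (0 : Space d) s, polyEval p x = 0) : p = 0 := by
  obtain ⟨ε, hε, hball⟩ := Metric.isOpen_iff.1
    ((isOpen_ball (x := (0 : Space d)) (ε := s)).preimage
      (PiLp.continuous_toLp 2 fun _ : Fin d => ℝ))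
    0 (by simpa using hs)
  refine MvPolynomial.funext_set (fun _ => Ioo (-ε) ε)
    (fun _ => Ioo_infinite (by linarith)) fun x hx => ?_
  have hx : x ∈ ball (0 : Fin d → ℝ) ε := by
    rw [mem_ball_zero_iff, pi_norm_lt_iff hε]
    exact fun i => abs_lt.2 (hx i (mem_univ i))
  simpa [polyEval] using hp _ (hball hx)

lemma polyEval_eq_of_polyGrad_eq_zero_on_ball {p : MvPolynomial (Fin d) ℝ} {s : ℝ} (hs : 0 < s)
    (hp : ∀ x ∈ ball (0 : Space d) s, polyGrad p x = 0) (x y : Space d) :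
    polyEval p x = polyEval p y := by
  have hpderiv (i : Fin d) : MvPolynomial.pderiv i p = 0 :=
    eq_zero_of_polyEval_eq_zero_on_ball hs fun x hx => congrArg (· i) (hp x hx)
  have hgrad (x : Space d) : polyGrad p x = 0 := by
    ext i
    simp [polyGrad, polyEval, hpderiv]
  refine is_const_of_fderiv_eq_zero (𝕜 := ℝ)
    (fun x => (hasFDerivAt_polyEval p x).differentiableAt) (fun x => ?_) x y
  rw [(hasFDerivAt_polyEval p x).fderiv, hgrad, map_zero]

/-- The substitution `p ↦ p (z + h ·)`. -/
noncomputable def affineSubst (z : Space d) (h : ℝ) :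
    MvPolynomial (Fin d) ℝ →ₐ[ℝ] MvPolynomial (Fin d) ℝ :=
  MvPolynomial.bind₁ fun i => MvPolynomial.C (z i) + MvPolynomial.C h * MvPolynomial.X i

lemma polyEval_affineSubst (z : Space d) (h : ℝ) (p : MvPolynomial (Fin d) ℝ) (x : Space d) :
    polyEval (affineSubst z h p) x = polyEval p (z + h • x) := by
  simp only [polyEval, affineSubst, MvPolynomial.eval, MvPolynomial.eval₂Hom_bind₁]
  congr 2
  funext i
  simp

lemma polyGrad_affineSubst (z : Space d) (h : ℝ) (p : MvPolynomial (Fin d) ℝ) (x : Space d) :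
    polyGrad (affineSubst z h p) x = h • polyGrad p (z + h • x) := by
  have hsubst := hasFDerivAt_polyEval (affineSubst z h p) x
  rw [funext (polyEval_affineSubst z h p)] at hsubst
  have haffine : HasFDerivAt (fun x : Space d => z + h • x) (h • ContinuousLinearMap.id ℝ _) x :=
    ((hasFDerivAt_id x).const_smul h).const_add z
  have hchain := hsubst.unique
    (HasFDerivAt.comp (g := polyEval p) x (hasFDerivAt_polyEval p (z + h • x)) haffine)
  refine ext_inner_right ℝ fun y => ?_
  simpa [real_inner_smul_left, real_inner_smul_right] using DFunLike.congr_fun hchain y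

lemma totalDegree_affineSubst_le (z : Space d) (h : ℝ) (p : MvPolynomial (Fin d) ℝ) :
    (affineSubst z h p).totalDegree ≤ p.totalDegree := by
  have hlin (i : Fin d) :
      (MvPolynomial.C (z i) + MvPolynomial.C h * MvPolynomial.X i).totalDegree ≤ 1 := by
    refine (MvPolynomial.totalDegree_add _ _).trans (max_le (by simp) ?_)
    exact (MvPolynomial.totalDegree_mul _ _).trans (by simp [MvPolynomial.totalDegree_X])
  rw [affineSubst, MvPolynomial.bind₁, MvPolynomial.aeval_def, MvPolynomial.eval₂_eq']
  refine MvPolynomial.totalDegree_finsetSum_le fun m hm => ?_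
  calc _ ≤ ∑ i, m i := ?_
    _ ≤ p.totalDegree := by
      simpa only [Finsupp.sum_fintype, implies_true] using MvPolynomial.le_totalDegree hm
  refine (MvPolynomial.totalDegree_mul _ _).trans ?_
  rw [MvPolynomial.algebraMap_eq, MvPolynomial.totalDegree_C, zero_add]
  refine (MvPolynomial.totalDegree_finsetProd _ _).trans (Finset.sum_le_sum fun i _ => ?_)
  exact (MvPolynomial.totalDegree_pow _ _).trans (mul_le_of_le_one_right (Nat.zero_le _) (hlin i))

end Polynomials

section LocalEstimates

open Metric hiding smul_ball

lemma exists_norm_le_of_ker_le {W F G : Type*} [AddCommGroup W] [Module ℝ W]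
    [FiniteDimensional ℝ W] [NormedAddCommGroup F] [NormedSpace ℝ F] [SeminormedAddCommGroup G]
    [NormedSpace ℝ G] (L : W →ₗ[ℝ] F) (T : W →ₗ[ℝ] G) (hLT : L.ker ≤ T.ker) :
    ∃ C : ℝ, 0 < C ∧ ∀ w, ‖T w‖ ≤ C * ‖L w‖ := by
  let S := ((L.ker.liftQ T hLT) ∘ₗ L.quotKerEquivRange.symm.toLinearMap).toContinuousLinearMap
  refine ⟨‖S‖ + 1, by positivity, fun w => ?_⟩
  have hS : S ⟨L w, L.mem_range_self w⟩ = T w := by simp [S]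
  calc ‖T w‖ ≤ ‖S‖ * ‖L w‖ := hS ▸ S.le_opNorm ⟨L w, L.mem_range_self w⟩
    _ ≤ (‖S‖ + 1) * ‖L w‖ := by gcongr; simp

variable {d : ℕ}

lemma memLp_restrict_of_continuous {E : Type*} [NormedAddCommGroup E] {f : Space d → E}
    (hf : Continuous f) {T : Set (Space d)} (hT : Bornology.IsBounded T) (hTm : MeasurableSet T)
    (p : ENNReal) : MemLp f p (volume.restrict T) := by
  have hfin : IsFiniteMeasure (volume.restrict T) := isFiniteMeasure_restrict.2 hT.measure_lt_top.ne
  obtain ⟨B, hB⟩ := hT.isCompact_closure.exists_bound_of_continuousOn hf.continuousOn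
  refine MemLp.of_bound hf.aestronglyMeasurable B ?_
  filter_upwards [ae_restrict_mem hTm] with x hx using hB x (subset_closure hx)

lemma integrableOn_of_continuous {E : Type*} [NormedAddCommGroup E] {f : Space d → E}
    (hf : Continuous f) {T : Set (Space d)} (hT : Bornology.IsBounded T) (hTm : MeasurableSet T) :
    IntegrableOn f T :=
  memLp_one_iff_integrable.1 (memLp_restrict_of_continuous hf hT hTm 1)

-- Polynomials of degree at most `r` form a finite-dimensional space, on which a linear map is
-- controlled by any other one with a smaller kernel.
lemma exists_norm_le_integral_norm {E F : Type*} [NormedAddCommGroup E] [NormedSpace ℝ E]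
    [NormedAddCommGroup F] [NormedSpace ℝ F] (r : ℕ) {s : ℝ}
    (D : MvPolynomial (Fin d) ℝ →ₗ[ℝ] C(Space d, E))
    (D' : MvPolynomial (Fin d) ℝ →ₗ[ℝ] C(Space d, F))
    (hD : ∀ p, (∀ x ∈ ball (0 : Space d) s, D p x = 0) → D' p = 0) :
    ∃ C : ℝ, 0 < C ∧ ∀ p : MvPolynomial (Fin d) ℝ, p.totalDegree ≤ r →
      ∀ x ∈ closedBall (0 : Space d) 1, ‖D' p x‖ ≤ C * ∫ y in ball (0 : Space d) s, ‖D p y‖ := by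
  have hint (p) : Integrable (D p) (volume.restrict (ball (0 : Space d) s)) :=
    integrableOn_of_continuous (D p).continuous isBounded_ball measurableSet_ball
  let L : MvPolynomial (Fin d) ℝ →ₗ[ℝ] Lp E 1 (volume.restrict (ball (0 : Space d) s)) :=
    { toFun p := (hint p).toL1 (D p)
      map_add' p q := by simp only [map_add, ContinuousMap.coe_add, Integrable.toL1_add, hint]
      map_smul' c p := by
        simp only [map_smul, ContinuousMap.coe_smul, RingHom.id_apply]
        exact Integrable.toL1_smul' _ (hint p) c }
  let T : MvPolynomial (Fin d) ℝ →ₗ[ℝ] C(closedBall (0 : Space d) 1, F) :=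
    { toFun p := (D' p).restrict (closedBall 0 1)
      map_add' p q := by ext; simp
      map_smul' c p := by ext; simp }
  have hLT : L.ker ≤ T.ker := by
    intro p hp
    have hae : D p =ᵐ[volume.restrict (ball (0 : Space d) s)] 0 :=
      (Integrable.toL1_eq_toL1_iff _ _ (hint p) (integrable_zero _ _ _)).1
        (Eq.trans hp (Integrable.toL1_zero _).symm)
    have hzero := hD p <| Measure.eqOn_open_of_ae_eq hae isOpen_ball
      (D p).continuous.continuousOn continuousOn_const
    ext x
    simp [T, hzero]
  let W := MvPolynomial.restrictTotalDegree (Fin d) ℝ r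
  obtain ⟨C, hC, hbound⟩ := exists_norm_le_of_ker_le (L ∘ₗ W.subtype) (T ∘ₗ W.subtype)
    fun p hp => hLT hp
  refine ⟨C, hC, fun p hp x hx => ?_⟩
  calc ‖D' p x‖ ≤ ‖T p‖ := (T p).norm_coe_le_norm ⟨x, hx⟩
    _ ≤ C * ‖L p‖ := hbound ⟨p, (MvPolynomial.mem_restrictTotalDegree _ _ _).2 hp⟩
    _ = C * ∫ y in ball (0 : Space d) s, ‖D p y‖ :=
      congrArg (C * ·) (L1.norm_of_fun_eq_integral_norm (hint p))

lemma setIntegral_ball_comp_affine (f : Space d → ℝ) (z : Space d) {h s : ℝ} (hh : 0 < h) :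
    ∫ y in ball (0 : Space d) s, f (z + h • y) = (h ^ d)⁻¹ * ∫ y in ball z (s * h), f y := by
  have htranslate := (measurePreserving_add_left volume z).setIntegral_preimage_emb
    (measurableEmbedding_addLeft z) f (ball z (s * h))
  rw [preimage_add_ball, sub_self] at htranslate
  rw [Measure.setIntegral_comp_smul_of_pos volume (fun y => f (z + y)) _ hh, smul_ball hh.ne',
    smul_zero, Real.norm_of_nonneg hh.le, finrank_euclideanSpace_fin, smul_eq_mul, mul_comm h s,
    htranslate]

lemma inv_smul_sub_mem_closedBall {z x : Space d} {h : ℝ} (hh : 0 < h) (hx : x ∈ closedBall z h) :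
    h⁻¹ • (x - z) ∈ closedBall (0 : Space d) 1 := by
  rwa [mem_closedBall_zero_iff, norm_smul, norm_inv, Real.norm_of_nonneg hh.le,
    inv_mul_le_iff₀ hh, mul_one, ← dist_eq_norm]

lemma add_smul_inv_smul_sub {z x : Space d} {h : ℝ} (hh : 0 < h) :
    z + h • h⁻¹ • (x - z) = x := by
  rw [smul_inv_smul₀ hh.ne', add_sub_cancel]

lemma exists_norm_polyGrad_le (d r : ℕ) {s : ℝ} (hs : 0 < s) :
    ∃ C : ℝ, 0 < C ∧ ∀ p : MvPolynomial (Fin d) ℝ, p.totalDegree ≤ r →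
      ∀ (z : Space d) (h : ℝ), 0 < h → ∀ x ∈ closedBall z h,
        h * ‖polyGrad p x‖ ≤ C * ((h ^ d)⁻¹ * ∫ y in ball z (s * h), |polyEval p y|) := by
  obtain ⟨C, hC, hbound⟩ := exists_norm_le_integral_norm r (s := s) (polyEvalₗ d) (polyGradₗ d)
    fun p hp => by rw [eq_zero_of_polyEval_eq_zero_on_ball hs hp, map_zero]
  refine ⟨C, hC, fun p hp z h hh x hx => ?_⟩
  have hscaled := hbound (affineSubst z h p) ((totalDegree_affineSubst_le z h p).trans hp) _
    (inv_smul_sub_mem_closedBall hh hx)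
  simp only [polyGradₗ, polyEvalₗ, LinearMap.coe_mk, AddHom.coe_mk, ContinuousMap.coe_mk,
    polyGrad_affineSubst, polyEval_affineSubst, add_smul_inv_smul_sub hh, norm_smul,
    Real.norm_of_nonneg hh.le, Real.norm_eq_abs] at hscaled
  rwa [← setIntegral_ball_comp_affine (fun y => |polyEval p y|) z hh]

lemma exists_abs_polyEval_sub_le (d r : ℕ) {s : ℝ} (hs : 0 < s) :
    ∃ C : ℝ, 0 < C ∧ ∀ p : MvPolynomial (Fin d) ℝ, p.totalDegree ≤ r →
      ∀ (z : Space d) (h : ℝ), 0 < h → ∀ x ∈ closedBall z h,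
        |polyEval p x - polyEval p z|
          ≤ C * (h * ((h ^ d)⁻¹ * ∫ y in ball z (s * h), ‖polyGrad p y‖)) := by
  have hosc (p : MvPolynomial (Fin d) ℝ) (x : Space d) :
      polyEval (p - affineSubst 0 0 p) x = polyEval p x - polyEval p 0 := by
    have := polyEval_affineSubst 0 0 p x
    rw [zero_smul, add_zero] at this
    rw [← this, polyEval, map_sub, polyEval, polyEval]
  obtain ⟨C, hC, hbound⟩ := exists_norm_le_integral_norm r (s := s) (polyGradₗ d)
    (polyEvalₗ d ∘ₗ (LinearMap.id - (affineSubst 0 0).toLinearMap)) fun p hp => by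
      ext x
      exact (hosc p x).trans
        (sub_eq_zero.2 (polyEval_eq_of_polyGrad_eq_zero_on_ball hs hp x 0))
  refine ⟨C, hC, fun p hp z h hh x hx => ?_⟩
  have hscaled := hbound (affineSubst z h p) ((totalDegree_affineSubst_le z h p).trans hp) _
    (inv_smul_sub_mem_closedBall hh hx)
  simp only [polyGradₗ, polyEvalₗ, LinearMap.comp_apply, LinearMap.sub_apply, LinearMap.id_apply,
    AlgHom.toLinearMap_apply, LinearMap.coe_mk, AddHom.coe_mk, ContinuousMap.coe_mk, hosc,
    polyGrad_affineSubst, polyEval_affineSubst, add_smul_inv_smul_sub hh, norm_smul,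
    Real.norm_of_nonneg hh.le, Real.norm_eq_abs, smul_zero, add_zero] at hscaled
  rwa [integral_const_mul, setIntegral_ball_comp_affine (fun y => ‖polyGrad p y‖) z hh] at hscaled

end LocalEstimates

section CellEstimates

open Metric hiding smul_ball

lemma sq_integral_le_rpow_mul {α : Type*} [MeasurableSpace α] {μ : Measure α} [IsFiniteMeasure μ]
    {f : α → ℝ} (hf0 : ∀ x, 0 ≤ f x) {p : ℝ} (hp : 1 < p) (hf : MemLp f (ENNReal.ofReal p) μ) :
    (∫ x, f x ∂μ) ^ 2 ≤ μ.real univ ^ (2 - 2 / p) * (∫ x, f x ^ p ∂μ) ^ (2 / p) := by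
  have hpq := Real.HolderConjugate.conjExponent hp
  have hholder := integral_mul_le_Lp_mul_Lq_of_nonneg (g := fun _ => 1) hpq (.of_forall hf0)
    (.of_forall fun _ => zero_le_one) hf (memLp_const 1)
  simp only [mul_one, Real.one_rpow, integral_const, smul_eq_mul] at hholder
  have hJ : 0 ≤ ∫ x, f x ^ p ∂μ := integral_nonneg fun x => Real.rpow_nonneg (hf0 x) _
  have hexp : 1 / p.conjExponent * (2 : ℕ) = 2 - 2 / p := by
    have := hpq.inv_add_inv_eq_one
    rw [one_div, eq_sub_of_add_eq' this]
    push_cast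
    ring
  refine (pow_le_pow_left₀ (integral_nonneg hf0) hholder 2).trans_eq ?_
  rw [mul_pow, ← Real.rpow_mul_natCast hJ, ← Real.rpow_mul_natCast measureReal_nonneg, hexp,
    mul_comm, Nat.cast_ofNat, one_div_mul_eq_div]

/-- The volume of the unit ball of `ℝᵈ`. -/
noncomputable def unitVol (d : ℕ) : ℝ := volume.real (ball (0 : Space d) 1)

lemma unitVol_pos (d : ℕ) : 0 < unitVol d :=
  ENNReal.toReal_pos (measure_ball_pos _ _ one_pos).ne' measure_ball_lt_top.ne

variable {d : ℕ} {T : Set (Space d)} {z : Space d} {h : ℝ}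

lemma volume_real_le_unitVol_mul_pow (hh : 0 < h) (hT : T ⊆ closedBall z h) :
    volume.real T ≤ unitVol d * h ^ d := by
  refine (measureReal_mono hT (measure_closedBall_lt_top).ne).trans_eq ?_
  rw [Measure.addHaar_real_closedBall _ _ hh.le, finrank_euclideanSpace_fin, mul_comm, unitVol]

lemma setIntegral_norm_sq_le {E : Type*} [NormedAddCommGroup E] (hh : 0 < h)
    (hT : T ⊆ closedBall z h) {f : Space d → E} {m : ℝ} (hf : ∀ x ∈ T, ‖f x‖ ≤ m) :
    ∫ x in T, ‖f x‖ ^ 2 ≤ unitVol d * h ^ d * m ^ 2 := by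
  have hbound : ∀ x ∈ T, ‖‖f x‖ ^ 2‖ ≤ m ^ 2 := fun x hx => by
    rw [norm_pow, norm_norm]
    exact pow_le_pow_left₀ (norm_nonneg _) (hf x hx) 2
  calc ∫ x in T, ‖f x‖ ^ 2 ≤ m ^ 2 * volume.real T :=
        (Real.le_norm_self _).trans (norm_setIntegral_le_of_norm_le_const
          (isBounded_closedBall.subset hT).measure_lt_top hbound)
    _ ≤ m ^ 2 * (unitVol d * h ^ d) := by
      gcongr
      exact volume_real_le_unitVol_mul_pow hh hT
    _ = unitVol d * h ^ d * m ^ 2 := mul_comm _ _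

lemma sq_setIntegral_le_mul_rpow (hh : 0 < h) (hTm : MeasurableSet T) (hT : T ⊆ closedBall z h)
    {f : Space d → ℝ} (hf : Continuous f) (hf0 : ∀ x, 0 ≤ f x) {p : ℝ} (hp : 1 < p) :
    (∫ x in T, f x) ^ 2
      ≤ (unitVol d * h ^ d) ^ (2 - 2 / p) * (∫ x in T, f x ^ p) ^ (2 / p) := by
  have hb := isBounded_closedBall.subset hT
  have : IsFiniteMeasure (volume.restrict T) := isFiniteMeasure_restrict.2 hb.measure_lt_top.ne
  have hexp : 0 ≤ 2 - 2 / p := by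
    have : 2 / p ≤ 2 := div_le_self zero_le_two hp.le
    linarith
  refine (sq_integral_le_rpow_mul hf0 hp (memLp_restrict_of_continuous hf hb hTm _)).trans ?_
  have hJ : 0 ≤ ∫ x in T, f x ^ p := integral_nonneg fun x => Real.rpow_nonneg (hf0 x) _
  rw [measureReal_restrict_apply_univ]
  gcongr
  exact volume_real_le_unitVol_mul_pow hh hT

lemma exists_setIntegral_norm_polyGrad_sq_le (d r : ℕ) {σ : ℝ} (hσ : 0 < σ) :
    ∃ C : ℝ, 0 < C ∧ ∀ p : MvPolynomial (Fin d) ℝ, p.totalDegree ≤ r →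
      ∀ (z : Space d) (h : ℝ) (T : Set (Space d)), 0 < h → MeasurableSet T →
        ball z (σ * h) ⊆ T → T ⊆ closedBall z h →
        ∫ x in T, ‖polyGrad p x‖ ^ 2 ≤ C * (h ^ 2)⁻¹ * ∫ x in T, polyEval p x ^ 2 := by
  obtain ⟨C, hC, hbound⟩ := exists_norm_polyGrad_le d r hσ
  have hω := unitVol_pos d
  refine ⟨(C * unitVol d) ^ 2, by positivity, fun p hp z h T hh hTm hbT hTb => ?_⟩
  have hTint := integrableOn_of_continuous (continuous_polyEval p).abs
    (isBounded_closedBall.subset hTb) hTm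
  set I := ∫ x in T, |polyEval p x|
  have hgrad : ∀ x ∈ T, ‖polyGrad p x‖ ≤ h⁻¹ * (C * ((h ^ d)⁻¹ * I)) := by
    intro x hx
    rw [le_inv_mul_iff₀ hh]
    refine (hbound p hp z h hh x (hTb hx)).trans ?_
    gcongr
    exact setIntegral_mono_set hTint (.of_forall fun _ => abs_nonneg _) hbT.eventuallyLE
  have hI : I ^ 2 ≤ unitVol d * h ^ d * ∫ x in T, polyEval p x ^ 2 := by
    have := sq_setIntegral_le_mul_rpow hh hTm hTb (continuous_polyEval p).abs
      (fun _ => abs_nonneg _) one_lt_two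
    norm_num at this
    exact this
  calc ∫ x in T, ‖polyGrad p x‖ ^ 2
      ≤ unitVol d * h ^ d * (h⁻¹ * (C * ((h ^ d)⁻¹ * I))) ^ 2 :=
        setIntegral_norm_sq_le hh hTb hgrad
    _ = unitVol d * (h ^ 2)⁻¹ * C ^ 2 * (h ^ d)⁻¹ * I ^ 2 := by field_simp
    _ ≤ unitVol d * (h ^ 2)⁻¹ * C ^ 2 * (h ^ d)⁻¹
        * (unitVol d * h ^ d * ∫ x in T, polyEval p x ^ 2) := by gcongr
    _ = (C * unitVol d) ^ 2 * (h ^ 2)⁻¹ * ∫ x in T, polyEval p x ^ 2 := by field_simp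

lemma exists_setIntegral_polyEval_sub_sq_le (d r : ℕ) {σ β R : ℝ} (hσ : 0 < σ) (hβ : 1 < β)
    (hdeg : 2 * d / β ≤ d + 2) (hR : 0 < R) :
    ∃ C : ℝ, 0 < C ∧ ∀ p : MvPolynomial (Fin d) ℝ, p.totalDegree ≤ r →
      ∀ (z : Space d) (h : ℝ) (T : Set (Space d)), 0 < h → h ≤ R → MeasurableSet T →
        ball z (σ * h) ⊆ T → T ⊆ closedBall z h →
        ∫ x in T, (polyEval p x - polyEval p z) ^ 2
          ≤ C * (∫ x in T, ‖polyGrad p x‖ ^ β) ^ (2 / β) := by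
  obtain ⟨C, hC, hbound⟩ := exists_abs_polyEval_sub_le d r hσ
  have hω := unitVol_pos d
  set e : ℝ := d + 2 - 2 * d / β with he
  refine ⟨unitVol d * C ^ 2 * unitVol d ^ (2 - 2 / β) * R ^ e, by positivity,
    fun p hp z h T hh hhR hTm hbT hTb => ?_⟩
  have hTint := integrableOn_of_continuous (continuous_polyGrad p).norm
    (isBounded_closedBall.subset hTb) hTm
  set I := ∫ x in T, ‖polyGrad p x‖
  set J := ∫ x in T, ‖polyGrad p x‖ ^ β
  have : 0 ≤ J := integral_nonneg fun x => Real.rpow_nonneg (norm_nonneg _) _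
  have hosc : ∀ x ∈ T, ‖polyEval p x - polyEval p z‖ ≤ C * (h * ((h ^ d)⁻¹ * I)) := by
    intro x hx
    refine (hbound p hp z h hh x (hTb hx)).trans ?_
    gcongr
    exact setIntegral_mono_set hTint (.of_forall fun _ => norm_nonneg _) hbT.eventuallyLE
  have hI : I ^ 2 ≤ (unitVol d * h ^ d) ^ (2 - 2 / β) * J ^ (2 / β) :=
    sq_setIntegral_le_mul_rpow hh hTm hTb (continuous_polyGrad p).norm (fun _ => norm_nonneg _) hβ
  have hpow : h ^ 2 * (h ^ d)⁻¹ * (h ^ d) ^ (2 - 2 / β) = h ^ e := by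
    rw [← Real.rpow_natCast_mul hh.le, ← Real.rpow_natCast, ← Real.rpow_natCast,
      ← Real.rpow_neg hh.le, ← Real.rpow_add hh, ← Real.rpow_add hh, he]
    congr 1
    push_cast
    ring
  calc ∫ x in T, (polyEval p x - polyEval p z) ^ 2
      ≤ unitVol d * h ^ d * (C * (h * ((h ^ d)⁻¹ * I))) ^ 2 := by
        simpa only [Real.norm_eq_abs, sq_abs] using setIntegral_norm_sq_le hh hTb hosc
    _ = unitVol d * C ^ 2 * (h ^ 2 * (h ^ d)⁻¹) * I ^ 2 := by field_simp
    _ ≤ unitVol d * C ^ 2 * (h ^ 2 * (h ^ d)⁻¹)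
        * ((unitVol d * h ^ d) ^ (2 - 2 / β) * J ^ (2 / β)) := by gcongr
    _ = unitVol d * C ^ 2 * unitVol d ^ (2 - 2 / β) * h ^ e * J ^ (2 / β) := by
      rw [Real.mul_rpow hω.le (by positivity), ← hpow]
      ring
    _ ≤ unitVol d * C ^ 2 * unitVol d ^ (2 - 2 / β) * R ^ e * J ^ (2 / β) := by
      have : 0 ≤ e := by linarith
      gcongr

end CellEstimates

/-! ### The Poincaré inequality on a star-shaped cell -/

section Mollification

open Metric
open scoped Convolution ENNReal

lemma sq_lintegral_le_lintegral_sq {α : Type*} [MeasurableSpace α] {μ : Measure α}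
    [IsProbabilityMeasure μ] {f : α → ℝ≥0∞} (hf : AEMeasurable f μ) :
    (∫⁻ x, f x ∂μ) ^ 2 ≤ ∫⁻ x, f x ^ 2 ∂μ := by
  have hholder := ENNReal.lintegral_mul_le_Lp_mul_Lq μ Real.HolderConjugate.two_two hf
    (aemeasurable_const (b := (1 : ℝ≥0∞)))
  simp only [Pi.mul_apply, mul_one, lintegral_const, measure_univ,
    ENNReal.rpow_two, one_pow, ENNReal.one_rpow] at hholder
  refine (pow_le_pow_left' hholder 2).trans_eq ?_
  rw [← ENNReal.rpow_two, ← ENNReal.rpow_mul, one_div_mul_cancel two_ne_zero, ENNReal.rpow_one]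

variable {d : ℕ} {E : Type*} [NormedAddCommGroup E] [NormedSpace ℝ E]

/-- The mollification `η * u` of a locally integrable function. -/
noncomputable def mollify (η : ContDiffBump (0 : Space d)) (u : Space d → E) : Space d → E :=
  η.normed volume ⋆[ContinuousLinearMap.lsmul ℝ ℝ, volume] u

/-- `G` is the weak gradient of `u` on the open set `T`. Unlike `IsWeakGradient`, this is a
condition on functions defined on the whole space. -/
def HasWeakGradientOn (u : Space d → ℝ) (G : Space d → Space d) (T : Set (Space d)) : Prop :=
  ∀ ψ : Space d → ℝ, IsTestFunction T ψ → ∀ i : Fin d,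
    ∫ x, u x * fderiv ℝ ψ x (EuclideanSpace.single i 1) = -∫ x, G x i * ψ x

lemma IsWeakGradient.hasWeakGradientOn_indicator {Ω T : Set (Space d)} {u : L2 Ω} {G : L2Vec Ω}
    (huG : IsWeakGradient u G) (hT : MeasurableSet T) (hTΩ : T ⊆ Ω) :
    HasWeakGradientOn (T.indicator u) (T.indicator G) T := by
  rintro ψ ⟨hψ, hψc, hψT⟩ i
  have hfderiv : Function.support (fun x => fderiv ℝ ψ x (EuclideanSpace.single i 1)) ⊆ T :=
    ((subset_tsupport _).trans (tsupport_fderiv_apply_subset ℝ _)).trans hψT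
  have hψsupp : Function.support ψ ⊆ T := (subset_tsupport ψ).trans hψT
  have hset : ∀ v k : Space d → ℝ, Function.support k ⊆ T →
      ∫ x, T.indicator v x * k x = ∫ x in Ω, v x * k x := fun v k hk => by
    have hvk : (fun x => v x * k x) = T.indicator fun x => v x * k x :=
      (indicator_eq_self.2 ((Function.support_mul_subset_right v k).trans hk)).symm
    rw [hvk, setIntegral_indicator hT, inter_eq_right.2 hTΩ, ← integral_indicator hT]
    simp only [indicator_mul_left]
  have hcoord : ∀ x, T.indicator G x i = T.indicator (fun x => G x i) x := fun x => by
    by_cases hx : x ∈ T <;> simp [hx]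
  simp only [hcoord]
  rw [hset _ _ hfderiv, hset _ _ hψsupp]
  exact huG ψ ⟨hψ, hψc, hψT.trans hTΩ⟩ i

variable (η : ContDiffBump (0 : Space d))

lemma mollify_eq_integral (u : Space d → E) (x : Space d) :
    mollify η u x = ∫ t, η.normed volume (x - t) • u t :=
  convolution_eq_swap _

lemma contDiff_mollify {u : Space d → E} (hu : LocallyIntegrable u volume) :
    ContDiff ℝ 1 (mollify η u) :=
  η.hasCompactSupport_normed.contDiff_convolution_left _ η.contDiff_normed hu

lemma hasCompactSupport_normed_sub (x : Space d) :
    HasCompactSupport fun t => η.normed volume (x - t) :=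
  η.hasCompactSupport_normed.comp_homeomorph (Homeomorph.subLeft x)

lemma isTestFunction_normed_sub {T : Set (Space d)} {x : Space d} (hx : closedBall x η.rOut ⊆ T) :
    IsTestFunction T fun t => η.normed volume (x - t) := by
  refine ⟨η.contDiff_normed.comp (contDiff_const.sub contDiff_id),
    hasCompactSupport_normed_sub η x,
    (closure_minimal (fun t ht => ?_) isClosed_closedBall).trans hx⟩
  have hsupp : x - t ∈ Function.support (η.normed volume) := ht
  rw [η.support_normed_eq, mem_ball_zero_iff, ← dist_eq_norm, dist_comm] at hsupp
  exact hsupp.le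

lemma fderiv_mollify_apply {u : Space d → ℝ} (hu : LocallyIntegrable u volume) (x w : Space d) :
    fderiv ℝ (mollify η u) x w
      = -∫ t, u t * fderiv ℝ (fun t => η.normed volume (x - t)) t w := by
  have hη : ContDiff ℝ 1 (η.normed volume) := η.contDiff_normed
  have hconv := (η.hasCompactSupport_normed.fderiv ℝ).convolutionExists_left
    ((ContinuousLinearMap.lsmul ℝ ℝ).precompL (Space d)) (hη.continuous_fderiv one_ne_zero) hu x
  rw [mollify, (η.hasCompactSupport_normed.hasFDerivAt_convolution_left _ hη hu x).fderiv,
    convolution_def, ContinuousLinearMap.integral_apply hconv,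
    ← integral_sub_left_eq_self _ volume x, ← integral_neg]
  refine integral_congr_ae (.of_forall fun t => ?_)
  have hchain := ((hη.differentiable one_ne_zero (x - t)).hasFDerivAt.comp t
    ((hasFDerivAt_id t).const_sub x)).fderiv
  rw [Function.comp_def] at hchain
  simp [hchain, mul_comm]

lemma HasWeakGradientOn.fderiv_mollify {u : Space d → ℝ} {G : Space d → Space d}
    {T : Set (Space d)} (huG : HasWeakGradientOn u G T) (hu : LocallyIntegrable u volume)
    (hG : LocallyIntegrable G volume) {x : Space d} (hx : closedBall x η.rOut ⊆ T) :
    fderiv ℝ (mollify η u) x = innerSL ℝ (mollify η G x) := by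
  have hGη : Integrable (fun t => η.normed volume (x - t) • G t) :=
    hG.integrable_smul_left_of_hasCompactSupport
      (η.continuous_normed.comp (continuous_const.sub continuous_id))
      (hasCompactSupport_normed_sub η x)
  refine ContinuousLinearMap.coe_injective
    ((EuclideanSpace.basisFun (Fin d) ℝ).toBasis.ext fun i => ?_)
  have hcoord := ContinuousLinearMap.integral_comp_comm (EuclideanSpace.proj (𝕜 := ℝ) i) hGη
  simp only [PiLp.proj_apply, PiLp.smul_apply, smul_eq_mul] at hcoord
  simp [fderiv_mollify_apply η hu, huG _ (isTestFunction_normed_sub η hx) i, mollify_eq_integral,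
    ← hcoord, EuclideanSpace.inner_single_right, mul_comm]

lemma isProbabilityMeasure_withDensity_normed :
    IsProbabilityMeasure
      ((volume : Measure (Space d)).withDensity fun t => ENNReal.ofReal (η.normed volume t)) where
  measure_univ := by
    rw [withDensity_apply _ .univ, Measure.restrict_univ, ← ofReal_integral_eq_lintegral_ofReal
      η.integrable_normed (.of_forall η.nonneg_normed), η.integral_normed, ENNReal.ofReal_one]

-- Jensen's inequality for the probability density `η`, integrated in space.
lemma lintegral_enorm_mollify_sq_le {u : Space d → E} (hu : StronglyMeasurable u) :
    ∫⁻ x, ‖mollify η u x‖ₑ ^ 2 ≤ ∫⁻ x, ‖u x‖ₑ ^ 2 := by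
  set ν := (volume : Measure (Space d)).withDensity fun t => ENNReal.ofReal (η.normed volume t)
  have : IsProbabilityMeasure ν := isProbabilityMeasure_withDensity_normed η
  have hη : Measurable fun t => ENNReal.ofReal (η.normed volume t) :=
    η.continuous_normed.measurable.ennreal_ofReal
  have hpt : ∀ x, ‖mollify η u x‖ₑ ^ 2 ≤ ∫⁻ t, ‖u (x - t)‖ₑ ^ 2 ∂ν := fun x => by
    have hux : Measurable fun t => ‖u (x - t)‖ₑ :=
      hu.enorm.comp (measurable_id.const_sub x)
    refine le_trans (pow_le_pow_left' ?_ 2) (sq_lintegral_le_lintegral_sq hux.aemeasurable)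
    rw [lintegral_withDensity_eq_lintegral_mul _ hη hux]
    refine (enorm_integral_le_lintegral_enorm _).trans_eq (lintegral_congr fun t => ?_)
    rw [ContinuousLinearMap.lsmul_apply, enorm_smul, Real.enorm_of_nonneg (η.nonneg_normed t),
      Pi.mul_apply]
  refine (lintegral_mono hpt).trans_eq ?_
  rw [lintegral_lintegral_swap
    ((hu.enorm.comp (measurable_fst.sub measurable_snd)).pow_const 2).aemeasurable]
  simp only [lintegral_sub_right_eq_self fun x => ‖u x‖ₑ ^ 2, lintegral_const, measure_univ,
    mul_one]

end Mollification

section Poincare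

open Metric Filter
open scoped ENNReal Topology

variable {d : ℕ}

lemma enorm_sub_sq_le_lintegral {v : Space d → ℝ} (hv : ContDiff ℝ 1 v) (x y : Space d) :
    ‖v x - v y‖ₑ ^ 2
      ≤ ∫⁻ k in Ioc (0 : ℝ) 1, (‖fderiv ℝ v (y + k • (x - y))‖ₑ * ‖x - y‖ₑ) ^ 2 := by
  have hline : ∀ k : ℝ, HasDerivAt (fun k : ℝ => y + k • (x - y)) (x - y) k := fun k => by
    simpa using ((hasDerivAt_id k).smul_const (x - y)).const_add y
  have hderiv : ∀ k : ℝ, HasDerivAt (fun k : ℝ => v (y + k • (x - y)))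
      (fderiv ℝ v (y + k • (x - y)) (x - y)) k := fun k =>
    (hv.differentiable one_ne_zero).differentiableAt.hasFDerivAt.comp_hasDerivAt k (hline k)
  have hcont : Continuous fun k : ℝ => fderiv ℝ v (y + k • (x - y)) (x - y) :=
    ((hv.continuous_fderiv one_ne_zero).comp (by fun_prop)).clm_apply continuous_const
  have hftc := intervalIntegral.integral_eq_sub_of_hasDerivAt (fun k _ => hderiv k)
    (hcont.intervalIntegrable 0 1)
  simp only [one_smul, zero_smul, add_zero, add_sub_cancel] at hftc
  have : IsProbabilityMeasure (volume.restrict (Ioc (0 : ℝ) 1)) := ⟨by simp⟩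
  rw [← hftc, intervalIntegral.integral_of_le zero_le_one]
  calc _ ≤ (∫⁻ k in Ioc (0 : ℝ) 1, ‖fderiv ℝ v (y + k • (x - y)) (x - y)‖ₑ) ^ 2 :=
        pow_le_pow_left' (enorm_integral_le_lintegral_enorm _) 2
    _ ≤ ∫⁻ k in Ioc (0 : ℝ) 1, ‖fderiv ℝ v (y + k • (x - y)) (x - y)‖ₑ ^ 2 :=
        sq_lintegral_le_lintegral_sq hcont.measurable.enorm.aemeasurable
    _ ≤ _ := by
        gcongr with k
        exact ContinuousLinearMap.le_opENorm _ _

lemma lintegral_comp_affine_le {m : Space d → ℝ≥0∞} (hm : Measurable m) {k : ℝ} (hk : 1 / 2 ≤ k)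
    (c : Space d) : ∫⁻ x, m (c + k • x) ≤ 2 ^ d * ∫⁻ x, m x := by
  have hk0 : 0 < k := by linarith
  rw [← lintegral_map (f := fun x => m (c + x)) (hm.comp (measurable_const_add c))
      (measurable_const_smul k), Measure.map_addHaar_smul _ hk0.ne', lintegral_smul_measure,
    lintegral_add_left_eq_self, finrank_euclideanSpace_fin, smul_eq_mul,
    abs_of_pos (by positivity), ← inv_pow]
  gcongr
  have hk2 : k⁻¹ ≤ 2 := by
    rw [inv_le_comm₀ hk0 two_pos]
    linarith
  calc ENNReal.ofReal (k⁻¹ ^ d) ≤ ENNReal.ofReal (2 ^ d) :=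
        ENNReal.ofReal_le_ofReal (pow_le_pow_left₀ (inv_nonneg.2 hk0.le) hk2 d)
    _ = 2 ^ d := by rw [ENNReal.ofReal_pow zero_le_two, ENNReal.ofReal_ofNat]

/-- For `1 / 2 ≤ k` the map `x ↦ y + k • (x - y)` contracts volumes by at most `2 ^ d`, for
`k ≤ 1 / 2` the map `y ↦ y + k • (x - y)` does. -/
lemma lintegral_lintegral_lineMap_le {m : Space d → ℝ≥0∞} (hm : Measurable m)
    {B T : Set (Space d)} (hBT : B ⊆ T) {k : ℝ} :
    ∫⁻ y in B, ∫⁻ x in T, m (y + k • (x - y)) ≤ 2 ^ d * volume T * ∫⁻ x, m x := by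
  rcases le_total (1 / 2) k with hk | hk
  · have hinner : ∀ y, ∫⁻ x in T, m (y + k • (x - y)) ≤ 2 ^ d * ∫⁻ x, m x := fun y => by
      refine (setLIntegral_le_lintegral _ _).trans ?_
      have hy : ∀ x, y + k • (x - y) = (y - k • y) + k • x := fun x => by module
      simp only [hy]
      exact lintegral_comp_affine_le hm hk _
    calc _ ≤ ∫⁻ _ in B, 2 ^ d * ∫⁻ x, m x := lintegral_mono hinner
      _ = 2 ^ d * volume B * ∫⁻ x, m x := by
        rw [lintegral_const, Measure.restrict_apply_univ, mul_right_comm]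
      _ ≤ _ := by gcongr
  · have hinner : ∀ x, ∫⁻ y in B, m (y + k • (x - y)) ≤ 2 ^ d * ∫⁻ x, m x := fun x => by
      refine (setLIntegral_le_lintegral _ _).trans ?_
      have hx : ∀ y, y + k • (x - y) = k • x + (1 - k) • y := fun y => by module
      simp only [hx]
      exact lintegral_comp_affine_le hm (by linarith) _
    rw [lintegral_lintegral_swap (f := fun y x => m (y + k • (x - y)))
      (hm.comp (by fun_prop)).aemeasurable]
    calc _ ≤ ∫⁻ _ in T, 2 ^ d * ∫⁻ x, m x := lintegral_mono hinner
      _ = _ := by rw [lintegral_const, Measure.restrict_apply_univ, mul_right_comm]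

lemma lintegral_segment_le {m : Space d → ℝ≥0∞} (hm : Measurable m) {B T : Set (Space d)}
    (hBT : B ⊆ T) :
    ∫⁻ y in B, ∫⁻ x in T, ∫⁻ k in Ioc (0 : ℝ) 1, m (y + k • (x - y))
      ≤ 2 ^ d * volume T * ∫⁻ x, m x := by
  have hmeas : Measurable fun q : Space d × ℝ => ∫⁻ x in T, m (q.1 + q.2 • (x - q.1)) :=
    Measurable.lintegral_prod_right' (f := fun q : (Space d × ℝ) × Space d =>
      m (q.1.1 + q.1.2 • (q.2 - q.1.1))) (hm.comp (by fun_prop))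
  calc _ = ∫⁻ y in B, ∫⁻ k in Ioc (0 : ℝ) 1, ∫⁻ x in T, m (y + k • (x - y)) :=
        lintegral_congr fun y => lintegral_lintegral_swap (hm.comp (by fun_prop)).aemeasurable
    _ = ∫⁻ k in Ioc (0 : ℝ) 1, ∫⁻ y in B, ∫⁻ x in T, m (y + k • (x - y)) :=
        lintegral_lintegral_swap hmeas.aemeasurable
    _ ≤ ∫⁻ _ in Ioc (0 : ℝ) 1, 2 ^ d * volume T * ∫⁻ x, m x :=
        lintegral_mono fun k => lintegral_lintegral_lineMap_le hm hBT
    _ = _ := by simp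

lemma lintegral_enorm_sub_sq_le_of_contDiff {v : Space d → ℝ} (hv : ContDiff ℝ 1 v)
    {B T : Set (Space d)} (hB : MeasurableSet B) (hT : MeasurableSet T) (hBT : B ⊆ T)
    (hstar : ∀ y ∈ B, StarConvex ℝ y T) {h : ℝ} (hdist : ∀ x ∈ T, ∀ y ∈ T, dist x y ≤ h) :
    ∫⁻ y in B, ∫⁻ x in T, ‖v x - v y‖ₑ ^ 2
      ≤ ENNReal.ofReal h ^ 2 * (2 ^ d * volume T * ∫⁻ x in T, ‖fderiv ℝ v x‖ₑ ^ 2) := by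
  set m := T.indicator fun x => ‖fderiv ℝ v x‖ₑ ^ 2 with hm_def
  have hm : Measurable m :=
    ((hv.continuous_fderiv one_ne_zero).measurable.enorm.pow_const 2).indicator hT
  have htop : ENNReal.ofReal h ^ 2 ≠ ⊤ := ENNReal.pow_ne_top ENNReal.ofReal_ne_top
  have hpt : ∀ y ∈ B, ∀ x ∈ T, ‖v x - v y‖ₑ ^ 2
      ≤ ENNReal.ofReal h ^ 2 * ∫⁻ k in Ioc (0 : ℝ) 1, m (y + k • (x - y)) := fun y hy x hx => by
    refine (enorm_sub_sq_le_lintegral hv x y).trans ?_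
    rw [← lintegral_const_mul' _ _ htop]
    refine setLIntegral_mono' measurableSet_Ioc fun k hk => ?_
    have hseg : y + k • (x - y) ∈ T := (hstar y hy).add_smul_sub_mem hx hk.1.le hk.2
    rw [hm_def, indicator_of_mem hseg, mul_pow, mul_comm]
    gcongr
    rw [← edist_eq_enorm_sub, edist_dist]
    exact ENNReal.ofReal_le_ofReal (hdist x hx y (hBT hy))
  calc _ ≤ ∫⁻ y in B, ∫⁻ x in T,
          ENNReal.ofReal h ^ 2 * ∫⁻ k in Ioc (0 : ℝ) 1, m (y + k • (x - y)) :=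
        setLIntegral_mono' hB fun y hy => setLIntegral_mono' hT (hpt y hy)
    _ = ENNReal.ofReal h ^ 2
          * ∫⁻ y in B, ∫⁻ x in T, ∫⁻ k in Ioc (0 : ℝ) 1, m (y + k • (x - y)) := by
        simp only [lintegral_const_mul' _ _ htop]
    _ ≤ _ := by
        rw [← lintegral_indicator hT]
        gcongr
        exact lintegral_segment_le hm hBT

/-- `T` contains the ball of radius `s` about `z` and is star-shaped with respect to each of its
points. -/
def IsStarShaped (z : Space d) (s : ℝ) (T : Set (Space d)) : Prop :=
  ball z s ⊆ T ∧ ∀ y ∈ ball z s, StarConvex ℝ y T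

/-- The set `T` contracted towards `z` by the factor `θ`. -/
def contract (z : Space d) (θ : ℝ) (T : Set (Space d)) : Set (Space d) :=
  AffineMap.homothety z θ⁻¹ ⁻¹' T

section Contract

variable {z : Space d} {s : ℝ} {T : Set (Space d)}

lemma measurableSet_contract (z : Space d) (θ : ℝ) (hT : MeasurableSet T) :
    MeasurableSet (contract z θ T) :=
  (AffineMap.homothety_continuous z θ⁻¹).measurable hT

lemma IsStarShaped.closedBall_subset (hT : IsStarShaped z s T) {θ ε : ℝ} (hθ0 : 0 < θ)
    (hθ1 : θ < 1) (hε : ε < (1 - θ) * s) {x : Space d} (hx : x ∈ contract z θ T) :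
    closedBall x ε ⊆ T := by
  intro q hq
  -- `q = (1 - θ) y + θ x'` where `x'` is the preimage of `x` in `T` and `y ∈ ball z s`.
  have hθ : 0 < 1 - θ := sub_pos.2 hθ1
  have hy : z + (1 - θ)⁻¹ • (q - x) ∈ ball z s := by
    rw [mem_ball, dist_eq_norm, add_sub_cancel_left, norm_smul, norm_inv, Real.norm_of_nonneg hθ.le,
      inv_mul_lt_iff₀ hθ, ← dist_eq_norm]
    exact lt_of_le_of_lt hq hε
  have hmem := hT.2 _ hy hx hθ.le hθ0.le (sub_add_cancel _ _)
  rw [AffineMap.homothety_apply, vsub_eq_sub, vadd_eq_add, add_comm _ z, smul_add, smul_add,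
    smul_inv_smul₀ hθ.ne', smul_inv_smul₀ hθ0.ne'] at hmem
  convert hmem using 1
  module

lemma IsStarShaped.contract_subset (hT : IsStarShaped z s T) (hs : 0 < s) {θ : ℝ} (hθ0 : 0 < θ)
    (hθ1 : θ < 1) : contract z θ T ⊆ T := fun _ hx =>
  hT.closedBall_subset hθ0 hθ1 (mul_pos (sub_pos.2 hθ1) hs) hx (mem_closedBall_self le_rfl)

lemma eventually_mem_contract (hT : IsOpen T) {x : Space d} (hx : x ∈ T) {θ : ℕ → ℝ}
    (hθ : Tendsto θ atTop (𝓝 1)) : ∀ᶠ n in atTop, x ∈ contract z (θ n) T := by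
  have hlim : Tendsto (fun n => (θ n)⁻¹ • (x - z) + z) atTop (𝓝 ((1 : ℝ)⁻¹ • (x - z) + z)) :=
    ((hθ.inv₀ one_ne_zero).smul_const _).add_const z
  rw [inv_one, one_smul, sub_add_cancel] at hlim
  exact hlim.eventually (hT.mem_nhds hx)

end Contract

lemma HasWeakGradientOn.lintegral_mollify_sub_sq_le {u : Space d → ℝ} {G : Space d → Space d}
    {T : Set (Space d)} (huG : HasWeakGradientOn u G T) (hu : LocallyIntegrable u volume)
    (hG : LocallyIntegrable G volume) (hGm : StronglyMeasurable G) (hTm : MeasurableSet T)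
    {z : Space d} {s h : ℝ} (hs : 0 < s) (hT : IsStarShaped z s T)
    (hdist : ∀ x ∈ T, ∀ y ∈ T, dist x y ≤ h) {θ : ℝ} (hθ0 : 0 < θ) (hθ1 : θ < 1)
    (η : ContDiffBump (0 : Space d)) (hη : η.rOut < (1 - θ) * s) :
    ∫⁻ y in contract z θ (ball z s), ∫⁻ x in contract z θ T, ‖mollify η u x - mollify η u y‖ₑ ^ 2
      ≤ ENNReal.ofReal h ^ 2 * (2 ^ d * volume T * ∫⁻ x, ‖G x‖ₑ ^ 2) := by
  have hsub : contract z θ T ⊆ T := hT.contract_subset hs hθ0 hθ1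
  have hcm := measurableSet_contract z θ hTm
  have hgrad : ∀ x ∈ contract z θ T, ‖fderiv ℝ (mollify η u) x‖ₑ = ‖mollify η G x‖ₑ :=
    fun x hx => by
      rw [huG.fderiv_mollify η hu hG (hT.closedBall_subset hθ0 hθ1 hη hx), ← ofReal_norm,
        innerSL_apply_norm, ofReal_norm]
  refine (lintegral_enorm_sub_sq_le_of_contDiff (contDiff_mollify η hu)
    (measurableSet_contract z θ measurableSet_ball) hcm (preimage_mono hT.1)
    (fun y hy => (hT.2 _ hy).affine_preimage _)
    fun x hx y hy => hdist x (hsub hx) y (hsub hy)).trans ?_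
  refine mul_le_mul_right (mul_le_mul' (mul_le_mul_right (measure_mono hsub) _) ?_) _
  calc _ = ∫⁻ x in contract z θ T, ‖mollify η G x‖ₑ ^ 2 :=
        setLIntegral_congr_fun hcm fun x hx => by simp only [hgrad x hx]
    _ ≤ ∫⁻ x, ‖mollify η G x‖ₑ ^ 2 := setLIntegral_le_lintegral _ _
    _ ≤ _ := lintegral_enorm_mollify_sq_le η hGm

lemma setLIntegral_le_of_tendsto {α : Type*} [MeasurableSpace α] {μ : Measure α} {s : Set α}
    {t : ℕ → Set α} {f : ℕ → α → ℝ≥0∞} {g : α → ℝ≥0∞} {A : ℝ≥0∞} (hs : MeasurableSet s)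
    (ht : ∀ n, MeasurableSet (t n)) (hf : ∀ n, Measurable (f n))
    (hst : ∀ x ∈ s, ∀ᶠ n in atTop, x ∈ t n)
    (hfg : ∀ᵐ x ∂μ, x ∈ s → Tendsto (fun n => f n x) atTop (𝓝 (g x)))
    (hA : ∀ n, ∫⁻ x in t n, f n x ∂μ ≤ A) : ∫⁻ x in s, g x ∂μ ≤ A := by
  have hlim : ∀ᵐ x ∂μ.restrict s, g x ≤ liminf (fun n => (t n).indicator (f n) x) atTop := by
    rw [ae_restrict_iff' hs]
    filter_upwards [hfg] with x hx hxs
    refine (((hx hxs).congr' ?_).liminf_eq).ge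
    filter_upwards [hst x hxs] with n hn
    rw [indicator_of_mem hn]
  calc _ ≤ ∫⁻ x in s, liminf (fun n => (t n).indicator (f n) x) atTop ∂μ := lintegral_mono_ae hlim
    _ ≤ liminf (fun n => ∫⁻ x in s, (t n).indicator (f n) x ∂μ) atTop :=
        lintegral_liminf_le fun n => (hf n).indicator (ht n)
    _ ≤ liminf (fun _ : ℕ => A) atTop := by
        refine liminf_le_liminf (.of_forall fun n => ?_)
        refine (setLIntegral_le_lintegral _ _).trans ?_
        rw [lintegral_indicator (ht n)]
        exact hA n
    _ = A := liminf_const A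

lemma exists_seq_contDiffBump (d : ℕ) {s : ℝ} (hs : 0 < s) :
    ∃ (θ : ℕ → ℝ) (η : ℕ → ContDiffBump (0 : Space d)),
      (∀ n, 0 < θ n ∧ θ n < 1 ∧ (η n).rOut < (1 - θ n) * s) ∧
      Tendsto θ atTop (𝓝 1) ∧ Tendsto (fun n => (η n).rOut) atTop (𝓝 0) ∧
      ∀ n, (η n).rOut ≤ 2 * (η n).rIn := by
  obtain ⟨τ, -, hτ, hτlim⟩ := exists_seq_strictAnti_tendsto' (zero_lt_one (α := ℝ))
  have hτs : ∀ n, 0 < τ n * s := fun n => mul_pos (hτ n).1 hs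
  refine ⟨fun n => 1 - τ n, fun n => ⟨τ n * s / 4, τ n * s / 2, by linarith [hτs n],
    by linarith [hτs n]⟩, fun n => ⟨by linarith [(hτ n).2], by linarith [(hτ n).1], ?_⟩,
    by simpa using hτlim.const_sub 1, by simpa using (hτlim.mul_const s).div_const 2, fun n => ?_⟩
  · rw [sub_sub_cancel]
    exact half_lt_self (hτs n)
  · exact le_of_eq (by ring)

lemma HasWeakGradientOn.lintegral_sub_sq_le {u : Space d → ℝ} {G : Space d → Space d}
    {T : Set (Space d)} (huG : HasWeakGradientOn u G T) (hu : LocallyIntegrable u volume)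
    (hum : Measurable u) (hG : LocallyIntegrable G volume) (hGm : StronglyMeasurable G)
    (hTo : IsOpen T) {z : Space d} {s h : ℝ} (hs : 0 < s) (hT : IsStarShaped z s T)
    (hdist : ∀ x ∈ T, ∀ y ∈ T, dist x y ≤ h) :
    ∫⁻ y in ball z s, ∫⁻ x in T, ‖u x - u y‖ₑ ^ 2
      ≤ ENNReal.ofReal h ^ 2 * (2 ^ d * volume T * ∫⁻ x, ‖G x‖ₑ ^ 2) := by
  obtain ⟨θ, η, hθη, hθ, hη, hη2⟩ := exists_seq_contDiffBump d hs
  have hlim : ∀ᵐ x, Tendsto (fun n => mollify (η n) u x) atTop (𝓝 (u x)) :=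
    ContDiffBump.ae_convolution_tendsto_right_of_locallyIntegrable hη (.of_forall hη2) hu
  have hmeas : ∀ v : Space d → ℝ, Measurable v →
      Measurable fun q : Space d × Space d => ‖v q.2 - v q.1‖ₑ ^ 2 := fun v hv =>
    ((hv.comp measurable_snd).sub (hv.comp measurable_fst)).enorm.pow_const 2
  have hmol := fun n => hmeas _ (contDiff_mollify (η n) hu).continuous.measurable
  rw [← lintegral_prod _ (hmeas u hum).aemeasurable, Measure.prod_restrict]
  refine setLIntegral_le_of_tendsto
    (t := fun n => contract z (θ n) (ball z s) ×ˢ contract z (θ n) T)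
    (measurableSet_ball.prod hTo.measurableSet)
    (fun n => (measurableSet_contract z _ measurableSet_ball).prod
      (measurableSet_contract z _ hTo.measurableSet)) hmol (fun q hq => ?_) ?_ fun n => ?_
  · filter_upwards [eventually_mem_contract isOpen_ball hq.1 hθ,
      eventually_mem_contract hTo hq.2 hθ] with n hn₁ hn₂ using ⟨hn₁, hn₂⟩
  · filter_upwards [Measure.quasiMeasurePreserving_fst.ae hlim,
      Measure.quasiMeasurePreserving_snd.ae hlim] with q hq₁ hq₂ _
    exact ((ENNReal.continuous_pow 2).tendsto _).comp (hq₂.sub hq₁).enorm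
  · rw [← Measure.prod_restrict, lintegral_prod _ (hmol n).aemeasurable]
    exact huG.lintegral_mollify_sub_sq_le hu hG hGm hTo.measurableSet hs hT hdist (hθη n).1
      (hθη n).2.1 (η n) (hθη n).2.2

lemma volume_le_mul_volume_ball {σ h : ℝ} (hσ : 0 < σ) (hh : 0 < h) {z : Space d}
    {T : Set (Space d)} (hT : T ⊆ closedBall z h) :
    volume T ≤ ENNReal.ofReal (σ ^ d)⁻¹ * volume (ball z (σ * h)) := by
  refine (measure_mono hT).trans_eq ?_
  rw [Measure.addHaar_closedBall _ _ hh.le, Measure.addHaar_ball_of_pos _ _ (mul_pos hσ hh),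
    ← mul_assoc, ← ENNReal.ofReal_mul (by positivity), finrank_euclideanSpace_fin, mul_pow,
    inv_mul_cancel_left₀ (by positivity)]

lemma HasWeakGradientOn.exists_lintegral_sub_sq_le {u : Space d → ℝ} {G : Space d → Space d}
    {T : Set (Space d)} (huG : HasWeakGradientOn u G T) (hu : LocallyIntegrable u volume)
    (hum : Measurable u) (hG : LocallyIntegrable G volume) (hGm : StronglyMeasurable G)
    (hTo : IsOpen T) {z : Space d} {σ h : ℝ} (hσ : 0 < σ) (hh : 0 < h)
    (hT : IsStarShaped z (σ * h) T) (hdist : ∀ x ∈ T, ∀ y ∈ T, dist x y ≤ h) :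
    ∃ c : ℝ, ∫⁻ x in T, ‖u x - c‖ₑ ^ 2
      ≤ ENNReal.ofReal (2 ^ d * (σ ^ d)⁻¹ * h ^ 2) * ∫⁻ x, ‖G x‖ₑ ^ 2 := by
  have hs : 0 < σ * h := mul_pos hσ hh
  have hball : volume (ball z (σ * h)) ≠ 0 := (measure_ball_pos _ _ hs).ne'
  have hTball : T ⊆ closedBall z h := fun x hx => hdist x hx z (hT.1 (mem_ball_self hs))
  have hmeas : Measurable fun q : Space d × Space d => ‖u q.2 - u q.1‖ₑ ^ 2 :=
    ((hum.comp measurable_snd).sub (hum.comp measurable_fst)).enorm.pow_const 2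
  obtain ⟨y, -, hy⟩ := exists_le_setLAverage (μ := volume) hball measure_ball_lt_top.ne
    (f := fun y => ∫⁻ x in T, ‖u x - u y‖ₑ ^ 2) hmeas.lintegral_prod_right'.aemeasurable
  refine ⟨u y, hy.trans ?_⟩
  rw [setLAverage_eq, ENNReal.div_le_iff hball measure_ball_lt_top.ne]
  calc _ ≤ ENNReal.ofReal h ^ 2 * (2 ^ d * volume T * ∫⁻ x, ‖G x‖ₑ ^ 2) :=
        huG.lintegral_sub_sq_le hu hum hG hGm hTo hs hT hdist
    _ ≤ ENNReal.ofReal h ^ 2 * (2 ^ d * (ENNReal.ofReal (σ ^ d)⁻¹ * volume (ball z (σ * h)))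
          * ∫⁻ x, ‖G x‖ₑ ^ 2) := by
        gcongr
        exact volume_le_mul_volume_ball hσ hh hTball
    _ = _ := by
        rw [ENNReal.ofReal_mul (by positivity), ENNReal.ofReal_mul (by positivity),
          ENNReal.ofReal_pow zero_le_two, ENNReal.ofReal_ofNat, ENNReal.ofReal_pow hh.le]
        ring

lemma ofReal_integral_norm_sq {α E : Type*} [MeasurableSpace α] [NormedAddCommGroup E]
    {μ : Measure α} {f : α → E} (hf : MemLp f 2 μ) :
    ENNReal.ofReal (∫ x, ‖f x‖ ^ 2 ∂μ) = ∫⁻ x, ‖f x‖ₑ ^ 2 ∂μ := by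
  rw [ofReal_integral_eq_lintegral_ofReal (hf.integrable_norm_pow two_ne_zero)
    (.of_forall fun _ => sq_nonneg _)]
  simp only [ENNReal.ofReal_pow (norm_nonneg _), ofReal_norm]

lemma IsWeakGradient.exists_setIntegral_sub_sq_le {Ω : Set (Space d)} {u : L2 Ω} {G : L2Vec Ω}
    (huG : IsWeakGradient u G) {T : Set (Space d)} (hTo : IsOpen T) (hTΩ : T ⊆ Ω) {z : Space d}
    {σ h : ℝ} (hσ : 0 < σ) (hh : 0 < h) (hT : IsStarShaped z (σ * h) T)
    (hdist : ∀ x ∈ T, ∀ y ∈ T, dist x y ≤ h) :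
    ∃ c : ℝ, ∫ x in T, (u x - c) ^ 2 ≤ 2 ^ d * (σ ^ d)⁻¹ * h ^ 2 * ∫ x in T, ‖G x‖ ^ 2 := by
  have hTm := hTo.measurableSet
  have huT : MemLp u 2 (volume.restrict T) :=
    (Lp.memLp u).mono_measure (Measure.restrict_mono hTΩ le_rfl)
  have hGT : MemLp G 2 (volume.restrict T) :=
    (Lp.memLp G).mono_measure (Measure.restrict_mono hTΩ le_rfl)
  have hGs := (Lp.stronglyMeasurable G).indicator hTm
  obtain ⟨c, hc⟩ := (huG.hasWeakGradientOn_indicator hTm hTΩ).exists_lintegral_sub_sq_le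
    (((memLp_indicator_iff_restrict hTm).2 huT).locallyIntegrable one_le_two)
    ((Lp.stronglyMeasurable u).measurable.indicator hTm)
    (((memLp_indicator_iff_restrict hTm).2 hGT).locallyIntegrable one_le_two) hGs hTo hσ hh hT hdist
  refine ⟨c, ?_⟩
  have : IsFiniteMeasure (volume.restrict T) := isFiniteMeasure_restrict.2
    (isBounded_iff.2 ⟨h, fun x hx y hy => hdist x hx y hy⟩).measure_lt_top.ne
  have hu : ∫⁻ x in T, ‖T.indicator u x - c‖ₑ ^ 2
      = ENNReal.ofReal (∫ x in T, ‖u x - c‖ ^ 2) := by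
    refine .trans ?_ (ofReal_integral_norm_sq (huT.sub (memLp_const c))).symm
    exact setLIntegral_congr_fun hTm fun x hx => by simp [indicator_of_mem hx]
  have hG : ∫⁻ x, ‖T.indicator G x‖ₑ ^ 2 = ENNReal.ofReal (∫ x in T, ‖G x‖ ^ 2) := by
    rw [ofReal_integral_norm_sq hGT, ← lintegral_indicator hTm]
    exact lintegral_congr fun x => by by_cases hx : x ∈ T <;> simp [hx]
  rw [hu, hG, ← ENNReal.ofReal_mul (by positivity),
    ENNReal.ofReal_le_ofReal_iff (by positivity)] at hc
  simpa only [Real.norm_eq_abs, sq_abs] using hc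

end Poincare

/-! ### Finite element estimates -/

section FiniteElements

lemma norm_lp_two_sq_eq_integral {α E : Type*} [MeasurableSpace α] {μ : Measure α}
    [NormedAddCommGroup E] [InnerProductSpace ℝ E] (f : Lp E 2 μ) :
    ‖f‖ ^ 2 = ∫ x, ‖f x‖ ^ 2 ∂μ := by
  simp only [← real_inner_self_eq_norm_sq, L2.inner_def]

variable {d : ℕ} {Ω : Set (Space d)} {σ h : ℝ}

namespace Mesh

variable (M : Mesh Ω σ h) {r : ℕ}

/-- The centre of the ball with respect to which the cell `T` is star-shaped. -/
noncomputable def center (T : Fin M.card) : Space d := (M.star T).choose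

lemma isStarShaped_cell (T : Fin M.card) : IsStarShaped (M.center T) (σ * h) (M.cell T) :=
  (M.star T).choose_spec

lemma cell_subset_closedBall (hσ : 0 < σ) (hh : 0 < h) (T : Fin M.card) :
    M.cell T ⊆ Metric.closedBall (M.center T) h := fun x hx =>
  M.dist_le T x hx _ ((M.isStarShaped_cell T).1 (Metric.mem_ball_self (by positivity)))

lemma measurableSet_cell (T : Fin M.card) : MeasurableSet (M.cell T) :=
  (M.isOpen_cell T).measurableSet

lemma sum_indicator_eq_of_mem {E : Type*} [AddCommMonoid E] (f : Fin M.card → Space d → E)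
    {T : Fin M.card} {x : Space d} (hx : x ∈ M.cell T) :
    ∑ T', (M.cell T').indicator (f T') x = f T x := by
  rw [Finset.sum_eq_single T, indicator_of_mem hx]
  · exact fun T' _ hne =>
      indicator_of_notMem (fun hx' => (M.disjoint_cell hne).le_bot ⟨hx', hx⟩) _
  · simp

lemma iUnion_cell_ae_eq : (⋃ T, M.cell T) =ᵐ[volume] Ω :=
  (iUnion_subset M.cell_subset).eventuallyLE.antisymm (ae_le_set.2 M.cover)

lemma integral_eq_sum_setIntegral {f : Space d → ℝ} (hf : ∀ T, IntegrableOn f (M.cell T)) :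
    ∫ x in Ω, f x = ∑ T, ∫ x in M.cell T, f x := by
  rw [← setIntegral_congr_set M.iUnion_cell_ae_eq]
  exact integral_iUnion_fintype M.measurableSet_cell M.disjoint_cell hf

lemma memLp_cell {E : Type*} [NormedAddCommGroup E] (f : Lp E 2 (volume.restrict Ω))
    (T : Fin M.card) : MemLp f 2 (volume.restrict (M.cell T)) :=
  (Lp.memLp f).mono_measure (Measure.restrict_mono (M.cell_subset T) le_rfl)

lemma norm_sq_eq_sum {E : Type*} [NormedAddCommGroup E] [InnerProductSpace ℝ E]
    (f : Lp E 2 (volume.restrict Ω)) : ‖f‖ ^ 2 = ∑ T, ∫ x in M.cell T, ‖f x‖ ^ 2 := by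
  rw [norm_lp_two_sq_eq_integral, M.integral_eq_sum_setIntegral fun T =>
    (M.memLp_cell f T).integrable_norm_pow two_ne_zero]

lemma memLp_grad (v : M.PolySpace r) : MemLp (M.grad v) 2 (volume.restrict Ω) := by
  refine memLp_finsetSum _ fun T _ => ?_
  rw [memLp_indicator_iff_restrict (M.measurableSet_cell T)]
  exact (memLp_restrict_of_continuous (continuous_polyGrad _) (M.isBounded_cell T)
    (M.measurableSet_cell T) 2).mono_measure
      (Measure.restrict_mono_measure Measure.restrict_le_self _)

lemma grad_add (v w : M.PolySpace r) : M.grad (v + w) = M.grad v + M.grad w := by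
  funext x
  have (p q : MvPolynomial (Fin d) ℝ) : polyGrad (p + q) = polyGrad p + polyGrad q :=
    congrArg DFunLike.coe (map_add (polyGradₗ d) p q)
  simp [grad, this, indicator_add', Finset.sum_add_distrib]

lemma grad_smul (c : ℝ) (v : M.PolySpace r) : M.grad (c • v) = c • M.grad v := by
  funext x
  have (p : MvPolynomial (Fin d) ℝ) : polyGrad (c • p) = c • polyGrad p :=
    congrArg DFunLike.coe (map_smul (polyGradₗ d) c p)
  simp only [grad, Pi.smul_apply, Finset.smul_sum]
  refine Finset.sum_congr rfl fun T _ => ?_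
  by_cases hx : x ∈ M.cell T <;> simp [hx, this]

/-- The elementwise gradient of a piecewise polynomial as an element of `(L²(Ω))ᵈ`. -/
noncomputable def gradL2 (r : ℕ) : M.PolySpace r →ₗ[ℝ] L2Vec Ω where
  toFun v := (M.memLp_grad v).toLp (M.grad v)
  map_add' v w := by
    rw [← MemLp.toLp_add]
    congr 1
    exact M.grad_add v w
  map_smul' c v := by
    rw [RingHom.id_apply, ← MemLp.toLp_const_smul]
    congr 1
    exact M.grad_smul c v

lemma coeFn_gradL2 (v : M.PolySpace r) : M.gradL2 r v =ᵐ[volume.restrict Ω] M.grad v :=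
  (M.memLp_grad v).coeFn_toLp

lemma toL2_ae_eq_polyEval (v : M.PolySpace r) (T : Fin M.card) :
    M.toL2 r v =ᵐ[volume.restrict (M.cell T)] polyEval (v T : MvPolynomial (Fin d) ℝ) := by
  filter_upwards [ae_restrict_of_ae_restrict_of_subset (M.cell_subset T)
    (M.memLp_eval v).coeFn_toLp, ae_restrict_mem (M.measurableSet_cell T)] with x hx hxT
  exact hx.trans (M.sum_indicator_eq_of_mem _ hxT)

lemma gradL2_ae_eq_polyGrad (v : M.PolySpace r) (T : Fin M.card) :
    M.gradL2 r v =ᵐ[volume.restrict (M.cell T)] polyGrad (v T : MvPolynomial (Fin d) ℝ) := by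
  filter_upwards [ae_restrict_of_ae_restrict_of_subset (M.cell_subset T) (M.coeFn_gradL2 v),
    ae_restrict_mem (M.measurableSet_cell T)] with x hx hxT
  exact hx.trans (M.sum_indicator_eq_of_mem _ hxT)

lemma norm_toL2_sq (v : M.PolySpace r) :
    ‖M.toL2 r v‖ ^ 2 = ∑ T, ∫ x in M.cell T, polyEval (v T : MvPolynomial (Fin d) ℝ) x ^ 2 := by
  rw [M.norm_sq_eq_sum]
  refine Finset.sum_congr rfl fun T _ => integral_congr_ae ?_
  filter_upwards [M.toL2_ae_eq_polyEval v T] with x hx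
  rw [hx, Real.norm_eq_abs, sq_abs]

lemma norm_gradL2_sq (v : M.PolySpace r) :
    ‖M.gradL2 r v‖ ^ 2
      = ∑ T, ∫ x in M.cell T, ‖polyGrad (v T : MvPolynomial (Fin d) ℝ) x‖ ^ 2 := by
  rw [M.norm_sq_eq_sum]
  refine Finset.sum_congr rfl fun T _ => integral_congr_ae ?_
  filter_upwards [M.gradL2_ae_eq_polyGrad v T] with x hx
  rw [hx]

lemma integral_norm_gradL2_rpow {β : ℝ} (hβ : 0 ≤ β) (v : M.PolySpace r) :
    ∫ x in Ω, ‖M.gradL2 r v x‖ ^ β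
      = ∑ T, ∫ x in M.cell T, ‖polyGrad (v T : MvPolynomial (Fin d) ℝ) x‖ ^ β := by
  have hae (T : Fin M.card) : (fun x => ‖M.gradL2 r v x‖ ^ β) =ᵐ[volume.restrict (M.cell T)]
      fun x => ‖polyGrad (v T : MvPolynomial (Fin d) ℝ) x‖ ^ β := by
    filter_upwards [M.gradL2_ae_eq_polyGrad v T] with x hx
    rw [hx]
  have hcont (p : MvPolynomial (Fin d) ℝ) : Continuous fun x => ‖polyGrad p x‖ ^ β :=
    (continuous_polyGrad p).norm.rpow_const fun _ => .inr hβ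
  rw [M.integral_eq_sum_setIntegral fun T => (integrableOn_of_continuous (hcont _)
    (M.isBounded_cell T) (M.measurableSet_cell T)).congr (hae T).symm]
  exact Finset.sum_congr rfl fun T _ => integral_congr_ae (hae T)

/-- The piecewise constant function with the values `c T`, as an element of `W_h`. -/
noncomputable def piecewiseConst (r : ℕ) (c : Fin M.card → ℝ) : M.PolySpace r := fun T =>
  ⟨MvPolynomial.C (c T), by simp [MvPolynomial.mem_restrictTotalDegree]⟩

lemma gradL2_piecewiseConst (c : Fin M.card → ℝ) : M.gradL2 r (M.piecewiseConst r c) = 0 := by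
  have hconst (T : Fin M.card) (x : Space d) : polyGrad (MvPolynomial.C (c T)) x = 0 := by
    ext i
    simp [polyGrad, polyEval]
  rw [← norm_eq_zero, ← sq_eq_zero_iff, norm_gradL2_sq]
  simp [piecewiseConst, hconst]

lemma norm_sub_piecewiseConst_sq (u : L2 Ω) (c : Fin M.card → ℝ) :
    ‖u - M.toL2 r (M.piecewiseConst r c)‖ ^ 2 = ∑ T, ∫ x in M.cell T, (u x - c T) ^ 2 := by
  rw [M.norm_sq_eq_sum]
  refine Finset.sum_congr rfl fun T _ => integral_congr_ae ?_
  filter_upwards [M.toL2_ae_eq_polyEval (M.piecewiseConst r c) T,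
    ae_restrict_of_ae_restrict_of_subset (M.cell_subset T) (Lp.coeFn_sub u _)] with x hx hsub
  rw [hsub, Pi.sub_apply, hx, Real.norm_eq_abs, sq_abs]
  simp [piecewiseConst, polyEval]

lemma toL2_proj (w : L2 Ω) : M.toL2 r (M.proj r w) = (M.toL2 r).range.starProjection w := by
  refine (Submodule.eq_starProjection_of_mem_of_inner_eq_zero
    (LinearMap.mem_range_self (M.toL2 r) _) ?_).symm
  rintro _ ⟨v, rfl⟩
  rw [inner_sub_left, M.proj_spec, sub_self]

lemma norm_toL2_proj_le (w : L2 Ω) : ‖M.toL2 r (M.proj r w)‖ ≤ ‖w‖ := by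
  rw [toL2_proj]
  exact Submodule.norm_starProjection_apply_le _ _

lemma norm_toL2_proj_sub_le (w : L2 Ω) (v : M.PolySpace r) :
    ‖M.toL2 r (M.proj r w - v)‖ ≤ ‖w - M.toL2 r v‖ := by
  have hfix : (M.toL2 r).range.starProjection (M.toL2 r v) = M.toL2 r v :=
    Submodule.starProjection_eq_self_iff.2 (LinearMap.mem_range_self (M.toL2 r) v)
  rw [map_sub, toL2_proj, ← hfix, ← map_sub, hfix]
  exact Submodule.norm_starProjection_apply_le _ _

lemma totalDegree_le (v : M.PolySpace r) (T : Fin M.card) :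
    (v T : MvPolynomial (Fin d) ℝ).totalDegree ≤ r :=
  (MvPolynomial.mem_restrictTotalDegree _ _ _).1 (v T).2

end Mesh

end FiniteElements

section FiniteElementEstimates

variable {d : ℕ}

lemma Mesh.exists_norm_gradL2_sq_le (d r : ℕ) {σ : ℝ} (hσ : 0 < σ) :
    ∃ C : ℝ, 0 < C ∧ ∀ (Ω : Set (Space d)) (h : ℝ), 0 < h → ∀ (M : Mesh Ω σ h) (v : M.PolySpace r),
      ‖M.gradL2 r v‖ ^ 2 ≤ C * (h ^ 2)⁻¹ * ‖M.toL2 r v‖ ^ 2 := by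
  obtain ⟨C, hC, hbound⟩ := exists_setIntegral_norm_polyGrad_sq_le d r hσ
  refine ⟨C, hC, fun Ω h hh M v => ?_⟩
  rw [M.norm_gradL2_sq, M.norm_toL2_sq, Finset.mul_sum]
  exact Finset.sum_le_sum fun T _ => hbound _ (M.totalDegree_le v T) (M.center T) h _ hh
    (M.measurableSet_cell T) (M.isStarShaped_cell T).1 (M.cell_subset_closedBall hσ hh T)

lemma IsWeakGradient.exists_norm_sub_piecewiseConst_sq_le {Ω : Set (Space d)} {u : L2 Ω}
    {G : L2Vec Ω} (huG : IsWeakGradient u G) {σ h : ℝ} (hσ : 0 < σ) (hh : 0 < h) (M : Mesh Ω σ h)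
    (r : ℕ) :
    ∃ c, ‖u - M.toL2 r (M.piecewiseConst r c)‖ ^ 2 ≤ 2 ^ d * (σ ^ d)⁻¹ * h ^ 2 * ‖G‖ ^ 2 := by
  choose c hc using fun T => huG.exists_setIntegral_sub_sq_le (M.isOpen_cell T) (M.cell_subset T)
    hσ hh (M.isStarShaped_cell T) (M.dist_le T)
  refine ⟨c, ?_⟩
  rw [M.norm_sub_piecewiseConst_sq, M.norm_sq_eq_sum, Finset.mul_sum]
  exact Finset.sum_le_sum fun T _ => hc T

lemma Mesh.exists_norm_gradL2_proj_sq_le (d r : ℕ) {σ : ℝ} (hσ : 0 < σ) :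
    ∃ C : ℝ, 0 < C ∧ ∀ (Ω : Set (Space d)) (h : ℝ), 0 < h → ∀ (M : Mesh Ω σ h) (φ : H1 Ω),
      ‖M.gradL2 r (M.proj r (H1.fn φ))‖ ^ 2 ≤ C * ‖φ‖ ^ 2 := by
  obtain ⟨C, hC, hinv⟩ := exists_norm_gradL2_sq_le d r hσ
  refine ⟨C * (2 ^ d * (σ ^ d)⁻¹), by positivity, fun Ω h hh M φ => ?_⟩
  set G : L2Vec Ω := (φ : WithLp 2 (L2 Ω × L2Vec Ω)).snd
  have hweak : IsWeakGradient (H1.fn φ) G := φ.2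
  obtain ⟨c, hc⟩ := hweak.exists_norm_sub_piecewiseConst_sq_le hσ hh M r
  set q := M.piecewiseConst r c with hq
  have hG : ‖G‖ ^ 2 ≤ ‖φ‖ ^ 2 := by
    have : ‖φ‖ ^ 2 = ‖H1.fn φ‖ ^ 2 + ‖G‖ ^ 2 := WithLp.prod_norm_sq_eq_of_L2 _
    linarith [sq_nonneg ‖H1.fn φ‖]
  calc ‖M.gradL2 r (M.proj r (H1.fn φ))‖ ^ 2 = ‖M.gradL2 r (M.proj r (H1.fn φ) - q)‖ ^ 2 := by
        rw [map_sub, hq, M.gradL2_piecewiseConst, sub_zero]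
    _ ≤ C * (h ^ 2)⁻¹ * ‖M.toL2 r (M.proj r (H1.fn φ) - q)‖ ^ 2 := hinv Ω h hh M _
    _ ≤ C * (h ^ 2)⁻¹ * (2 ^ d * (σ ^ d)⁻¹ * h ^ 2 * ‖φ‖ ^ 2) := by
        have := pow_le_pow_left₀ (norm_nonneg _) (M.norm_toL2_proj_sub_le (H1.fn φ) q) 2
        refine mul_le_mul_of_nonneg_left (this.trans (hc.trans ?_)) (by positivity)
        gcongr
    _ = C * (2 ^ d * (σ ^ d)⁻¹) * ‖φ‖ ^ 2 := by field_simp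

lemma Mesh.size_le {Ω : Set (Space d)} {σ h D : ℝ} (hd : 0 < d) (hσ : 0 < σ) (hh : 0 < h)
    (hD : ∀ x ∈ Ω, ∀ y ∈ Ω, dist x y ≤ D) (M : Mesh Ω σ h) (T : Fin M.card) : h ≤ 2 * D / σ := by
  have hball := (M.isStarShaped_cell T).1.trans (M.cell_subset T)
  set e : Space d := EuclideanSpace.single ⟨0, hd⟩ (σ * h / 2) with he
  have hnorm : ‖e‖ = σ * h / 2 := by
    rw [he, PiLp.norm_single, Real.norm_of_nonneg (by positivity)]
  have hmem : M.center T + e ∈ Metric.ball (M.center T) (σ * h) := by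
    rw [mem_ball_iff_norm, add_sub_cancel_left, hnorm]
    exact half_lt_self (by positivity)
  have hdist := hD _ (hball hmem) _ (hball (Metric.mem_ball_self (by positivity)))
  rw [dist_eq_norm, add_sub_cancel_left, hnorm] at hdist
  rw [le_div_iff₀ hσ]
  linarith

lemma sum_rpow_le_rpow_sum {ι : Type*} (s : Finset ι) {x : ι → ℝ} (hx : ∀ i, 0 ≤ x i) {q : ℝ}
    (hq : 1 ≤ q) : ∑ i ∈ s, x i ^ q ≤ (∑ i ∈ s, x i) ^ q := by
  classical
  induction s using Finset.induction_on with
  | empty => simp [Real.zero_rpow (by linarith : q ≠ 0)]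
  | insert i s hi ih =>
    rw [Finset.sum_insert hi, Finset.sum_insert hi]
    exact (add_le_add_right ih _).trans
      (Real.add_rpow_le_rpow_add (hx i) (Finset.sum_nonneg fun j _ => hx j) hq)

lemma Mesh.exists_norm_sub_piecewiseConst_sq_le (hd : 0 < d) (r : ℕ) {σ β : ℝ} (hσ : 0 < σ)
    (hβ : 1 < β) (hβ2 : β ≤ 2) (hdeg : 2 * d / β ≤ d + 2) {Ω : Set (Space d)}
    (hΩ : Bornology.IsBounded Ω) :
    ∃ C : ℝ, 0 < C ∧ ∀ (h : ℝ), 0 < h → ∀ (M : Mesh Ω σ h) (v : M.PolySpace r),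
      ∃ c, ‖M.toL2 r v - M.toL2 r (M.piecewiseConst r c)‖ ^ 2
        ≤ C * (∫ x in Ω, ‖M.gradL2 r v x‖ ^ β) ^ (2 / β) := by
  obtain ⟨D, hD⟩ := Metric.isBounded_iff.1 hΩ
  have hβ₀ : 0 < β := by linarith
  obtain ⟨C, hC, hcell⟩ := exists_setIntegral_polyEval_sub_sq_le d r (R := max (2 * D / σ) 1) hσ hβ
    hdeg (lt_max_of_lt_right one_pos)
  refine ⟨C, hC, fun h hh M v =>
    ⟨fun T => polyEval (v T : MvPolynomial (Fin d) ℝ) (M.center T), ?_⟩⟩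
  rw [M.norm_sub_piecewiseConst_sq, M.integral_norm_gradL2_rpow hβ₀.le]
  refine (Finset.sum_le_sum fun T _ => ?_).trans
    (b := ∑ T, C * (∫ x in M.cell T, ‖polyGrad (v T : MvPolynomial (Fin d) ℝ) x‖ ^ β) ^ (2 / β)) ?_
  · have hsize := M.size_le hd hσ hh (fun x hx y hy => hD hx hy) T
    refine (integral_congr_ae ?_).trans_le (hcell _ (M.totalDegree_le v T) (M.center T) h
      (M.cell T) hh (hsize.trans (le_max_left _ _)) (M.measurableSet_cell T)
      (M.isStarShaped_cell T).1 (M.cell_subset_closedBall hσ hh T))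
    filter_upwards [M.toL2_ae_eq_polyEval v T] with x hx
    rw [hx]
  · rw [← Finset.mul_sum]
    refine mul_le_mul_of_nonneg_left (sum_rpow_le_rpow_sum _ (fun T => ?_) ?_) hC.le
    · exact integral_nonneg fun x => Real.rpow_nonneg (norm_nonneg _) _
    · exact (one_le_div hβ₀).2 hβ2

end FiniteElementEstimates

section Dissipation

lemma add_rpow_le_two_rpow_mul {a b β : ℝ} (ha : 0 ≤ a) (hb : 0 ≤ b) (hβ : 0 ≤ β) :
    (a + b) ^ β ≤ 2 ^ β * (a ^ β + b ^ β) := by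
  have hmax : max a b ^ β ≤ a ^ β + b ^ β := by
    rcases max_cases a b with ⟨h, -⟩ | ⟨h, -⟩ <;> rw [h]
    · linarith [Real.rpow_nonneg hb β]
    · linarith [Real.rpow_nonneg ha β]
  calc (a + b) ^ β ≤ (2 * max a b) ^ β :=
        Real.rpow_le_rpow (by positivity) (by linarith [le_max_left a b, le_max_right a b]) hβ
    _ = 2 ^ β * max a b ^ β := Real.mul_rpow two_pos.le (le_max_of_le_left ha)
    _ ≤ _ := by gcongr

lemma rpow_le_one_add_sq {b β : ℝ} (hb : 0 ≤ b) (hβ : 0 ≤ β) (hβ2 : β ≤ 2) :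
    b ^ β ≤ 1 + b ^ 2 := by
  rcases le_total b 1 with h | h
  · linarith [Real.rpow_le_one hb h hβ, sq_nonneg b]
  · have := Real.rpow_le_rpow_of_exponent_le h hβ2
    rw [Real.rpow_two] at this
    linarith

namespace GenPoly

variable (P : GenPoly)

lemma exists_norm_rpow_le (E : Type*) [NormedAddCommGroup E] [InnerProductSpace ℝ E] :
    ∃ C : ℝ, 0 < C ∧ ∀ x y : E,
      ‖x‖ ^ P.β ≤ C * (1 + inner ℝ (P.field y) y + ‖y - x‖ ^ 2) := by
  obtain ⟨C, hC, hg⟩ := P.exists_rpow_le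
  have hβ : 0 ≤ P.β := by linarith [P.one_lt_β]
  refine ⟨2 ^ P.β * (C + 1), by positivity, fun x y => ?_⟩
  have hinner : 0 ≤ inner ℝ (P.field y) y :=
    (P.fieldGradient E).inner_field_nonneg P.coeff_zero_pos.le y
  have hy : ‖y‖ ^ P.β ≤ C * (1 + inner ℝ (P.field y) y) := by
    rw [inner_field_self]
    exact hg _ (norm_nonneg y)
  have hdiff : ‖y - x‖ ^ P.β ≤ 1 + ‖y - x‖ ^ 2 :=
    rpow_le_one_add_sq (norm_nonneg _) hβ P.β_lt_two.le
  calc ‖x‖ ^ P.β ≤ (‖y‖ + ‖y - x‖) ^ P.β :=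
        Real.rpow_le_rpow (norm_nonneg _) (by simpa using norm_sub_le y (y - x)) hβ
    _ ≤ 2 ^ P.β * (‖y‖ ^ P.β + ‖y - x‖ ^ P.β) :=
        add_rpow_le_two_rpow_mul (norm_nonneg _) (norm_nonneg _) hβ
    _ ≤ 2 ^ P.β * ((C + 1) * (1 + inner ℝ (P.field y) y + ‖y - x‖ ^ 2)) := by
        gcongr
        linarith [mul_nonneg hC.le (sq_nonneg ‖y - x‖)]
    _ = _ := by ring

lemma exists_integral_norm_rpow_le {α : Type*} [MeasurableSpace α] (μ : Measure α)
    [IsFiniteMeasure μ] (E : Type*) [NormedAddCommGroup E] [InnerProductSpace ℝ E] :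
    ∃ C : ℝ, 0 < C ∧ ∀ G p : Lp E 2 μ, ∫ x, ‖G x‖ ^ P.β ∂μ
      ≤ C * (1 + inner ℝ ((P.fieldGradient E).compLp P.coeff_zero_pos p) p + ‖p - G‖ ^ 2) := by
  obtain ⟨C, hC, hbound⟩ := P.exists_norm_rpow_le E
  refine ⟨C * (μ.real univ + 1), by positivity, fun G p => ?_⟩
  have hinner : Integrable (fun x => inner ℝ (P.field (p x)) (p x)) μ :=
    (P.fieldGradient E).integrable_inner_field P.coeff_zero_pos p p
  have hone : Integrable (fun x => 1 + inner ℝ (P.field (p x)) (p x)) μ :=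
    (integrable_const 1).add hinner
  have hsub : Integrable (fun x => ‖(p - G) x‖ ^ 2) μ :=
    (Lp.memLp _).integrable_norm_pow two_ne_zero
  have hinner₀ : 0 ≤ inner ℝ ((P.fieldGradient E).compLp P.coeff_zero_pos p) p :=
    ((P.fieldGradient E).lp P.coeff_zero_pos μ).inner_field_nonneg P.coeff_zero_pos.le p
  calc ∫ x, ‖G x‖ ^ P.β ∂μ
      ≤ ∫ x, C * (1 + inner ℝ (P.field (p x)) (p x) + ‖(p - G) x‖ ^ 2) ∂μ := by
        refine integral_mono_of_nonneg
          (Filter.Eventually.of_forall fun x => Real.rpow_nonneg (norm_nonneg _) _)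
          ((hone.add hsub).const_mul C) ?_
        filter_upwards [Lp.coeFn_sub p G] with x hx
        rw [hx]
        exact hbound _ _
    _ = C * (μ.real univ + inner ℝ ((P.fieldGradient E).compLp P.coeff_zero_pos p) p
          + ‖p - G‖ ^ 2) := by
        rw [integral_const_mul, integral_add hone hsub,
          integral_add (integrable_const 1) hinner, norm_lp_two_sq_eq_integral,
          CocoerciveGradient.inner_compLp, integral_const, smul_eq_mul, mul_one]
        rfl
    _ ≤ C * ((μ.real univ + 1) * (1 + inner ℝ ((P.fieldGradient E).compLp P.coeff_zero_pos p) p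
          + ‖p - G‖ ^ 2)) := by
        gcongr
        linarith [mul_nonneg (measureReal_nonneg (μ := μ) (s := univ)) hinner₀,
          mul_nonneg (measureReal_nonneg (μ := μ) (s := univ)) (sq_nonneg ‖p - G‖)]
    _ = _ := by ring

lemma degree_condition {d : ℕ} (hdeg : P.a ≤ 4 / ((d : ℝ) + 2)) : 2 * d / P.β ≤ d + 2 := by
  have hd : (0 : ℝ) < d + 2 := by positivity
  have hβ := P.one_lt_β
  rw [le_div_iff₀ hd] at hdeg
  rw [div_le_iff₀ (by linarith), GenPoly.β]
  linarith

lemma exists_norm_sub_piecewiseConst_rpow_le {d : ℕ} (hd : 0 < d)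
    (hdeg : P.a ≤ 4 / ((d : ℝ) + 2)) {Ω : Set (Space d)} (hΩ : Bornology.IsBounded Ω) (r : ℕ)
    {σ : ℝ} (hσ : 0 < σ) :
    ∃ C : ℝ, 0 < C ∧ ∀ h, 0 < h → ∀ (M : Mesh Ω σ h) (v : M.PolySpace r) (p : L2Vec Ω),
      ∃ c, ‖M.toL2 r v - M.toL2 r (M.piecewiseConst r c)‖ ^ P.β
        ≤ C * (1 + inner ℝ ((P.fieldGradient (Space d)).compLp P.coeff_zero_pos p) p
          + ‖p - M.gradL2 r v‖ ^ 2) := by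
  have hβ : 0 < P.β := by linarith [P.one_lt_β]
  have : IsFiniteMeasure (volume.restrict Ω) :=
    ⟨by simpa only [Measure.restrict_apply_univ] using hΩ.measure_lt_top⟩
  obtain ⟨C₁, hC₁, hpoincare⟩ := Mesh.exists_norm_sub_piecewiseConst_sq_le hd r hσ P.one_lt_β
    P.β_lt_two.le (P.degree_condition hdeg) hΩ
  obtain ⟨C₂, hC₂, hdissip⟩ := P.exists_integral_norm_rpow_le (volume.restrict Ω) (Space d)
  refine ⟨C₁ ^ (P.β / 2) * C₂, by positivity, fun h hh M v p => ?_⟩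
  obtain ⟨c, hc⟩ := hpoincare h hh M v
  refine ⟨c, ?_⟩
  set n := ‖M.toL2 r v - M.toL2 r (M.piecewiseConst r c)‖
  set I := ∫ x in Ω, ‖M.gradL2 r v x‖ ^ P.β
  have hI : 0 ≤ I := integral_nonneg fun x => Real.rpow_nonneg (norm_nonneg _) _
  calc n ^ P.β = (n ^ 2) ^ (P.β / 2) := by
        rw [← Real.rpow_two, ← Real.rpow_mul (norm_nonneg _), mul_div_cancel₀ _ two_ne_zero]
    _ ≤ (C₁ * I ^ (2 / P.β)) ^ (P.β / 2) := by gcongr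
    _ = C₁ ^ (P.β / 2) * I := by
        rw [Real.mul_rpow hC₁.le (Real.rpow_nonneg hI _), ← Real.rpow_mul hI,
          div_mul_div_cancel₀ hβ.ne', div_self two_ne_zero, Real.rpow_one]
    _ ≤ C₁ ^ (P.β / 2) * (C₂ * _) := by
        gcongr
        exact hdissip _ p
    _ = _ := by ring

end GenPoly

end Dissipation

/-! ### The semidiscrete problem -/

section SemidiscreteSystem

namespace Mesh

variable {d : ℕ} {Ω : Set (Space d)} {σ h : ℝ} (M : Mesh Ω σ h) {r : ℕ}

lemma ker_toL2_le_ker_gradL2 (hσ : 0 < σ) (hh : 0 < h) (r : ℕ) :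
    (M.toL2 r).ker ≤ (M.gradL2 r).ker := fun v hv => by
  obtain ⟨C, -, hinv⟩ := exists_norm_gradL2_sq_le d r hσ
  have hle := hinv Ω h hh M v
  rw [LinearMap.mem_ker.1 hv, norm_zero, zero_pow two_ne_zero, mul_zero] at hle
  exact norm_eq_zero.1 (sq_eq_zero_iff.1 (hle.antisymm (sq_nonneg _)))

/-- The elementwise gradient on `W_h` regarded as a subspace of `L²(Ω)`; the inverse inequality
makes it independent of the polynomials representing a given function. -/
noncomputable def rangeGrad (hσ : 0 < σ) (hh : 0 < h) (r : ℕ) :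
    (M.toL2 r).range →L[ℝ] L2Vec Ω :=
  (((M.toL2 r).ker.liftQ (M.gradL2 r) (M.ker_toL2_le_ker_gradL2 hσ hh r)).comp
    (M.toL2 r).quotKerEquivRange.symm.toLinearMap).toContinuousLinearMap

lemma rangeGrad_rangeRestrict (hσ : 0 < σ) (hh : 0 < h) (v : M.PolySpace r) :
    M.rangeGrad hσ hh r ((M.toL2 r).rangeRestrict v) = M.gradL2 r v := by
  simp only [rangeGrad, LinearMap.coe_toContinuousLinearMap', LinearMap.comp_apply,
    LinearEquiv.coe_coe]
  exact congrArg _ ((M.toL2 r).quotKerEquivRange_symm_apply_image v _)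

/-- The underlying function of an element of `H¹(Ω)`, projected onto `W_h`. -/
noncomputable def rangeProj (r : ℕ) : H1 Ω →L[ℝ] (M.toL2 r).range :=
  (M.toL2 r).range.orthogonalProjectionOnto ∘L WithLp.fstL 2 ℝ (L2 Ω) (L2Vec Ω) ∘L (H1 Ω).subtypeL

lemma rangeProj_apply (φ : H1 Ω) :
    M.rangeProj r φ = (M.toL2 r).rangeRestrict (M.proj r (H1.fn φ)) :=
  Subtype.ext (M.toL2_proj (H1.fn φ)).symm

lemma inner_compLp_gradL2 (P : GenPoly) (v w : M.PolySpace r) :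
    inner ℝ ((P.fieldGradient (Space d)).compLp P.coeff_zero_pos (M.gradL2 r v)) (M.gradL2 r w)
      = ∫ x in Ω, inner ℝ (P.K ‖M.grad v x‖ • M.grad v x) (M.grad w x) := by
  rw [CocoerciveGradient.inner_compLp]
  refine integral_congr_ae ?_
  filter_upwards [M.coeFn_gradL2 v, M.coeFn_gradL2 w] with x hv hw
  rw [hv, hw]
  rfl

variable {P : GenPoly} {c C : ℝ} (hσ : 0 < σ) (hh : 0 < h)
  (hproj : ∀ φ : H1 Ω, ‖M.gradL2 r (M.proj r (H1.fn φ))‖ ^ 2 ≤ c * ‖φ‖ ^ 2)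
  (hpoincare : ∀ (v : M.PolySpace r) (p : L2Vec Ω),
    ∃ c, ‖M.toL2 r v - M.toL2 r (M.piecewiseConst r c)‖ ^ P.β
      ≤ C * (1 + inner ℝ ((P.fieldGradient (Space d)).compLp P.coeff_zero_pos p) p
        + ‖p - M.gradL2 r v‖ ^ 2))

/-- The semidiscrete problem as a Galerkin system. -/
noncomputable def galerkinSystem :
    GalerkinSystem (M.toL2 r).range (L2Vec Ω) (H1 Ω) (P.coeff 0) c C P.β where
  A := (P.fieldGradient (Space d)).lp P.coeff_zero_pos (volume.restrict Ω)
  grad := M.rangeGrad hσ hh r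
  lift := M.rangeGrad hσ hh r ∘L M.rangeProj r
  norm_lift_sq_le φ := by
    rw [ContinuousLinearMap.comp_apply, rangeProj_apply, rangeGrad_rangeRestrict]
    exact hproj φ
  poincare w p := by
    obtain ⟨v, rfl⟩ := (M.toL2 r).surjective_rangeRestrict w
    obtain ⟨c, hc⟩ := hpoincare v p
    refine ⟨(M.toL2 r).rangeRestrict (M.piecewiseConst r c), ?_, ?_⟩
    · exact (M.rangeGrad_rangeRestrict hσ hh _).trans (M.gradL2_piecewiseConst c)
    · rw [rangeGrad_rangeRestrict]
      exact hc

lemma flux_galerkinSystem {φ : ℝ → H1 Ω} {u : ℝ → M.PolySpace r} (t : ℝ) :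
    (M.galerkinSystem hσ hh hproj hpoincare).flux φ (fun t => (M.toL2 r).rangeRestrict (u t)) t
      = M.gradL2 r (u t + M.proj r (H1.fn (φ t))) := by
  rw [map_add, ← M.rangeGrad_rangeRestrict hσ hh (u t),
    ← M.rangeGrad_rangeRestrict hσ hh (M.proj r (H1.fn (φ t))), ← rangeProj_apply]
  rfl

lemma IsSemidiscreteSolution.isSolution {φ φt : ℝ → H1 Ω} {F Ft : ℝ → L2 Ω} {u₀ : L2 Ω}
    {u ut : ℝ → M.PolySpace r}
    (hφ : ∀ t, 0 ≤ t → HasDerivWithinAt φ (φt t) (Ici 0) t)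
    (hF : ∀ t, 0 ≤ t → HasDerivWithinAt F (Ft t) (Ici 0) t)
    (hu : M.IsSemidiscreteSolution P φ F u₀ u ut) :
    (M.galerkinSystem hσ hh hproj hpoincare).IsSolution φ φt F Ft
      (fun t => (M.toL2 r).rangeRestrict (u t)) (fun t => (M.toL2 r).rangeRestrict (ut t)) where
  data_hasDerivWithinAt := hφ
  source_hasDerivWithinAt := hF
  continuousOn := Topology.IsInducing.subtypeVal.continuousOn_iff.2 hu.continuousOn
  hasDerivAt t ht := by
    have hS (v : M.PolySpace r) :
        (M.toL2 r).range.orthogonalProjectionOnto (M.toL2 r v) = (M.toL2 r).rangeRestrict v :=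
      Submodule.orthogonalProjectionOnto_mem_subspace_eq_self ((M.toL2 r).rangeRestrict v)
    have hderiv := (M.toL2 r).range.orthogonalProjectionOnto.hasFDerivAt.comp_hasDerivAt t
      (hu.hasDerivAt t ht)
    simpa only [Function.comp_def, hS] using hderiv
  equation t ht w := by
    obtain ⟨w, rfl⟩ := (M.toL2 r).surjective_rangeRestrict w
    have hgrad : (M.galerkinSystem hσ hh hproj hpoincare).grad ((M.toL2 r).rangeRestrict w)
        = M.gradL2 r w := M.rangeGrad_rangeRestrict hσ hh w
    rw [flux_galerkinSystem, hgrad, Submodule.coe_inner]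
    exact (congrArg _ (M.inner_compLp_gradL2 P _ w)).trans (hu.equation t ht w)

end Mesh

end SemidiscreteSystem

end Forchheimer

open Forchheimer in
theorem theorem4p5_general (P : GenPoly) (d : ℕ) (hd : 0 < d) (hdeg : P.a ≤ 4 / ((d : ℝ) + 2))
    (Ω : Set (Space d)) (hΩ : Bornology.IsBounded Ω) (r : ℕ) (σ : ℝ) (hσ : 0 < σ) :
    ∃ C : ℝ, 0 < C ∧
      ∀ (h : ℝ) (_ : 0 < h) (M : Mesh Ω σ h) (φ φt : ℝ → H1 Ω) (F Ft : ℝ → L2 Ω) (u₀ : L2 Ω)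
        (u ut : ℝ → M.PolySpace r)
        (_ : ∀ t, 0 ≤ t → HasDerivWithinAt φ (φt t) (Ici 0) t)
        (_ : ∀ t, 0 ≤ t → HasDerivWithinAt F (Ft t) (Ici 0) t)
        (_ : M.IsSemidiscreteSolution P φ F u₀ u ut) (t E : ℝ) (_ : 1 ≤ t)
        (_ : ∀ s ∈ Icc 0 t, ‖F s‖ ^ P.lam + ‖φ s‖ ^ 2 ≤ E)
        (_ : IntervalIntegrable (fun s => ‖φt s‖ ^ 2) volume (t - 1) t)
        (_ : IntervalIntegrable (fun s => ‖Ft s‖ ^ 2) volume (t - 1) t),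
        ‖M.toL2 r (ut t)‖ ^ 2 ≤ C * (1 + ‖u₀‖ ^ 2 + E ^ (2 / P.β)
          + ∫ s in (t - 1)..t, (‖φt s‖ ^ 2 + ‖Ft s‖ ^ 2)) := by
  obtain ⟨c, hc, hproj⟩ := Mesh.exists_norm_gradL2_proj_sq_le d r hσ
  obtain ⟨C₁, hC₁, hpoincare⟩ := P.exists_norm_sub_piecewiseConst_rpow_le hd hdeg hΩ r hσ
  obtain ⟨C, hC, hbound⟩ := GalerkinSystem.exists_norm_deriv_sq_le (L2 Ω) (L2Vec Ω) (H1 Ω)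
    P.coeff_zero_pos hc.le hC₁ P.holderConjugate P.β_lt_two.le
  refine ⟨C, hC, fun h hh M φ φt F Ft u₀ u ut hφ hF hu t E ht hE hφt hFt => ?_⟩
  have hsol := hu.isSolution M hσ hh (hproj Ω h hh M) (hpoincare h hh M) hφ hF
  have hinit : ‖M.toL2 r (u 0)‖ ≤ ‖u₀‖ := hu.initial ▸ M.norm_toL2_proj_le u₀
  refine (hbound _ _ _ _ _ _ _ _ hsol t E ht hE hφt hFt).trans ?_
  gcongr
  exact hinit

theorem theorem4p5 (P : Forchheimer.GenPoly) (d : ℕ) (hd : 2 ≤ d)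
    (hdeg : P.a ≤ 4 / ((d : ℝ) + 2))
    (Ω : Set (Forchheimer.Space d)) (hΩo : IsOpen Ω) (hΩb : Bornology.IsBounded Ω)
    (r : ℕ) (σ : ℝ) (hσ : 0 < σ) :
    ∃ C : ℝ, 0 < C ∧
      ∀ (h : ℝ) (_ : 0 < h) (M : Forchheimer.Mesh Ω σ h)
        (φ φt : ℝ → Forchheimer.H1 Ω) (f F Ft : ℝ → Forchheimer.L2 Ω) (ρ₀ : Forchheimer.L2 Ω)
        (u ut : ℝ → M.PolySpace r) (Env : ℝ → ℝ)
        (_ : ∀ t, 0 ≤ t → HasDerivWithinAt φ (φt t) (Set.Ici 0) t)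
        (_ : ∀ t, 0 ≤ t → F t = f t - Forchheimer.H1.fn (φt t))
        (_ : ∀ t, 0 ≤ t → HasDerivWithinAt F (Ft t) (Set.Ici 0) t)
        (_ : ∀ t, 1 ≤ t → IntervalIntegrable (fun s => ‖φt s‖ ^ 2) MeasureTheory.volume (t - 1) t)
        (_ : ∀ t, 1 ≤ t → IntervalIntegrable (fun s => ‖Ft s‖ ^ 2) MeasureTheory.volume (t - 1) t)
        (_ : M.IsSemidiscreteSolution P φ F (ρ₀ - Forchheimer.H1.fn (φ 0)) u ut)
        (_ : Forchheimer.IsEnvelope (Set.Ici 0) (fun t => ‖F t‖ ^ P.lam + ‖φ t‖ ^ 2) Env),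
        ∀ t, 1 ≤ t →
          ‖M.toL2 r (ut t)‖ ^ 2 ≤
            C * (1 + ‖ρ₀ - Forchheimer.H1.fn (φ 0)‖ ^ 2 + Env t ^ (2 / P.β)
              + ∫ s in (t - 1)..t, (‖φt s‖ ^ 2 + ‖Ft s‖ ^ 2)) := by
  obtain ⟨C, hC, hbound⟩ := theorem4p5_general P d (by omega) hdeg Ω hΩb r σ hσ
  exact ⟨C, hC, fun h hh M φ φt _ F Ft _ u ut Env hφ _ hF hφt hFt hu hEnv t ht =>
    hbound h hh M φ φt F Ft _ u ut hφ hF hu t (Env t) ht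
      (fun s hs => (hEnv.2.2 s hs.1).trans (hEnv.2.1 hs.1 (hs.1.trans hs.2) hs.2))
      (hφt t ht) (hFt t ht)⟩
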